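/- **Setting.** Let $\Theta\subseteq\mathbb R^d$ be open, $\theta_0\in\Theta$, let $\mu$ be a $\sigma$-finite measure on a measurable space $\mathcal Y$, and let $\{P_\theta:\theta\in\Theta\}$ be probability measures on $\mathcal Y$ with densities $p_\theta=dP_\theta/d\mu$ jointly measurable in $(\theta,y)$. A sample $\mathbf y=(y_1,\dots,y_n)$ consists of independent observations with law $P_{\theta}$; write $P^n_\theta$ for its law, $\mu^n$ for the product of $n$ copies of $\mu$, and $p(\mathbf y,\theta)=\prod_{i=1}^n p_\theta(y_i)$ for the likelihood. For each $n$ let $J(\mathbf y,\theta)\in[0,\infty)$ be jointly measurable (the Jacobian function of the data generating algorithm). The generalized fiducial distribution has Lebesgue density on $\Theta$ $$r(\theta\mid\mathbf y)=\frac{p(\mathbf y,\theta)J(\mathbf y,\theta)}{\int_\Theta p(\mathbf y,\theta')J(\mathbf y,\theta')\,d\theta'},$$ where the normalizing integral is supposed to be finite with $P^n_{\theta_0}$-probability tending to $1$. Let $r_{H_n\mid Y_n}$ be the distribution of $h=\sqrt n(\theta-\theta_0)$ when $\theta\sim r(\cdot\mid\mathbf y)$. **Assumptions.** 1. (Differentiability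 in quadratic mean.) There is a measurable $\dot\ell_{\theta_0}:\mathcal Y\to\mathbb R^d$ with $\int\big(\sqrt{p_{\theta_0+h}}-\sqrt{p_{\theta_0}}-\tfrac12h^\top\dot\ell_{\theta_0}\sqrt{p_{\theta_0}}\big)^2d\mu=o(\|h\|^2)$ as $h\to0$, and the Fisher information matrix $I_{\theta_0}=\int\dot\ell_{\theta_0}\dot\ell_{\theta_0}^\top dP_{\theta_0}$ is non-singular. 2. (Convergence of the Jacobian.) There are $D>0$ and a measurable $\pi\ge0$ such that $$\sup_{\theta\in\Theta:\ \|\theta-\theta_0\|\le D}\frac{|J(\mathbf y,\theta)-\pi(\theta)|}{J(\mathbf y,\theta)}\to0\quad\text{in }P^n_{\theta_0}\text{-probability}$$ (with $a/0=\infty$ for $a>0$ and $0/0=0$). 3. (Mass of the limiting measure.) $\pi$ is continuous at $\theta_0$ and $\pi(\theta_0)>0$. 4. (Likelihood splitting.) For each $n$ there are jointly measurable $p^1(\mathbf y,\theta),p^2(\mathbf y,\theta)\in[0,\infty)$ such that, for every $\theta\in\Theta$, $p(\mathbf y,\theta)=p^1(\mathbf y,\theta)p^2(\mathbf y,\theta)$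 for $\mu^n$-almost every $\mathbf y$, and there is a measurable $\gamma\ge0$, not depending on $n$, with $\int_\Theta\gamma(\theta)\,d\theta<\infty$ such that, for the same $D$, $$P^n_{\theta_0}\big(p^2(\mathbf y,\theta)J(\mathbf y,\theta)\le\gamma(\theta)\text{ for all }\theta\in\Theta\text{ with }\|\theta-\theta_0\|>D\big)\to1.$$ 5. (Exponentially consistent tests.) For every $\varepsilon>0$ there are measurable tests $\delta_n:\mathcal Y^n\to[0,1]$ and a constant $c>0$ such that $P^n_{\theta_0}\delta_n\to0$ and, for every $n$ and every $\theta\in\Theta$ with $\|\theta-\theta_0\|\ge\varepsilon$, $$P^n_\theta(1-\delta_n)\le e^{-cn(\|\theta-\theta_0\|^2\wedge1)}\quad\text{and}\quad\int(1-\delta_n)\,p^1(\cdot,\theta)\,d\mu^n\le e^{-cn(\|\theta-\theta_0\|^2\wedge1)}.$$ **Theorem.** Under these assumptions, with $\Delta_{n,\theta_0}=\frac1{\sqrt n}\sum_{i=1}^nI_{\theta_0}^{-1}\dot\ell_{\theta_0}(y_i)$, $$\big\|r_{H_n\mid Y_n}-N(\Delta_{n,\theta_0},I_{\theta_0}^{-1})\big\|_{TV}\to0\quad\text{in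 }P^n_{\theta_0}\text{-probability}.$$ -/

import Mathlib

open MeasureTheory ProbabilityTheory Filter Topology
open scoped ENNReal NNReal

namespace GFD

variable {𝒴 : Type*} [MeasurableSpace 𝒴] {d : ℕ}

/-- The law `P_θ` of one observation: density `p θ` with respect to the dominating measure `μ`. -/
noncomputable def obsLaw (μ : Measure 𝒴) (p : EuclideanSpace ℝ (Fin d) → 𝒴 → ℝ≥0)
    (θ : EuclideanSpace ℝ (Fin d)) : Measure 𝒴 :=
  μ.withDensity fun y => (p θ y : ℝ≥0∞)

/-- The law `P^n_θ` of a sample of `n` independent observations with law `P_θ`. -/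
noncomputable def sampleLaw (μ : Measure 𝒴) (p : EuclideanSpace ℝ (Fin d) → 𝒴 → ℝ≥0)
    (n : ℕ) (θ : EuclideanSpace ℝ (Fin d)) : Measure (Fin n → 𝒴) :=
  Measure.pi fun _ => obsLaw μ p θ

/-- The likelihood `p(y, θ) = ∏ i, p_θ(y_i)` of a sample `y = (y_1, …, y_n)`. -/
noncomputable def likelihood (p : EuclideanSpace ℝ (Fin d) → 𝒴 → ℝ≥0) (n : ℕ)
    (y : Fin n → 𝒴) (θ : EuclideanSpace ℝ (Fin d)) : ℝ≥0 :=
  ∏ i, p θ (y i)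

/-- `p` is a parametric family of probability densities with respect to `μ`, indexed by `Θ`,
jointly measurable in the parameter and the observation. -/
structure IsDensityFamily (μ : Measure 𝒴) (Θ : Set (EuclideanSpace ℝ (Fin d)))
    (p : EuclideanSpace ℝ (Fin d) → 𝒴 → ℝ≥0) : Prop where
  measurable : Measurable (Function.uncurry p)
  lintegral_eq_one : ∀ θ ∈ Θ, ∫⁻ y, (p θ y : ℝ≥0∞) ∂μ = 1

/-- Convergence to zero in probability of `[0, ∞]`-valued variables, the `n`-th of which lives on
its own space with law `P n`. For a variable that is not measurable, `P n` is the outer measure. -/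
def TendstoZeroInProb {Ω : ℕ → Type*} [∀ n, MeasurableSpace (Ω n)]
    (P : ∀ n, Measure (Ω n)) (X : ∀ n, Ω n → ℝ≥0∞) : Prop :=
  ∀ ε : ℝ≥0∞, 0 < ε → Tendsto (fun n => P n {ω | ε ≤ X n ω}) atTop (𝓝 0)

/-- Differentiability in quadratic mean at `θ₀` with score function `ℓ`:
`∫ (√p_{θ₀+h} - √p_{θ₀} - ½ ⟨h, ℓ⟩ √p_{θ₀})² dμ = o(‖h‖²)` as `h → 0`. -/
def DQMAt (μ : Measure 𝒴) (p : EuclideanSpace ℝ (Fin d) → 𝒴 → ℝ≥0)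
    (θ₀ : EuclideanSpace ℝ (Fin d)) (ℓ : 𝒴 → EuclideanSpace ℝ (Fin d)) : Prop :=
  Measurable ℓ ∧ ∀ ε : ℝ, 0 < ε → ∀ᶠ h in 𝓝 (0 : EuclideanSpace ℝ (Fin d)),
    ∫⁻ y, ENNReal.ofReal ((√(p (θ₀ + h) y : ℝ) - √(p θ₀ y : ℝ)
      - 1 / 2 * inner ℝ h (ℓ y) * √(p θ₀ y : ℝ)) ^ 2) ∂μ ≤ ENNReal.ofReal (ε * ‖h‖ ^ 2)

/-- The Fisher information matrix `I_{θ₀} = P_{θ₀} ℓ ℓᵀ`. -/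
noncomputable def fisherInfo (μ : Measure 𝒴) (p : EuclideanSpace ℝ (Fin d) → 𝒴 → ℝ≥0)
    (θ₀ : EuclideanSpace ℝ (Fin d)) (ℓ : 𝒴 → EuclideanSpace ℝ (Fin d)) :
    Matrix (Fin d) (Fin d) ℝ :=
  Matrix.of fun i j => ∫ y, ℓ y i * ℓ y j ∂(obsLaw μ p θ₀)

/-- `Δ_{n,θ₀} = n^{-1/2} ∑ i, I_{θ₀}⁻¹ ℓ(y_i)`. -/
noncomputable def localStat (μ : Measure 𝒴) (p : EuclideanSpace ℝ (Fin d) → 𝒴 → ℝ≥0)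
    (θ₀ : EuclideanSpace ℝ (Fin d)) (ℓ : 𝒴 → EuclideanSpace ℝ (Fin d)) (n : ℕ)
    (y : Fin n → 𝒴) : EuclideanSpace ℝ (Fin d) :=
  (√(n : ℝ))⁻¹ • ∑ i, Matrix.toEuclideanLin (fisherInfo μ p θ₀ ℓ)⁻¹ (ℓ (y i))

/-- The normalizing constant `∫_Θ p(y, θ) J(y, θ) dθ` of the generalized fiducial density. -/
noncomputable def fiducialNormalizer (Θ : Set (EuclideanSpace ℝ (Fin d)))
    (p : EuclideanSpace ℝ (Fin d) → 𝒴 → ℝ≥0)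
    (J : ∀ n : ℕ, (Fin n → 𝒴) → EuclideanSpace ℝ (Fin d) → ℝ≥0) (n : ℕ) (y : Fin n → 𝒴) : ℝ≥0∞ :=
  ∫⁻ θ in Θ, (likelihood p n y θ : ℝ≥0∞) * (J n y θ : ℝ≥0∞)

/-- The generalized fiducial distribution of `θ`: the measure on `Θ` with Lebesgue density
`p(y, θ) J(y, θ) / ∫_Θ p(y, θ') J(y, θ') dθ'`. It is a probability measure if the normalizing
constant is positive and finite, and the zero measure otherwise. -/
noncomputable def fiducial (Θ : Set (EuclideanSpace ℝ (Fin d)))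
    (p : EuclideanSpace ℝ (Fin d) → 𝒴 → ℝ≥0)
    (J : ∀ n : ℕ, (Fin n → 𝒴) → EuclideanSpace ℝ (Fin d) → ℝ≥0) (n : ℕ) (y : Fin n → 𝒴) :
    Measure (EuclideanSpace ℝ (Fin d)) :=
  (fiducialNormalizer Θ p J n y)⁻¹ •
    (volume.restrict Θ).withDensity fun θ => (likelihood p n y θ : ℝ≥0∞) * (J n y θ : ℝ≥0∞)

/-- The generalized fiducial distribution of the local parameter `h = √n (θ - θ₀)`. -/
noncomputable def localFiducial (Θ : Set (EuclideanSpace ℝ (Fin d)))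
    (p : EuclideanSpace ℝ (Fin d) → 𝒴 → ℝ≥0)
    (J : ∀ n : ℕ, (Fin n → 𝒴) → EuclideanSpace ℝ (Fin d) → ℝ≥0)
    (θ₀ : EuclideanSpace ℝ (Fin d)) (n : ℕ) (y : Fin n → 𝒴) :
    Measure (EuclideanSpace ℝ (Fin d)) :=
  (fiducial Θ p J n y).map fun θ => √(n : ℝ) • (θ - θ₀)

/-- The total variation norm of the difference of two finite measures, normalized as
`2 * sup_B |P(B) - Q(B)|` (which is `2 ∫ (1 - p/q)₊ dQ` for probability measures). -/
noncomputable def tvNorm {E : Type*} [MeasurableSpace E] (P Q : Measure E) : ℝ≥0∞ :=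
  2 * ⨆ (B : Set E) (_ : MeasurableSet B), ENNReal.ofReal |P.real B - Q.real B|

/-- `J(y, ·)` converges to `π`, uniformly on `‖θ - θ₀‖ ≤ D` in relative error, in
`P^n_{θ₀}`-probability. The quotient is taken in `[0, ∞]`: it is `∞` where `J = 0 < π`. -/
def JacobianConverges (μ : Measure 𝒴) (Θ : Set (EuclideanSpace ℝ (Fin d)))
    (p : EuclideanSpace ℝ (Fin d) → 𝒴 → ℝ≥0)
    (J : ∀ n : ℕ, (Fin n → 𝒴) → EuclideanSpace ℝ (Fin d) → ℝ≥0)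
    (θ₀ : EuclideanSpace ℝ (Fin d)) (D : ℝ) (π : EuclideanSpace ℝ (Fin d) → ℝ≥0) : Prop :=
  TendstoZeroInProb (fun n => sampleLaw μ p n θ₀) fun n y =>
    ⨆ θ ∈ Θ ∩ Metric.closedBall θ₀ D,
      ENNReal.ofReal |(J n y θ : ℝ) - (π θ : ℝ)| / (J n y θ : ℝ≥0∞)

/-- Likelihood splitting `p = p¹ p²`, with `p² J` dominated off the ball `‖θ - θ₀‖ ≤ D` by `γ`,
the density of a finite measure on `Θ`, with `P^n_{θ₀}`-probability tending to one. -/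
structure LikelihoodSplits (μ : Measure 𝒴) (Θ : Set (EuclideanSpace ℝ (Fin d)))
    (p : EuclideanSpace ℝ (Fin d) → 𝒴 → ℝ≥0)
    (J : ∀ n : ℕ, (Fin n → 𝒴) → EuclideanSpace ℝ (Fin d) → ℝ≥0)
    (θ₀ : EuclideanSpace ℝ (Fin d)) (D : ℝ)
    (p₁ p₂ : ∀ n : ℕ, (Fin n → 𝒴) → EuclideanSpace ℝ (Fin d) → ℝ≥0)
    (γ : EuclideanSpace ℝ (Fin d) → ℝ≥0) : Prop where
  measurable_fst : ∀ n, Measurable (Function.uncurry (p₁ n))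
  measurable_snd : ∀ n, Measurable (Function.uncurry (p₂ n))
  split : ∀ n, ∀ θ ∈ Θ, ∀ᵐ y ∂(Measure.pi fun _ : Fin n => μ),
    likelihood p n y θ = p₁ n y θ * p₂ n y θ
  measurable_dom : Measurable γ
  finite_dom : ∫⁻ θ in Θ, (γ θ : ℝ≥0∞) < ∞
  dominated : Tendsto (fun n => sampleLaw μ p n θ₀
    {y | ¬ ∀ θ ∈ Θ, D < ‖θ - θ₀‖ → p₂ n y θ * J n y θ ≤ γ θ}) atTop (𝓝 0)

/-- Exponentially consistent tests of `θ₀` against `‖θ - θ₀‖ ≥ ε`, for every `ε > 0`, both for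
`P_θ` and for the measures `P¹_θ` with densities `p₁`. -/
def ExpConsistentTests (μ : Measure 𝒴) (Θ : Set (EuclideanSpace ℝ (Fin d)))
    (p : EuclideanSpace ℝ (Fin d) → 𝒴 → ℝ≥0) (θ₀ : EuclideanSpace ℝ (Fin d))
    (p₁ : ∀ n : ℕ, (Fin n → 𝒴) → EuclideanSpace ℝ (Fin d) → ℝ≥0) : Prop :=
  ∀ ε : ℝ, 0 < ε → ∃ (δ : ∀ n : ℕ, (Fin n → 𝒴) → ℝ) (c : ℝ), 0 < c ∧
    (∀ n, Measurable (δ n)) ∧ (∀ n y, δ n y ∈ Set.Icc (0 : ℝ) 1) ∧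
    Tendsto (fun n => ∫⁻ y, ENNReal.ofReal (δ n y) ∂(sampleLaw μ p n θ₀)) atTop (𝓝 0) ∧
    ∀ n, ∀ θ ∈ Θ, ε ≤ ‖θ - θ₀‖ →
      ∫⁻ y, ENNReal.ofReal (1 - δ n y) ∂(sampleLaw μ p n θ)
        ≤ ENNReal.ofReal (Real.exp (-(c * n * min (‖θ - θ₀‖ ^ 2) 1))) ∧
      ∫⁻ y, ENNReal.ofReal (1 - δ n y) * (p₁ n y θ : ℝ≥0∞) ∂(Measure.pi fun _ : Fin n => μ)
        ≤ ENNReal.ofReal (Real.exp (-(c * n * min (‖θ - θ₀‖ ^ 2) 1)))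

end GFD

/-!
The total variation distance of two normalized measures is controlled by the mass of the difference
of any unnormalized versions of their densities. In the local parameter `h = √n (θ - θ₀)` the
fiducial distribution has the unnormalized density `p(y, θ₀ + h/√n) J(y, θ₀ + h/√n)`, and the
Gaussian limit has the unnormalized density `π(θ₀) p(y, θ₀) exp (⟪h, S⟫ - ⟪h, I h⟫ / 2)`, where
`S = n^{-1/2} ∑ ℓ(y_i)`. It therefore suffices that the `L¹` distance of these two functions of `h`,
divided by the likelihood at `θ₀`, tends to zero in probability (`GFD.tvNorm_localFiducial_le`).
Dividing by the likelihood turns expectations under `P^n_{θ₀}` into integrals under `μ^n`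
(`GFD.lintegral_sampleLaw_div_le`), so that Fubini's theorem reduces everything to integrals in the
sample for fixed `h`, followed by an integral in `h`.

*Near `θ₀`*, `J` may be replaced by `π`, and dominated convergence in `h` applies on the event that
`S` and its truncations are bounded (`GFD.IsRegularAt.tendsto_localDiff`).

* For fixed `h`, the likelihood at `θ₀ + h/√n` is close in `L¹(μ^n)` to its Gaussian approximation
  (`GFD.IsRegularAt.tendsto_setLIntegral_likelihood_sub`). This is a form of local asymptotic
  normality that needs no central limit theorem: it compares the roots of two product densities,
  and the distance of products is controlled factor by factor
  (`GFD.tendsto_lintegral_prod_sq_sub`). The second density is an exponential tilt of `p_{θ₀}` by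
  the score truncated at a level `n^{1/4}`, which makes its exponential moments elementary
  (`GFD.tendsto_tilt`).
* A dominating function is obtained from a score truncated at a fixed level. Differentiability in
  quadratic mean gives it a drift of order `‖θ - θ₀‖` under `P_θ` (`GFD.IsRegularAt.exists_drift`),
  and an exponential moment bound converts the drift into the bound
  `exp (b M ‖h‖ - c ‖h‖²)` for the integral of the likelihood over the event that the truncated
  score sum is at most `M` (`GFD.IsRegularAt.exists_setLIntegral_likelihood_le`).

*Away from `θ₀`* the tests make the expected mass exponentially small, which beats the factor
`n^{d/2}` of the change of variables (`GFD.tendsto_fiducial_far`). Outside the ball of radius `D`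
the mass is dominated by `∫ p₁ γ` (`GFD.tendsto_fiducial_outside`). In the shell between a small
radius and `D` it is comparable to `∫ p π`; since `π` is not assumed integrable there, a fixed
number of observations is set aside, given which `π` becomes a finite measure with high probability,
and the tests are applied to the remaining observations (`GFD.tendsto_fiducial_shell`).
-/

namespace GFD

variable {𝒴 : Type*} [MeasurableSpace 𝒴] {d : ℕ}

/-! ### Product measures with densities -/

theorem lintegral_pi_prod {n : ℕ} (μ : Measure 𝒴) [SigmaFinite μ] (f : Fin n → 𝒴 → ℝ≥0∞)
    (hf : ∀ i, Measurable (f i)) :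
    ∫⁻ y, ∏ i, f i (y i) ∂(Measure.pi fun _ : Fin n => μ) = ∏ i, ∫⁻ y, f i y ∂μ := by
  induction n with
  | zero => simp
  | succ n ih =>
    have h := (measurePreserving_piFinSuccAbove (fun _ : Fin (n + 1) => μ) 0).symm
    rw [← h.lintegral_comp_emb (MeasurableEquiv.measurableEmbedding _)]
    simp_rw [MeasurableEquiv.piFinSuccAbove_symm_apply, Fin.insertNthEquiv,
      Fin.prod_univ_succ, Fin.insertNth_zero]
    simp only [Equiv.coe_fn_mk, Fin.cons_succ, Fin.cons_zero]
    rw [← ih (fun i => f i.succ) fun i => hf _]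
    refine lintegral_prod_mul (μ := μ) (ν := Measure.pi fun _ : Fin n => μ)
      (g := fun y => ∏ i : Fin n, f i.succ (y i)) (hf 0).aemeasurable ?_
    exact (Finset.measurable_prod _ fun i _ => (hf _).comp (measurable_pi_apply i)).aemeasurable

theorem pi_withDensity {n : ℕ} (μ : Measure 𝒴) [SigmaFinite μ] (f : 𝒴 → ℝ≥0)
    (hf : Measurable f) :
    Measure.pi (fun _ : Fin n => μ.withDensity fun y => (f y : ℝ≥0∞)) =
      (Measure.pi fun _ : Fin n => μ).withDensity fun y => ((∏ i, f (y i) : ℝ≥0) : ℝ≥0∞) := by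
  have hσ : SigmaFinite (μ.withDensity fun y => (f y : ℝ≥0∞)) :=
    SigmaFinite.withDensity_of_ne_top (ae_of_all _ fun _ => ENNReal.coe_ne_top)
  refine Measure.pi_eq (μ := fun _ : Fin n => μ.withDensity fun y => (f y : ℝ≥0∞))
    fun s hs => ?_
  rw [withDensity_apply _ (MeasurableSet.univ_pi hs), ← lintegral_indicator
    (MeasurableSet.univ_pi hs)]
  have h : ∀ y : Fin n → 𝒴, (Set.univ.pi s).indicator
      (fun y => ((∏ i, f (y i) : ℝ≥0) : ℝ≥0∞)) y
      = ∏ i, (s i).indicator (fun y => (f y : ℝ≥0∞)) (y i) := by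
    intro y
    by_cases hy : y ∈ Set.univ.pi s
    · rw [Set.indicator_of_mem hy, ENNReal.ofNNReal_finsetProd]
      exact Finset.prod_congr rfl fun i _ => by rw [Set.indicator_of_mem (hy i trivial)]
    · rw [Set.indicator_of_notMem hy]
      simp only [Set.mem_pi, Set.mem_univ, true_imp_iff, not_forall] at hy
      obtain ⟨i, hi⟩ := hy
      exact (Finset.prod_eq_zero (Finset.mem_univ i) (Set.indicator_of_notMem hi _)).symm
  simp_rw [h]
  rw [lintegral_pi_prod μ _ fun i => hf.coe_nnreal_ennreal.indicator (hs i)]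
  exact Finset.prod_congr rfl fun i _ => by
    rw [withDensity_apply _ (hs i), lintegral_indicator (hs i)]

theorem sampleLaw_eq_withDensity (μ : Measure 𝒴) [SigmaFinite μ]
    {p : EuclideanSpace ℝ (Fin d) → 𝒴 → ℝ≥0} {θ : EuclideanSpace ℝ (Fin d)}
    (hp : Measurable (p θ)) (n : ℕ) :
    sampleLaw μ p n θ = (Measure.pi fun _ : Fin n => μ).withDensity
      fun y => (likelihood p n y θ : ℝ≥0∞) :=
  pi_withDensity μ _ hp

theorem measurable_likelihood {p : EuclideanSpace ℝ (Fin d) → 𝒴 → ℝ≥0}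
    (hp : Measurable (Function.uncurry p)) (n : ℕ) :
    Measurable (Function.uncurry (likelihood p n)) := by
  have h : Measurable fun z : (Fin n → 𝒴) × EuclideanSpace ℝ (Fin d) => ∏ i, p z.2 (z.1 i) :=
    Finset.measurable_prod _ fun i _ =>
      hp.comp (measurable_snd.prodMk ((measurable_pi_apply i).comp measurable_fst))
  exact h

theorem measurable_likelihood_left {p : EuclideanSpace ℝ (Fin d) → 𝒴 → ℝ≥0}
    {θ : EuclideanSpace ℝ (Fin d)} (hp : Measurable (p θ)) (n : ℕ) :
    Measurable fun y : Fin n → 𝒴 => likelihood p n y θ :=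
  Finset.measurable_prod _ fun i _ => hp.comp (measurable_pi_apply i)

/-- Dividing by the likelihood at `θ` turns an integral under `μ^n` into an expectation under
`P^n_θ`, up to what `μ^n` charges where the likelihood vanishes. -/
theorem lintegral_sampleLaw_div_le (μ : Measure 𝒴) [SigmaFinite μ]
    {p : EuclideanSpace ℝ (Fin d) → 𝒴 → ℝ≥0} {θ : EuclideanSpace ℝ (Fin d)}
    (hp : Measurable (p θ)) (n : ℕ) (f : (Fin n → 𝒴) → ℝ≥0∞) :
    ∫⁻ y, f y / likelihood p n y θ ∂(sampleLaw μ p n θ)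
      ≤ ∫⁻ y, f y ∂(Measure.pi fun _ : Fin n => μ) := by
  rw [sampleLaw_eq_withDensity μ hp]
  refine (lintegral_withDensity_le_lintegral_mul _
    (measurable_likelihood_left hp n).coe_nnreal_ennreal _).trans (lintegral_mono fun y => ?_)
  exact ENNReal.mul_div_le

theorem isProbabilityMeasure_obsLaw {μ : Measure 𝒴} {p : EuclideanSpace ℝ (Fin d) → 𝒴 → ℝ≥0}
    {θ : EuclideanSpace ℝ (Fin d)} (h : ∫⁻ y, (p θ y : ℝ≥0∞) ∂μ = 1) :
    IsProbabilityMeasure (obsLaw μ p θ) :=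
  ⟨by rw [obsLaw, withDensity_apply _ MeasurableSet.univ, setLIntegral_univ, h]⟩

theorem isProbabilityMeasure_sampleLaw {μ : Measure 𝒴}
    {p : EuclideanSpace ℝ (Fin d) → 𝒴 → ℝ≥0}
    {θ : EuclideanSpace ℝ (Fin d)} (h : ∫⁻ y, (p θ y : ℝ≥0∞) ∂μ = 1) (n : ℕ) :
    IsProbabilityMeasure (sampleLaw μ p n θ) := by
  have := isProbabilityMeasure_obsLaw h
  unfold sampleLaw
  infer_instance

theorem sampleLaw_likelihood_eq_zero (μ : Measure 𝒴) [SigmaFinite μ]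
    {p : EuclideanSpace ℝ (Fin d) → 𝒴 → ℝ≥0} {θ : EuclideanSpace ℝ (Fin d)}
    (hp : Measurable (p θ)) (n : ℕ) :
    sampleLaw μ p n θ {y | likelihood p n y θ = 0} = 0 := by
  rw [sampleLaw_eq_withDensity μ hp, withDensity_apply_eq_zero
    (measurable_likelihood_left hp n).coe_nnreal_ennreal]
  convert measure_empty (μ := Measure.pi fun _ : Fin n => μ)
  ext y
  simp

/-- The splitting of a sample of `m + n` observations into its first `m` and its last `n`. -/
theorem measurePreserving_split (P : Measure 𝒴) [SigmaFinite P] (m n : ℕ) :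
    MeasurePreserving (fun y : Fin (m + n) → 𝒴 =>
        ((fun i => y (Fin.castAdd n i), fun i => y (Fin.natAdd m i)) :
          (Fin m → 𝒴) × (Fin n → 𝒴)))
      (Measure.pi fun _ => P) ((Measure.pi fun _ => P).prod (Measure.pi fun _ => P)) := by
  have h1 := (measurePreserving_piCongrLeft (fun _ : Fin (m + n) => P) finSumFinEquiv).symm
  have h2 := measurePreserving_sumPiEquivProdPi (fun _ : Fin m ⊕ Fin n => P)
  convert h2.comp h1 using 1
  funext y
  refine Prod.ext (funext fun i => ?_) (funext fun i => ?_) <;>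
  simp [MeasurableEquiv.sumPiEquivProdPi, MeasurableEquiv.piCongrLeft, Equiv.sumPiEquivProdPi]

/-! ### Convergence in probability -/

section InProb

variable {Ω : ℕ → Type*} [∀ n, MeasurableSpace (Ω n)] {P : ∀ n, Measure (Ω n)}

theorem TendstoZeroInProb.of_lintegral {X : ∀ n, Ω n → ℝ≥0∞}
    (hX : ∀ᶠ n in atTop, AEMeasurable (X n) (P n))
    (h : Tendsto (fun n => ∫⁻ ω, X n ω ∂P n) atTop (𝓝 0)) : TendstoZeroInProb P X := by
  intro ε hε
  by_cases hε' : ε = ∞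
  · have h1 : Tendsto (fun n => ∫⁻ ω, X n ω ∂P n) atTop (𝓝 0) := h
    refine tendsto_of_tendsto_of_tendsto_of_le_of_le' tendsto_const_nhds h1
      (Eventually.of_forall fun _ => zero_le) ?_
    filter_upwards [hX] with n hn
    calc P n {ω | ε ≤ X n ω} ≤ P n {ω | 1 ≤ X n ω} :=
          measure_mono fun ω hω => le_trans (by simp [hε']) (show ε ≤ X n ω from hω)
      _ ≤ _ := by simpa using mul_meas_ge_le_lintegral₀ hn 1
  have h1 : Tendsto (fun n => (∫⁻ ω, X n ω ∂P n) / ε) atTop (𝓝 0) := by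
    simpa using ENNReal.Tendsto.div_const h (Or.inr hε.ne')
  refine tendsto_of_tendsto_of_tendsto_of_le_of_le' tendsto_const_nhds h1
    (Eventually.of_forall fun _ => zero_le) ?_
  filter_upwards [hX] with n hn
  exact meas_ge_le_lintegral_div hn hε.ne' hε'

/-- It suffices to bound `X n`, outside events of probability at most `η`, by variables that
converge to zero in probability; these may depend on `η` and on the accuracy `ε`. -/
theorem TendstoZeroInProb.of_le {X : ∀ n, Ω n → ℝ≥0∞}
    (h : ∀ η : ℝ≥0∞, 0 < η → ∀ ε : ℝ≥0∞, 0 < ε → ε ≠ ∞ →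
      ∃ (G : ∀ n, Set (Ω n)) (Y : ∀ n, Ω n → ℝ≥0∞),
      (∀ᶠ n in atTop, P n (G n)ᶜ ≤ η) ∧ TendstoZeroInProb P Y ∧
      ∀ᶠ n in atTop, ∀ ω ∈ G n, X n ω ≤ Y n ω + ε) :
    TendstoZeroInProb P X := by
  intro ε hε
  rw [ENNReal.tendsto_atTop_zero]
  intro η hη
  have hη2 : 0 < η / 2 := ENNReal.half_pos hη.ne'
  obtain ⟨ε', hε', hε'2⟩ : ∃ ε' : ℝ≥0∞, 0 < ε' ∧ ε' ≠ ∞ ∧ ε' + ε' ≤ ε := by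
    by_cases h : ε = ∞
    · exact ⟨1, one_pos, by simp, by simp [h]⟩
    · exact ⟨ε / 2, ENNReal.half_pos hε.ne', by simp [ENNReal.div_eq_top, h],
        (ENNReal.add_halves ε).le⟩
  obtain ⟨G, Y, hG, hY, hXY⟩ := h _ hη2 ε' hε' hε'2.1
  have hY' := (ENNReal.tendsto_atTop_zero.1 (hY _ hε')) _ hη2
  obtain ⟨N, hN⟩ := eventually_atTop.1 (hG.and hXY)
  obtain ⟨N', hN'⟩ := hY'
  refine ⟨max N N', fun n hn => ?_⟩
  obtain ⟨h1, h2⟩ := hN n (le_of_max_le_left hn)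
  calc P n {ω | ε ≤ X n ω} ≤ P n ((G n)ᶜ ∪ {ω | ε' ≤ Y n ω}) := by
        refine measure_mono fun ω hω => ?_
        by_cases hωG : ω ∈ G n
        · right
          by_contra hlt
          have hlt' : Y n ω < ε' := not_le.1 hlt
          have h3 := h2 ω hωG
          have h4 : ε < ε' + ε' :=
            ((show ε ≤ X n ω from hω).trans h3).trans_lt (ENNReal.add_lt_add_right hε'2.1 hlt')
          exact absurd h4 (not_lt.2 hε'2.2)
        · exact Or.inl hωG
    _ ≤ η / 2 + η / 2 := (measure_union_le _ _).trans (add_le_add h1 (hN' n (le_of_max_le_right hn)))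
    _ = η := ENNReal.add_halves η

theorem TendstoZeroInProb.add {X Y : ∀ n, Ω n → ℝ≥0∞} (hX : TendstoZeroInProb P X)
    (hY : TendstoZeroInProb P Y) : TendstoZeroInProb P fun n ω => X n ω + Y n ω := by
  intro ε hε
  have hX' := hX (ε / 2) (ENNReal.half_pos hε.ne')
  have hY' := hY (ε / 2) (ENNReal.half_pos hε.ne')
  refine tendsto_of_tendsto_of_tendsto_of_le_of_le tendsto_const_nhds
    (by simpa using hX'.add hY') (fun _ => zero_le) fun n => ?_
  refine (measure_mono fun ω hω => ?_).trans (measure_union_le _ _)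
  by_contra hc
  simp only [Set.mem_union, Set.mem_ofPred_eq, not_or, not_le] at hc
  exact absurd (ENNReal.add_lt_add hc.1 hc.2) (not_lt.2 (by
    rw [ENNReal.add_halves]; exact hω))

theorem TendstoZeroInProb.const_mul {X : ∀ n, Ω n → ℝ≥0∞} (hX : TendstoZeroInProb P X)
    {c : ℝ≥0∞} (hc : c ≠ ∞) : TendstoZeroInProb P fun n ω => c * X n ω := by
  intro ε hε
  by_cases hc0 : c = 0
  · simp [hc0, hε.not_ge]
  refine (hX (ε / c) (ENNReal.div_pos hε.ne' hc)).congr fun n => ?_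
  congr 1
  ext ω
  simp only [Set.mem_ofPred_eq]
  rw [ENNReal.div_le_iff_le_mul (Or.inl hc0) (Or.inl hc), mul_comm]

end InProb

/-! ### Total variation of normalized densities -/

/-- Unnormalized densities that differ by at most `W` in mass on every set are, once normalized,
close in total variation. -/
theorem tvNorm_normalize_le {E : Type*} [MeasurableSpace E] (ν : Measure E) {q z : E → ℝ≥0∞}
    (hz : ∫⁻ x, z x ∂ν ≠ ∞) {W : ℝ≥0∞}
    (h₁ : ∀ B, MeasurableSet B → ∫⁻ x in B, q x ∂ν ≤ ∫⁻ x in B, z x ∂ν + W)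
    (h₂ : ∀ B, MeasurableSet B → ∫⁻ x in B, z x ∂ν ≤ ∫⁻ x in B, q x ∂ν + W)
    (hz0 : ∫⁻ x, z x ∂ν ≠ 0) :
    tvNorm ((∫⁻ x, q x ∂ν)⁻¹ • ν.withDensity q) ((∫⁻ x, z x ∂ν)⁻¹ • ν.withDensity z)
      ≤ 4 * (W / ∫⁻ x, z x ∂ν) := by
  rcases le_or_gt (∫⁻ x, z x ∂ν) W with hWz | hW
  · -- the bound is at least the maximal value of the total variation norm
    have h1 : 1 ≤ W / ∫⁻ x, z x ∂ν :=
      (ENNReal.le_div_iff_mul_le (Or.inl hz0) (Or.inl hz)).2 (by rwa [one_mul])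
    have hone : ∀ f : E → ℝ≥0∞, ∀ B, MeasurableSet B →
        ((∫⁻ x, f x ∂ν)⁻¹ • ν.withDensity f).real B ≤ 1 := fun f B hB => by
      refine ENNReal.toReal_le_of_le_ofReal zero_le_one ?_
      rw [Measure.smul_apply, withDensity_apply _ hB, smul_eq_mul, ENNReal.ofReal_one]
      exact (mul_le_mul_right (setLIntegral_le_lintegral _ _) _).trans (ENNReal.inv_mul_le_one _)
    calc tvNorm _ _ ≤ 2 * 1 := by
          unfold tvNorm
          gcongr
          refine iSup₂_le fun B hB => ENNReal.ofReal_le_one.2 (abs_le.2 ⟨?_, ?_⟩)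
          · linarith [hone z B hB, measureReal_nonneg (s := B)
              (μ := (∫⁻ x, q x ∂ν)⁻¹ • ν.withDensity q)]
          · linarith [hone q B hB, measureReal_nonneg (s := B)
              (μ := (∫⁻ x, z x ∂ν)⁻¹ • ν.withDensity z)]
      _ ≤ 4 * 1 := by norm_num
      _ ≤ _ := by gcongr
  have hWt : W ≠ ∞ := (hW.trans_le le_top).ne
  have e₁ := h₁ _ MeasurableSet.univ
  have e₂ := h₂ _ MeasurableSet.univ
  simp only [setLIntegral_univ] at e₁ e₂
  have hq : ∫⁻ x, q x ∂ν ≠ ∞ := (e₁.trans_lt (ENNReal.add_lt_top.2 ⟨hz.lt_top, hWt.lt_top⟩)).ne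
  have hqB : ∀ B, ∫⁻ x in B, q x ∂ν ≠ ∞ := fun B => ne_top_of_le_ne_top hq
    (setLIntegral_le_lintegral _ _)
  have hzB : ∀ B, ∫⁻ x in B, z x ∂ν ≠ ∞ := fun B => ne_top_of_le_ne_top hz
    (setLIntegral_le_lintegral _ _)
  have hq0 : ∫⁻ x, q x ∂ν ≠ 0 := by
    intro h
    rw [h, zero_add] at e₂
    exact absurd hW (not_lt.2 e₂)
  have key : ⨆ (B : Set E) (_ : MeasurableSet B), ENNReal.ofReal
      |((∫⁻ x, q x ∂ν)⁻¹ • ν.withDensity q).real B - ((∫⁻ x, z x ∂ν)⁻¹ • ν.withDensity z).real B|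
      ≤ 2 * (W / ∫⁻ x, z x ∂ν) := by
    refine iSup₂_le fun B hB => ENNReal.ofReal_le_of_le_toReal ?_
    have f₁ := ENNReal.toReal_mono (ENNReal.add_ne_top.2 ⟨hz, hWt⟩) e₁
    have f₂ := ENNReal.toReal_mono (ENNReal.add_ne_top.2 ⟨hq, hWt⟩) e₂
    have f₃ := ENNReal.toReal_mono (ENNReal.add_ne_top.2 ⟨hzB B, hWt⟩) (h₁ B hB)
    have f₄ := ENNReal.toReal_mono (ENNReal.add_ne_top.2 ⟨hqB B, hWt⟩) (h₂ B hB)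
    have f₅ := ENNReal.toReal_mono hq (setLIntegral_le_lintegral B q)
    rw [ENNReal.toReal_add hz hWt] at f₁
    rw [ENNReal.toReal_add hq hWt] at f₂
    rw [ENNReal.toReal_add (hzB B) hWt] at f₃
    rw [ENNReal.toReal_add (hqB B) hWt] at f₄
    rw [measureReal_def, measureReal_def, Measure.smul_apply, Measure.smul_apply,
      withDensity_apply _ hB, withDensity_apply _ hB, smul_eq_mul, smul_eq_mul,
      ENNReal.toReal_mul, ENNReal.toReal_mul, ENNReal.toReal_mul, ENNReal.toReal_inv,
      ENNReal.toReal_inv, ENNReal.toReal_div, ENNReal.toReal_ofNat]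
    have hA : 0 < (∫⁻ x, q x ∂ν).toReal := ENNReal.toReal_pos hq0 hq
    have hZ : 0 < (∫⁻ x, z x ∂ν).toReal := ENNReal.toReal_pos hz0 hz
    have ha : 0 ≤ (∫⁻ x in B, q x ∂ν).toReal := ENNReal.toReal_nonneg
    have hw : 0 ≤ W.toReal := ENNReal.toReal_nonneg
    generalize (∫⁻ x, q x ∂ν).toReal = A at *
    generalize (∫⁻ x, z x ∂ν).toReal = Z at *
    generalize (∫⁻ x in B, q x ∂ν).toReal = a at *
    generalize (∫⁻ x in B, z x ∂ν).toReal = b at *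
    generalize W.toReal = w at *
    have e : A⁻¹ * a - Z⁻¹ * b = ((a - b) + a / A * (Z - A)) / Z := by
      field_simp
      ring
    have h1 : |a - b| ≤ w := abs_le.2 ⟨by linarith, by linarith⟩
    have h2 : |Z - A| ≤ w := abs_le.2 ⟨by linarith, by linarith⟩
    have h3 : a / A ≤ 1 := (div_le_one hA).2 f₅
    have h4 : 0 ≤ a / A := by positivity
    rw [e, abs_div, abs_of_pos hZ, ← mul_div_assoc]
    gcongr
    calc |(a - b) + a / A * (Z - A)| ≤ |a - b| + |a / A * (Z - A)| := abs_add_le _ _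
      _ ≤ w + 1 * w := by
        rw [abs_mul, abs_of_nonneg h4]
        gcongr
      _ = 2 * w := by ring
  calc tvNorm _ _ ≤ 2 * (2 * (W / ∫⁻ x, z x ∂ν)) := by unfold tvNorm; gcongr
    _ = _ := by rw [← mul_assoc]; norm_num

/-! ### Normalized sums of independent centred vectors -/

/-- The normalized sum `n^{-1/2} ∑ i, f (y_i)`. -/
noncomputable def normSum (f : 𝒴 → EuclideanSpace ℝ (Fin d)) (n : ℕ) (y : Fin n → 𝒴) :
    EuclideanSpace ℝ (Fin d) :=
  (√(n : ℝ))⁻¹ • ∑ i, f (y i)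

theorem measurable_normSum {f : 𝒴 → EuclideanSpace ℝ (Fin d)} (hf : Measurable f) (n : ℕ) :
    Measurable (normSum f n) := by
  have : Measurable fun y : Fin n → 𝒴 => ∑ i, f (y i) :=
    Finset.measurable_sum _ fun i _ => hf.comp (measurable_pi_apply i)
  exact this.const_smul (√(n : ℝ))⁻¹

theorem integral_sq_norm_normSum_le (P : Measure 𝒴) [IsProbabilityMeasure P]
    {f : 𝒴 → EuclideanSpace ℝ (Fin d)} (hf : MemLp f 2 P) (h0 : ∫ y, f y ∂P = 0) (n : ℕ) :
    Integrable (fun y => ‖normSum f n y‖ ^ 2) (Measure.pi fun _ : Fin n => P) ∧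
    ∫ y, ‖normSum f n y‖ ^ 2 ∂(Measure.pi fun _ : Fin n => P) ≤ ∫ y, ‖f y‖ ^ 2 ∂P := by
  have hfj : ∀ j, MemLp (fun y => f y j) 2 P := fun j => by
    exact (EuclideanSpace.proj (𝕜 := ℝ) j).comp_memLp' hf
  have h0j : ∀ j, ∫ y, f y j ∂P = 0 := fun j => by
    have := (EuclideanSpace.proj (𝕜 := ℝ) j).integral_comp_comm (hf.integrable (by norm_num))
    simpa [h0] using this
  have hgj : ∀ j, MemLp (fun y : Fin n → 𝒴 => ∑ i, f (y i) j) 2 (Measure.pi fun _ : Fin n => P) :=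
    fun j => memLp_finsetSum _ fun i _ =>
      (hfj j).comp_measurePreserving (measurePreserving_eval _ i)
  have hvar : ∀ j, ∫ y, (∑ i, f (y i) j) ^ 2 ∂(Measure.pi fun _ : Fin n => P)
      = n * ∫ y, (f y j) ^ 2 ∂P := by
    intro j
    have h1 := variance_sum_pi (μ := fun _ : Fin n => P) (X := fun _ y => f y j) fun _ => hfj j
    have hint : ∀ i : Fin n, Integrable (fun y : Fin n → 𝒴 => f (y i) j)
        (Measure.pi fun _ : Fin n => P) := fun i =>
      ((hfj j).comp_measurePreserving (measurePreserving_eval _ i)).integrable (by norm_num)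
    rw [variance_of_integral_eq_zero, Finset.sum_congr rfl fun i _ =>
      variance_of_integral_eq_zero (hfj j).aemeasurable (h0j j)] at h1
    · simpa [Finset.sum_apply] using h1
    · refine AEMeasurable.congr (hgj j).aemeasurable (ae_of_all _ fun y => ?_)
      simp
    · simp only [Finset.sum_apply]
      rw [integral_finsetSum _ fun i _ => hint i]
      refine Finset.sum_eq_zero fun i _ => ?_
      have h2 : ∫ y : Fin n → 𝒴, f (y i) j ∂(Measure.pi fun _ : Fin n => P) = ∫ y, f y j ∂P := by
        exact integral_comp_eval (μ := fun _ : Fin n => P) (hfj j).aestronglyMeasurable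
      rw [h2, h0j]
  have hnorm : ∀ y : Fin n → 𝒴, ‖normSum f n y‖ ^ 2
      = (n : ℝ)⁻¹ * ∑ j, (∑ i, f (y i) j) ^ 2 := by
    intro y
    rw [normSum, norm_smul, mul_pow, EuclideanSpace.real_norm_sq_eq]
    congr 1
    · simp
    · simp
  simp_rw [hnorm]
  refine ⟨(integrable_finsetSum _ fun j _ => (hgj j).integrable_sq).const_mul _, ?_⟩
  rw [integral_const_mul, integral_finsetSum _ fun j _ => (hgj j).integrable_sq]
  simp_rw [hvar]
  rw [← Finset.mul_sum, ← mul_assoc]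
  have h1 : ∑ j, ∫ y, (f y j) ^ 2 ∂P = ∫ y, ‖f y‖ ^ 2 ∂P := by
    rw [← integral_finsetSum _ fun j _ => (hfj j).integrable_sq]
    simp_rw [EuclideanSpace.real_norm_sq_eq]
  rw [h1]
  have h2 : (n : ℝ)⁻¹ * n ≤ 1 := by
    rcases Nat.eq_zero_or_pos n with h | h
    · simp [h]
    · field_simp; exact le_rfl
  exact mul_le_of_le_one_left (integral_nonneg fun _ => by positivity) h2

/-- Chebyshev's inequality for a normalized sum. -/
theorem measure_normSum_le (P : Measure 𝒴) [IsProbabilityMeasure P]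
    {f : 𝒴 → EuclideanSpace ℝ (Fin d)} (hf : MemLp f 2 P) (h0 : ∫ y, f y ∂P = 0)
    (n : ℕ) {M : ℝ} (hM : 0 < M) :
    Measure.pi (fun _ : Fin n => P) {y | M < ‖normSum f n y‖}
      ≤ ENNReal.ofReal ((∫ y, ‖f y‖ ^ 2 ∂P) / M ^ 2) := by
  obtain ⟨hi, hle⟩ := integral_sq_norm_normSum_le P hf h0 n
  have h := mul_meas_ge_le_integral_of_nonneg (ae_of_all _ fun y => sq_nonneg ‖normSum f n y‖) hi
    (M ^ 2)
  have h1 : (Measure.pi fun _ : Fin n => P).real {y | M ^ 2 ≤ ‖normSum f n y‖ ^ 2}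
      ≤ (∫ y, ‖f y‖ ^ 2 ∂P) / M ^ 2 := by
    rw [le_div_iff₀ (by positivity), mul_comm]
    exact h.trans hle
  calc _ ≤ Measure.pi (fun _ : Fin n => P) {y | M ^ 2 ≤ ‖normSum f n y‖ ^ 2} :=
        measure_mono fun y hy => by
          have : M < ‖normSum f n y‖ := hy
          simp only [Set.mem_ofPred_eq]
          gcongr
    _ = ENNReal.ofReal ((Measure.pi fun _ : Fin n => P).real _) := (ofReal_measureReal).symm
    _ ≤ _ := ENNReal.ofReal_le_ofReal h1

/-! ### The Gaussian limit -/

/-- The likelihood ratio of the Gaussian shift experiment with information operator `A`, as a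
function of the shift `h`, at the central statistic `S`. -/
noncomputable def limitRatio (A : EuclideanSpace ℝ (Fin d) →L[ℝ] EuclideanSpace ℝ (Fin d))
    (S h : EuclideanSpace ℝ (Fin d)) : ℝ :=
  Real.exp (inner ℝ h S - 1 / 2 * inner ℝ h (A h))

theorem continuous_limitRatio (A : EuclideanSpace ℝ (Fin d) →L[ℝ] EuclideanSpace ℝ (Fin d)) :
    Continuous fun z : EuclideanSpace ℝ (Fin d) × EuclideanSpace ℝ (Fin d) =>
      limitRatio A z.1 z.2 := by
  unfold limitRatio
  fun_prop

theorem limitRatio_pos (A : EuclideanSpace ℝ (Fin d) →L[ℝ] EuclideanSpace ℝ (Fin d))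
    (S h : EuclideanSpace ℝ (Fin d)) : 0 < limitRatio A S h := Real.exp_pos _

theorem limitRatio_le {A : EuclideanSpace ℝ (Fin d) →L[ℝ] EuclideanSpace ℝ (Fin d)} {c M : ℝ}
    (hA : ∀ h, c * ‖h‖ ^ 2 ≤ inner ℝ h (A h)) {S : EuclideanSpace ℝ (Fin d)} (hS : ‖S‖ ≤ M)
    (h : EuclideanSpace ℝ (Fin d)) :
    limitRatio A S h ≤ Real.exp (M * ‖h‖ - c / 2 * ‖h‖ ^ 2) := by
  unfold limitRatio
  have h1 : inner ℝ h S ≤ M * ‖h‖ := (real_inner_le_norm h S).trans (by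
    rw [mul_comm]; gcongr)
  have h2 := hA h
  exact Real.exp_le_exp.2 (by linarith)

theorem lintegral_exp_norm_lt_top {a c : ℝ} (hc : 0 < c) :
    ∫⁻ h : EuclideanSpace ℝ (Fin d), ENNReal.ofReal (Real.exp (a * ‖h‖ - c * ‖h‖ ^ 2)) < ∞ := by
  have hb : (0 : ℝ) < ((c / 2 : ℝ) : ℂ).re := by simpa using hc
  have h1 := (GaussianFourier.integrable_cexp_neg_mul_sq_norm_add (V := EuclideanSpace ℝ (Fin d))
    hb 0 0).norm
  have h2 : Integrable fun h : EuclideanSpace ℝ (Fin d) =>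
      Real.exp (a ^ 2 / (2 * c)) * Real.exp (-(c / 2) * ‖h‖ ^ 2) := by
    refine Integrable.const_mul (h1.congr (ae_of_all _ fun h => ?_)) _
    simp only [Complex.norm_exp]
    congr 1
    rw [← Complex.ofReal_pow, zero_mul, add_zero, ← Complex.ofReal_neg, ← Complex.ofReal_mul,
      Complex.ofReal_re]
  refine lt_of_le_of_lt (lintegral_mono fun h => ?_) h2.lintegral_lt_top
  rw [← Real.exp_add]
  refine ENNReal.ofReal_le_ofReal (Real.exp_le_exp.2 ?_)
  have h3 : a ^ 2 / (2 * c) + -(c / 2) * ‖h‖ ^ 2 - (a * ‖h‖ - c * ‖h‖ ^ 2)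
      = (a - c * ‖h‖) ^ 2 / (2 * c) := by
    field_simp
    ring
  have h4 : 0 ≤ (a - c * ‖h‖) ^ 2 / (2 * c) := by positivity
  linarith

theorem lintegral_limitRatio_zero_pos
    (A : EuclideanSpace ℝ (Fin d) →L[ℝ] EuclideanSpace ℝ (Fin d)) :
    0 < ∫⁻ h, ENNReal.ofReal (limitRatio A 0 h) := by
  have hm : Measurable fun h => ENNReal.ofReal (limitRatio A 0 h) :=
    ((continuous_limitRatio A).measurable.comp (measurable_const.prodMk measurable_id)).ennreal_ofReal
  rw [lintegral_pos_iff_support hm]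
  have : (Function.support fun h => ENNReal.ofReal (limitRatio A 0 h)) = Set.univ := by
    ext h
    simp [limitRatio_pos]
  rw [this]
  exact Measure.measure_univ_pos.2 (NeZero.ne _)

/-- The mass of the Gaussian likelihood is smallest at `S = 0`, since `cosh ≥ 1`. -/
theorem lintegral_limitRatio_zero_le
    (A : EuclideanSpace ℝ (Fin d) →L[ℝ] EuclideanSpace ℝ (Fin d)) (S : EuclideanSpace ℝ (Fin d)) :
    ∫⁻ h, ENNReal.ofReal (limitRatio A 0 h) ≤ ∫⁻ h, ENNReal.ofReal (limitRatio A S h) := by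
  have hm : ∀ S, Measurable fun h => ENNReal.ofReal (limitRatio A S h) := fun S =>
    ((continuous_limitRatio A).measurable.comp (measurable_const.prodMk measurable_id)).ennreal_ofReal
  have hneg : ∫⁻ h, ENNReal.ofReal (limitRatio A S (-h))
      = ∫⁻ h, ENNReal.ofReal (limitRatio A S h) :=
    lintegral_neg_eq_self (fun h => ENNReal.ofReal (limitRatio A S h))
  have h1 : 2 * ∫⁻ h, ENNReal.ofReal (limitRatio A 0 h)
      ≤ 2 * ∫⁻ h, ENNReal.ofReal (limitRatio A S h) := by
    calc 2 * ∫⁻ h, ENNReal.ofReal (limitRatio A 0 h)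
        = ∫⁻ h, 2 * ENNReal.ofReal (limitRatio A 0 h) := (lintegral_const_mul _ (hm 0)).symm
      _ ≤ ∫⁻ h, (ENNReal.ofReal (limitRatio A S h) + ENNReal.ofReal (limitRatio A S (-h))) := by
          refine lintegral_mono fun h => ?_
          rw [← ENNReal.ofReal_add (limitRatio_pos _ _ _).le (limitRatio_pos _ _ _).le,
            two_mul, ← ENNReal.ofReal_add (limitRatio_pos _ _ _).le (limitRatio_pos _ _ _).le,
            ← two_mul]
          refine ENNReal.ofReal_le_ofReal ?_
          unfold limitRatio
          simp only [map_neg, inner_neg_left, inner_neg_right, neg_neg, inner_zero_right,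
            sub_eq_add_neg, Real.exp_add, zero_add]
          rw [← add_mul]
          gcongr
          have := Real.one_le_cosh (inner ℝ h S)
          rw [Real.cosh_eq] at this
          linarith
      _ = 2 * ∫⁻ h, ENNReal.ofReal (limitRatio A S h) := by
          rw [lintegral_add_left (hm S), hneg, two_mul]
  exact (ENNReal.mul_le_mul_iff_right (by simp) (by simp)).1 h1

theorem stdGaussian_eq_smul_withDensity :
    ∃ c : ℝ≥0∞, stdGaussian (EuclideanSpace ℝ (Fin d))
      = c • volume.withDensity fun x => ENNReal.ofReal (Real.exp (-(1 / 2) * ‖x‖ ^ 2)) := by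
  let C : ℝ := (√(2 * Real.pi * (1 : ℝ≥0)))⁻¹
  have h1 : gaussianReal 0 1 = (volume : Measure ℝ).withDensity
      fun x => ((gaussianPDFReal 0 1 x).toNNReal : ℝ≥0∞) := by
    rw [gaussianReal_of_var_ne_zero _ one_ne_zero]
    rfl
  refine ⟨ENNReal.ofReal (C ^ d), ?_⟩
  rw [← map_pi_eq_stdGaussian, h1, pi_withDensity _ _ (measurable_gaussianPDFReal 0 1).real_toNNReal]
  ext B hB
  have hT := PiLp.volume_preserving_toLp (Fin d)
  rw [Measure.map_apply hT.measurable hB, withDensity_apply _ (hT.measurable hB),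
    Measure.smul_apply, withDensity_apply _ hB, smul_eq_mul]
  have h2 : ∫⁻ x in B, ENNReal.ofReal (Real.exp (-(1 / 2) * ‖x‖ ^ 2))
      = ∫⁻ x in (WithLp.toLp 2) ⁻¹' B, ENNReal.ofReal
        (Real.exp (-(1 / 2) * ‖(WithLp.toLp 2 x : EuclideanSpace ℝ (Fin d))‖ ^ 2)) := by
    rw [← hT.setLIntegral_comp_preimage hB (by fun_prop)]
  rw [h2, ← lintegral_const_mul _ (by fun_prop), ← volume_pi]
  refine lintegral_congr fun x => ?_
  rw [← ENNReal.ofReal_mul (by positivity)]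
  change ENNReal.ofNNReal _ = ENNReal.ofNNReal _
  congr 1
  rw [← Real.toNNReal_prod_of_nonneg fun i _ => gaussianPDFReal_nonneg _ _ _]
  congr 1
  simp only [gaussianPDFReal]
  rw [Finset.prod_mul_distrib, Finset.prod_const, Finset.card_univ, Fintype.card_fin,
    ← Real.exp_sum, EuclideanSpace.real_norm_sq_eq, Finset.mul_sum]
  congr 2
  refine Finset.sum_congr rfl fun i _ => ?_
  simp
  ring

open scoped MatrixOrder in
/-- The Gaussian `N(Δ, I⁻¹)` is the normalized likelihood ratio of the Gaussian shift experiment with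
central statistic `I Δ`: it is the image of the standard Gaussian under an affine map, and total mass
one determines the constant. -/
theorem multivariateGaussian_eq_withDensity {I : Matrix (Fin d) (Fin d) ℝ} (hI : I.PosDef)
    (Δ : EuclideanSpace ℝ (Fin d)) :
    multivariateGaussian Δ I⁻¹ =
      (∫⁻ h, ENNReal.ofReal (limitRatio (Matrix.toEuclideanCLM (𝕜 := ℝ) I)
        (Matrix.toEuclideanCLM (𝕜 := ℝ) I Δ) h))⁻¹ •
      volume.withDensity fun h => ENNReal.ofReal (limitRatio (Matrix.toEuclideanCLM (𝕜 := ℝ) I)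
        (Matrix.toEuclideanCLM (𝕜 := ℝ) I Δ) h) := by
  set T := Matrix.toEuclideanCLM (n := Fin d) (𝕜 := ℝ) with hT
  set A := T I with hA
  set R := T (CFC.sqrt I⁻¹) with hR
  have hRR : CFC.sqrt I⁻¹ * CFC.sqrt I⁻¹ = I⁻¹ := by
    exact CFC.sqrt_mul_sqrt_self _ hI.inv.posSemidef.nonneg
  have hRIR : CFC.sqrt I⁻¹ * I * CFC.sqrt I⁻¹ = 1 := by
    rw [mul_eq_one_comm, ← mul_assoc, hRR]
    exact Matrix.nonsing_inv_mul _ ((Matrix.isUnit_iff_isUnit_det _).1 hI.isUnit)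
  have hRsymm : ∀ x y, inner ℝ (R x) y = inner ℝ x (R y) := by
    have h1 : (CFC.sqrt I⁻¹).IsHermitian := by
        exact (Matrix.nonneg_iff_posSemidef.1 (CFC.sqrt_nonneg I⁻¹)).isHermitian
    exact Matrix.isSymmetric_toEuclideanLin_iff.2 h1
  have hRAR : ∀ x, R (A (R x)) = x := fun x => by
    have h1 : R * A * R = 1 := by rw [hR, hA, ← map_mul, ← map_mul, hRIR, map_one]
    exact congrArg (fun f : EuclideanSpace ℝ (Fin d) →L[ℝ] EuclideanSpace ℝ (Fin d) => f x) h1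
  have hAsymm : ∀ x y, inner ℝ (A x) y = inner ℝ x (A y) :=
    Matrix.isSymmetric_toEuclideanLin_iff.2 hI.isHermitian
  have hdet : LinearMap.det (R : EuclideanSpace ℝ (Fin d) →ₗ[ℝ] EuclideanSpace ℝ (Fin d)) ≠ 0 := by
    have hinj : Function.Injective R := fun x y h => by rw [← hRAR x, ← hRAR y, h]
    have h1 : IsUnit (R : EuclideanSpace ℝ (Fin d) →ₗ[ℝ] EuclideanSpace ℝ (Fin d)) :=
      (LinearMap.isUnit_iff_ker_eq_bot _).2 (LinearMap.ker_eq_bot.2 hinj)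
    exact (LinearMap.isUnit_iff_isUnit_det _).1 h1 |>.ne_zero
  have hz : Measurable fun h => ENNReal.ofReal (limitRatio A (A Δ) h) :=
    ((continuous_limitRatio A).measurable.comp (measurable_const.prodMk measurable_id)).ennreal_ofReal
  -- up to a constant, the two measures have the same density
  obtain ⟨c, hc⟩ : ∃ c : ℝ≥0∞, multivariateGaussian Δ I⁻¹ =
      c • volume.withDensity fun h => ENNReal.ofReal (limitRatio A (A Δ) h) := by
    obtain ⟨c, hc⟩ := stdGaussian_eq_smul_withDensity (d := d)
    have hφ : Measurable fun x => Δ + R x := by fun_prop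
    have hmap : Measure.map (fun x => Δ + R x) volume = ENNReal.ofReal
        |(LinearMap.det (R : EuclideanSpace ℝ (Fin d) →ₗ[ℝ] EuclideanSpace ℝ (Fin d)))⁻¹| •
        (volume : Measure (EuclideanSpace ℝ (Fin d))) := by
      have h1 := Measure.map_linearMap_addHaar_eq_smul_addHaar
        (volume : Measure (EuclideanSpace ℝ (Fin d))) hdet
      have h2 : Measure.map (fun x => Δ + R x) volume
          = Measure.map (fun x => Δ + x) (Measure.map R (volume : Measure
            (EuclideanSpace ℝ (Fin d)))) := by
        rw [Measure.map_map (measurable_const_add Δ) (by fun_prop)]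
        rfl
      rw [h2]
      erw [h1]
      rw [Measure.map_smul, map_add_left_eq_self]
    refine ⟨c * (ENNReal.ofReal (Real.exp (-(1 / 2) * inner ℝ Δ (A Δ))) * ENNReal.ofReal
        |(LinearMap.det (R : EuclideanSpace ℝ (Fin d) →ₗ[ℝ] EuclideanSpace ℝ (Fin d)))⁻¹|), ?_⟩
    rw [multivariateGaussian, hc, Measure.map_smul, mul_smul]
    congr 1
    ext B hB
    rw [Measure.map_apply hφ hB, withDensity_apply _ (hφ hB), Measure.smul_apply,
      withDensity_apply _ hB, smul_eq_mul, mul_assoc, ← smul_eq_mul (_ : ℝ≥0∞) (∫⁻ h in B, _),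
      ← lintegral_smul_measure, ← Measure.restrict_smul, ← hmap,
      setLIntegral_map hB hz hφ, ← lintegral_const_mul _ (by exact hz.comp hφ)]
    refine lintegral_congr fun x => ?_
    rw [← ENNReal.ofReal_mul (by positivity)]
    congr 1
    rw [limitRatio, ← Real.exp_add]
    congr 1
    have h1 : inner ℝ (R x) (A (R x)) = ‖x‖ ^ 2 := by
      rw [hRsymm, hRAR, real_inner_self_eq_norm_sq]
    have h2 : inner ℝ Δ (A (R x)) = inner ℝ (R x) (A Δ) := by
      rw [← hAsymm, real_inner_comm]
    simp only [map_add, inner_add_left, inner_add_right]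
    linarith
  have h1 : multivariateGaussian Δ I⁻¹ Set.univ = 1 := measure_univ
  rw [hc, Measure.smul_apply, withDensity_apply _ MeasurableSet.univ, setLIntegral_univ,
    smul_eq_mul] at h1
  rw [hc, ENNReal.eq_inv_of_mul_eq_one_left h1]

/-! ### The score function -/

/-- The regularity of the family `p` at `θ₀` that the local analysis uses: the `p θ` are measurable,
integrate to one for `θ` near `θ₀`, and are differentiable in quadratic mean at `θ₀`. -/
structure IsRegularAt (μ : Measure 𝒴) (p : EuclideanSpace ℝ (Fin d) → 𝒴 → ℝ≥0)
    (θ₀ : EuclideanSpace ℝ (Fin d)) (ℓ : 𝒴 → EuclideanSpace ℝ (Fin d)) : Prop where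
  measurable : Measurable (Function.uncurry p)
  lintegral_eq_one : ∀ᶠ h in 𝓝 (0 : EuclideanSpace ℝ (Fin d)), ∫⁻ y, (p (θ₀ + h) y : ℝ≥0∞) ∂μ = 1
  dqm : DQMAt μ p θ₀ ℓ

/-- The remainder in the differentiation of `θ ↦ √p_θ` at `θ₀`. -/
noncomputable def dqmRem (p : EuclideanSpace ℝ (Fin d) → 𝒴 → ℝ≥0)
    (θ₀ : EuclideanSpace ℝ (Fin d)) (ℓ : 𝒴 → EuclideanSpace ℝ (Fin d))
    (h : EuclideanSpace ℝ (Fin d)) (y : 𝒴) : ℝ :=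
  √(p (θ₀ + h) y : ℝ) - √(p θ₀ y : ℝ) - 1 / 2 * inner ℝ h (ℓ y) * √(p θ₀ y : ℝ)

section

variable {μ : Measure 𝒴} {p : EuclideanSpace ℝ (Fin d) → 𝒴 → ℝ≥0}
  {θ₀ : EuclideanSpace ℝ (Fin d)} {ℓ : 𝒴 → EuclideanSpace ℝ (Fin d)}

theorem integral_obsLaw {F : Type*} [NormedAddCommGroup F] [NormedSpace ℝ F]
    {θ : EuclideanSpace ℝ (Fin d)} (hp : Measurable (p θ)) (f : 𝒴 → F) :
    ∫ y, f y ∂(obsLaw μ p θ) = ∫ y, (p θ y : ℝ) • f y ∂μ :=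
  integral_withDensity_eq_integral_smul hp f

theorem integrable_obsLaw_iff {F : Type*} [NormedAddCommGroup F] [NormedSpace ℝ F]
    {θ : EuclideanSpace ℝ (Fin d)} (hp : Measurable (p θ)) {f : 𝒴 → F} :
    Integrable f (obsLaw μ p θ) ↔ Integrable (fun y => (p θ y : ℝ) • f y) μ :=
  integrable_withDensity_iff_integrable_smul hp

theorem integrable_and_integral_density {θ : EuclideanSpace ℝ (Fin d)} (hp : Measurable (p θ))
    (h : ∫⁻ y, (p θ y : ℝ≥0∞) ∂μ = 1) :
    Integrable (fun y => (p θ y : ℝ)) μ ∧ ∫ y, (p θ y : ℝ) ∂μ = 1 := by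
  have hi : Integrable (fun y => (p θ y : ℝ)) μ := by
    refine ⟨hp.coe_nnreal_real.aestronglyMeasurable, ?_⟩
    simp [hasFiniteIntegral_iff_enorm, h]
  refine ⟨hi, ?_⟩
  rw [integral_eq_lintegral_of_nonneg_ae (ae_of_all _ fun y => NNReal.coe_nonneg _)
    hi.aestronglyMeasurable]
  simp [h]

theorem exists_sqrt_eq (x : ℝ≥0) : ∃ r : ℝ, √(x : ℝ) = r ∧ (x : ℝ) = r ^ 2 :=
  ⟨_, rfl, (Real.sq_sqrt (NNReal.coe_nonneg _)).symm⟩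

namespace IsRegularAt

theorem measurable_apply (hr : IsRegularAt μ p θ₀ ℓ) (θ : EuclideanSpace ℝ (Fin d)) :
    Measurable (p θ) := hr.measurable.of_uncurry_left

theorem measurable_score (hr : IsRegularAt μ p θ₀ ℓ) : Measurable ℓ := hr.dqm.1

theorem lintegral_self (hr : IsRegularAt μ p θ₀ ℓ) : ∫⁻ y, (p θ₀ y : ℝ≥0∞) ∂μ = 1 := by
  simpa using hr.lintegral_eq_one.self_of_nhds

theorem isProbabilityMeasure (hr : IsRegularAt μ p θ₀ ℓ) : IsProbabilityMeasure (obsLaw μ p θ₀) :=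
  isProbabilityMeasure_obsLaw hr.lintegral_self

theorem integrable_density (hr : IsRegularAt μ p θ₀ ℓ) :
    Integrable (fun y => (p θ₀ y : ℝ)) μ :=
  (integrable_and_integral_density (hr.measurable_apply _) hr.lintegral_self).1

theorem integral_density (hr : IsRegularAt μ p θ₀ ℓ) : ∫ y, (p θ₀ y : ℝ) ∂μ = 1 :=
  (integrable_and_integral_density (hr.measurable_apply _) hr.lintegral_self).2

theorem integrable_and_integral_density_add (hr : IsRegularAt μ p θ₀ ℓ) :
    ∀ᶠ h in 𝓝 (0 : EuclideanSpace ℝ (Fin d)),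
      Integrable (fun y => (p (θ₀ + h) y : ℝ)) μ ∧ ∫ y, (p (θ₀ + h) y : ℝ) ∂μ = 1 :=
  hr.lintegral_eq_one.mono fun _ => integrable_and_integral_density (hr.measurable_apply _)

theorem measurable_dqmRem (hr : IsRegularAt μ p θ₀ ℓ) (h : EuclideanSpace ℝ (Fin d)) :
    Measurable (dqmRem p θ₀ ℓ h) := by
  have h1 := fun θ => (hr.measurable_apply θ).coe_nnreal_real.sqrt
  have h2 : Measurable fun y => inner ℝ h (ℓ y) := measurable_const.inner hr.measurable_score
  exact ((h1 _).sub (h1 _)).sub ((h2.const_mul _).mul (h1 _))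

theorem dqmRem_bound (hr : IsRegularAt μ p θ₀ ℓ) {ν : ℝ} (hν : 0 < ν) :
    ∀ᶠ h in 𝓝 (0 : EuclideanSpace ℝ (Fin d)),
      Integrable (fun y => dqmRem p θ₀ ℓ h y ^ 2) μ ∧
      ∫ y, dqmRem p θ₀ ℓ h y ^ 2 ∂μ ≤ ν * ‖h‖ ^ 2 := by
  filter_upwards [hr.dqm.2 ν hν] with h hh
  have hm := (hr.measurable_dqmRem h).pow_const 2
  refine ⟨⟨hm.aestronglyMeasurable, ?_⟩, ?_⟩
  · rw [hasFiniteIntegral_iff_ofReal (ae_of_all _ fun y => sq_nonneg _)]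
    exact hh.trans_lt ENNReal.ofReal_lt_top
  · rw [integral_eq_lintegral_of_nonneg_ae (ae_of_all _ fun y => sq_nonneg _)
      hm.aestronglyMeasurable]
    exact ENNReal.toReal_le_of_le_ofReal (by positivity) hh

/-- The score is square integrable: along a coordinate direction at a small `t > 0`, the function
`½ t ℓ_j √p_θ₀` is a combination of square integrable functions. -/
theorem memLp_score (hr : IsRegularAt μ p θ₀ ℓ) : MemLp ℓ 2 (obsLaw μ p θ₀) := by
  have hp0 := hr.measurable_apply θ₀
  refine (memLp_two_iff_integrable_sq_norm hr.measurable_score.aestronglyMeasurable).2 ?_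
  have hj : ∀ j, Integrable (fun y => (ℓ y j) ^ 2) (obsLaw μ p θ₀) := by
    intro j
    have hlim : Tendsto (fun t : ℝ => t • EuclideanSpace.single j (1 : ℝ)) (𝓝[>] 0)
        (𝓝 (0 : EuclideanSpace ℝ (Fin d))) := by
      have : Tendsto (fun t : ℝ => t • EuclideanSpace.single j (1 : ℝ)) (𝓝 0)
          (𝓝 ((0 : ℝ) • EuclideanSpace.single j (1 : ℝ))) :=
        (continuous_id.smul continuous_const).tendsto 0
      rw [zero_smul] at this
      exact this.mono_left nhdsWithin_le_nhds
    obtain ⟨t, ⟨⟨h1, h2⟩, ht⟩⟩ := ((hlim.eventually ((hr.dqmRem_bound one_pos).and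
      hr.integrable_and_integral_density_add)).and self_mem_nhdsWithin).exists
    have ht : 0 < t := ht
    rw [integrable_obsLaw_iff hp0]
    set h := t • EuclideanSpace.single j (1 : ℝ)
    refine Integrable.mono' (((h1.1.add h2.1).add hr.integrable_density).const_mul (12 / t ^ 2))
      ?_ (ae_of_all _ fun y => ?_)
    · have : Measurable fun y => ℓ y j := by
        have := hr.measurable_score
        fun_prop
      exact (hp0.coe_nnreal_real.smul (this.pow_const 2)).aestronglyMeasurable
    · have e : inner ℝ h (ℓ y) = t * ℓ y j := by
        simp [h, real_inner_smul_left, EuclideanSpace.inner_single_left]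
      have hR : dqmRem p θ₀ ℓ h y = √(p (θ₀ + h) y : ℝ) - √(p θ₀ y : ℝ)
        - 1 / 2 * (t * ℓ y j) * √(p θ₀ y : ℝ) := by rw [dqmRem, e]
      simp only [Pi.add_apply, smul_eq_mul]
      rw [Real.norm_of_nonneg (by positivity)]
      obtain ⟨r, e1, e1'⟩ := exists_sqrt_eq (p θ₀ y)
      obtain ⟨a, e2, e2'⟩ := exists_sqrt_eq (p (θ₀ + h) y)
      rw [e1, e2] at hR
      rw [e1', e2', div_mul_eq_mul_div, le_div_iff₀ (by positivity)]
      generalize dqmRem p θ₀ ℓ h y = R at *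
      have : r ^ 2 * ℓ y j ^ 2 * t ^ 2 = 4 * (a - r - R) ^ 2 := by rw [hR]; ring
      rw [this]
      nlinarith [sq_nonneg (a + r), sq_nonneg (a + R), sq_nonneg (r - R)]
  simp_rw [EuclideanSpace.real_norm_sq_eq]
  exact integrable_finsetSum _ fun j _ => hj j

theorem integrable_sq_norm_score (hr : IsRegularAt μ p θ₀ ℓ) :
    Integrable (fun y => (p θ₀ y : ℝ) * ‖ℓ y‖ ^ 2) μ :=
  (integrable_obsLaw_iff (hr.measurable_apply _)).1
    ((memLp_two_iff_integrable_sq_norm hr.measurable_score.aestronglyMeasurable).1 hr.memLp_score)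

/-- The squared Hellinger distance to `p θ₀` is `O(‖h‖²)`. -/
theorem hellinger_bound (hr : IsRegularAt μ p θ₀ ℓ) :
    ∃ C : ℝ, 0 ≤ C ∧ ∀ᶠ h in 𝓝 (0 : EuclideanSpace ℝ (Fin d)),
      Integrable (fun y => (√(p (θ₀ + h) y : ℝ) - √(p θ₀ y : ℝ)) ^ 2) μ ∧
      ∫ y, (√(p (θ₀ + h) y : ℝ) - √(p θ₀ y : ℝ)) ^ 2 ∂μ ≤ C * ‖h‖ ^ 2 := by
  set V := ∫ y, (p θ₀ y : ℝ) * ‖ℓ y‖ ^ 2 ∂μ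
  have hV : 0 ≤ V := integral_nonneg fun y => by positivity
  refine ⟨1 / 2 * V + 2, by positivity, ?_⟩
  filter_upwards [hr.dqmRem_bound one_pos] with h hh
  have hb : ∀ y, (√(p (θ₀ + h) y : ℝ) - √(p θ₀ y : ℝ)) ^ 2
      ≤ 1 / 2 * ‖h‖ ^ 2 * ((p θ₀ y : ℝ) * ‖ℓ y‖ ^ 2) + 2 * dqmRem p θ₀ ℓ h y ^ 2 := by
    intro y
    have e2 : (inner ℝ h (ℓ y)) ^ 2 ≤ ‖h‖ ^ 2 * ‖ℓ y‖ ^ 2 := by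
      rw [← mul_pow, ← sq_abs]
      exact pow_le_pow_left₀ (abs_nonneg _) (abs_real_inner_le_norm h (ℓ y)) 2
    have e3 : √(p (θ₀ + h) y : ℝ) - √(p θ₀ y : ℝ)
      = dqmRem p θ₀ ℓ h y + 1 / 2 * inner ℝ h (ℓ y) * √(p θ₀ y : ℝ) := by rw [dqmRem]; ring
    rw [e3]
    obtain ⟨r, e1, e1'⟩ := exists_sqrt_eq (p θ₀ y)
    rw [e1, e1']
    have e4 := mul_le_mul_of_nonneg_left e2 (sq_nonneg r)
    nlinarith [sq_nonneg (dqmRem p θ₀ ℓ h y - 1 / 2 * inner ℝ h (ℓ y) * r)]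
  have hi : Integrable (fun y => 1 / 2 * ‖h‖ ^ 2 * ((p θ₀ y : ℝ) * ‖ℓ y‖ ^ 2)
      + 2 * dqmRem p θ₀ ℓ h y ^ 2) μ :=
    (hr.integrable_sq_norm_score.const_mul _).add (hh.1.const_mul _)
  have hi' : Integrable (fun y => (√(p (θ₀ + h) y : ℝ) - √(p θ₀ y : ℝ)) ^ 2) μ := by
    refine hi.mono' ?_ (ae_of_all _ fun y => ?_)
    · have h1 := fun θ => (hr.measurable_apply θ).coe_nnreal_real.sqrt
      exact (((h1 _).sub (h1 _)).pow_const 2).aestronglyMeasurable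
    · rw [Real.norm_of_nonneg (sq_nonneg _)]
      exact hb y
  refine ⟨hi', (integral_mono hi' hi hb).trans ?_⟩
  rw [integral_add (hr.integrable_sq_norm_score.const_mul _) (hh.1.const_mul _),
    integral_const_mul, integral_const_mul]
  have := hh.2
  nlinarith

/-- The score is centred, since `∫ √p_θ √p_θ₀ dμ = 1 - ½ ∫ (√p_θ - √p_θ₀)² dμ` has a vanishing
derivative at `θ₀`. -/
theorem integral_score (hr : IsRegularAt μ p θ₀ ℓ) : ∫ y, ℓ y ∂(obsLaw μ p θ₀) = 0 := by
  have := hr.isProbabilityMeasure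
  have hp0 := hr.measurable_apply θ₀
  have hℓi : Integrable ℓ (obsLaw μ p θ₀) := hr.memLp_score.integrable (by norm_num)
  refine ext_inner_left ℝ fun v => ?_
  rw [← integral_inner hℓi, inner_zero_right]
  set m := ∫ y, inner ℝ v (ℓ y) ∂(obsLaw μ p θ₀) with hm
  have hvi : Integrable (fun y => (p θ₀ y : ℝ) * inner ℝ v (ℓ y)) μ :=
    (integrable_obsLaw_iff hp0).1 (hℓi.const_inner v)
  have hm' : m = ∫ y, (p θ₀ y : ℝ) * inner ℝ v (ℓ y) ∂μ := integral_obsLaw hp0 _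
  obtain ⟨C, hC, hH⟩ := hr.hellinger_bound
  have hlim : Tendsto (fun t : ℝ => t • v) (𝓝[>] 0) (𝓝 0) := by
    have : Tendsto (fun t : ℝ => t • v) (𝓝 0) (𝓝 ((0 : ℝ) • v)) :=
      (continuous_id.smul continuous_const).tendsto 0
    rw [zero_smul] at this
    exact this.mono_left nhdsWithin_le_nhds
  have key : ∀ ν : ℝ, 0 < ν → |m| ≤ ν * (‖v‖ ^ 2 + 1) := by
    intro ν hν
    have hev : ∀ᶠ t in 𝓝[>] (0 : ℝ), |m| ≤ ν * (‖v‖ ^ 2 + 1) + t * (C * ‖v‖ ^ 2) := by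
      filter_upwards [hlim.eventually ((hr.dqmRem_bound (sq_pos_of_pos hν)).and
        (hH.and hr.integrable_and_integral_density_add)), self_mem_nhdsWithin] with t ht ht0
      obtain ⟨⟨hRi, hR⟩, ⟨hDi, hD⟩, hai, ha⟩ := ht
      have ht0 : 0 < t := ht0
      set h := t • v with hh
      have hnh : ‖h‖ ^ 2 = t ^ 2 * ‖v‖ ^ 2 := by rw [hh, norm_smul, mul_pow, Real.norm_eq_abs, sq_abs]
      -- expand `p_θ - p_θ₀ = (√p_θ - √p_θ₀)² + 2 (√p_θ - √p_θ₀) √p_θ₀`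
      have e : ∀ y, t * ((p θ₀ y : ℝ) * inner ℝ v (ℓ y))
          = (p (θ₀ + h) y : ℝ) - (p θ₀ y : ℝ) - (√(p (θ₀ + h) y : ℝ) - √(p θ₀ y : ℝ)) ^ 2
            - 2 * (dqmRem p θ₀ ℓ h y * √(p θ₀ y : ℝ)) := by
        intro y
        have e3 : inner ℝ h (ℓ y) = t * inner ℝ v (ℓ y) := by rw [hh, real_inner_smul_left]
        obtain ⟨r, e1, e1'⟩ := exists_sqrt_eq (p θ₀ y)
        obtain ⟨a, e2, e2'⟩ := exists_sqrt_eq (p (θ₀ + h) y)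
        rw [dqmRem, e3, e1, e2, e1', e2']
        ring
      have hb : ∀ y, |t * ((p θ₀ y : ℝ) * inner ℝ v (ℓ y)) -
          ((p (θ₀ + h) y : ℝ) - (p θ₀ y : ℝ))| ≤ (√(p (θ₀ + h) y : ℝ) - √(p θ₀ y : ℝ)) ^ 2
            + ((ν * t)⁻¹ * dqmRem p θ₀ ℓ h y ^ 2 + ν * t * (p θ₀ y : ℝ)) := by
        intro y
        have e4 : |2 * (dqmRem p θ₀ ℓ h y * √(p θ₀ y : ℝ))|
            ≤ (ν * t)⁻¹ * dqmRem p θ₀ ℓ h y ^ 2 + ν * t * (p θ₀ y : ℝ) := by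
          have hs : 0 < ν * t := by positivity
          obtain ⟨r, e1, e1'⟩ := exists_sqrt_eq (p θ₀ y)
          rw [e1, e1']
          generalize dqmRem p θ₀ ℓ h y = R
          have f1 : (ν * t)⁻¹ * R ^ 2 + ν * t * r ^ 2 - 2 * (R * r)
            = (ν * t)⁻¹ * (R - ν * t * r) ^ 2 := by field_simp; ring
          have f2 : (ν * t)⁻¹ * R ^ 2 + ν * t * r ^ 2 + 2 * (R * r)
            = (ν * t)⁻¹ * (R + ν * t * r) ^ 2 := by field_simp; ring
          have f3 : 0 ≤ (ν * t)⁻¹ * (R - ν * t * r) ^ 2 := by positivity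
          have f4 : 0 ≤ (ν * t)⁻¹ * (R + ν * t * r) ^ 2 := by positivity
          exact abs_le.2 ⟨by linarith, by linarith⟩
        rw [e y]
        have e5 := abs_sub (-(√(p (θ₀ + h) y : ℝ) - √(p θ₀ y : ℝ)) ^ 2)
          (2 * (dqmRem p θ₀ ℓ h y * √(p θ₀ y : ℝ)))
        rw [abs_neg, abs_of_nonneg (sq_nonneg (√(p (θ₀ + h) y : ℝ) - √(p θ₀ y : ℝ)))] at e5
        calc _ = |-(√(p (θ₀ + h) y : ℝ) - √(p θ₀ y : ℝ)) ^ 2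
            - 2 * (dqmRem p θ₀ ℓ h y * √(p θ₀ y : ℝ))| := by congr 1; ring
          _ ≤ _ := e5.trans (by linarith)
      have hI : t * m = ∫ y, (t * ((p θ₀ y : ℝ) * inner ℝ v (ℓ y)) -
          ((p (θ₀ + h) y : ℝ) - (p θ₀ y : ℝ))) ∂μ := by
        rw [integral_sub (hvi.const_mul t) (by exact hai.sub hr.integrable_density),
          integral_sub hai hr.integrable_density, ha, hr.integral_density, integral_const_mul, hm']
        ring
      have hint : Integrable (fun y => (√(p (θ₀ + h) y : ℝ) - √(p θ₀ y : ℝ)) ^ 2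
            + ((ν * t)⁻¹ * dqmRem p θ₀ ℓ h y ^ 2 + ν * t * (p θ₀ y : ℝ))) μ :=
        hDi.add ((hRi.const_mul _).add (hr.integrable_density.const_mul _))
      have hle : t * |m| ≤ C * ‖h‖ ^ 2 + ((ν * t)⁻¹ * (ν ^ 2 * ‖h‖ ^ 2) + ν * t) := by
        rw [← abs_of_pos ht0, ← abs_mul, abs_of_pos ht0, hI]
        refine (norm_integral_le_of_norm_le hint (ae_of_all _ fun y => by
          rw [Real.norm_eq_abs]; exact hb y)).trans ?_
        rw [integral_add hDi
            (by exact (hRi.const_mul _).add (hr.integrable_density.const_mul _)),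
          integral_add (hRi.const_mul _) (hr.integrable_density.const_mul _), integral_const_mul,
          integral_const_mul, hr.integral_density, mul_one]
        gcongr
      rw [hnh] at hle
      have e6 : C * (t ^ 2 * ‖v‖ ^ 2) + ((ν * t)⁻¹ * (ν ^ 2 * (t ^ 2 * ‖v‖ ^ 2)) + ν * t)
        = t * (ν * (‖v‖ ^ 2 + 1) + t * (C * ‖v‖ ^ 2)) := by field_simp; ring
      rw [e6] at hle
      exact le_of_mul_le_mul_left hle ht0
    have hlim2 : Tendsto (fun t : ℝ => ν * (‖v‖ ^ 2 + 1) + t * (C * ‖v‖ ^ 2)) (𝓝[>] 0)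
        (𝓝 (ν * (‖v‖ ^ 2 + 1) + 0 * (C * ‖v‖ ^ 2))) := by
      refine Tendsto.mono_left (Continuous.tendsto ?_ 0) nhdsWithin_le_nhds
      fun_prop
    simpa using ge_of_tendsto hlim2 hev
  by_contra hne
  have hpos : 0 < |m| := abs_pos.2 hne
  have h1 := key (|m| / (2 * (‖v‖ ^ 2 + 1))) (by positivity)
  have h2 : |m| / (2 * (‖v‖ ^ 2 + 1)) * (‖v‖ ^ 2 + 1) = |m| / 2 := by field_simp
  linarith

theorem integrable_inner_mul_inner (hr : IsRegularAt μ p θ₀ ℓ) (u v : EuclideanSpace ℝ (Fin d)) :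
    Integrable (fun y => inner ℝ u (ℓ y) * inner ℝ v (ℓ y)) (obsLaw μ p θ₀) :=
  (hr.memLp_score.const_inner u).integrable_mul (hr.memLp_score.const_inner v)

theorem inner_fisherInfo (hr : IsRegularAt μ p θ₀ ℓ) (u v : EuclideanSpace ℝ (Fin d)) :
    inner ℝ u (Matrix.toEuclideanCLM (𝕜 := ℝ) (fisherInfo μ p θ₀ ℓ) v)
      = ∫ y, inner ℝ u (ℓ y) * inner ℝ v (ℓ y) ∂(obsLaw μ p θ₀) := by
  have hj : ∀ j, MemLp (fun y => ℓ y j) 2 (obsLaw μ p θ₀) := fun j =>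
    (EuclideanSpace.proj (𝕜 := ℝ) j).comp_memLp' hr.memLp_score
  have hi : ∀ i j, Integrable (fun y => ℓ y i * ℓ y j) (obsLaw μ p θ₀) := fun i j =>
    (hj i).integrable_mul (hj j)
  have e : ∀ y, inner ℝ u (ℓ y) * inner ℝ v (ℓ y)
      = ∑ i, ∑ j, u i * v j * (ℓ y i * ℓ y j) := by
    intro y
    rw [PiLp.inner_apply, PiLp.inner_apply, Finset.sum_mul_sum]
    refine Finset.sum_congr rfl fun i _ => Finset.sum_congr rfl fun j _ => ?_
    simp
    ring
  simp_rw [e]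
  rw [integral_finsetSum _ fun i _ => integrable_finsetSum _ fun j _ => (hi i j).const_mul _,
    Matrix.inner_toEuclideanCLM]
  simp_rw [dotProduct, Matrix.mulVec, dotProduct, Finset.mul_sum]
  refine Finset.sum_congr rfl fun i _ => ?_
  rw [integral_finsetSum _ fun j _ => (hi i j).const_mul _]
  refine Finset.sum_congr rfl fun j _ => ?_
  rw [integral_const_mul, fisherInfo, Matrix.of_apply]
  ring

theorem inner_fisherInfo_self_nonneg (hr : IsRegularAt μ p θ₀ ℓ) (h : EuclideanSpace ℝ (Fin d)) :
    0 ≤ inner ℝ h (Matrix.toEuclideanCLM (𝕜 := ℝ) (fisherInfo μ p θ₀ ℓ) h) := by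
  rw [hr.inner_fisherInfo]
  exact integral_nonneg fun y => mul_self_nonneg _

theorem fisherInfo_posDef (hr : IsRegularAt μ p θ₀ ℓ) (hI : IsUnit (fisherInfo μ p θ₀ ℓ)) :
    (fisherInfo μ p θ₀ ℓ).PosDef := by
  refine (Matrix.PosSemidef.posDef_iff_isUnit ?_).2 hI
  refine Matrix.PosSemidef.of_dotProduct_mulVec_nonneg ?_ fun x => ?_
  · ext i j
    simp [fisherInfo, mul_comm]
  · have h1 := Matrix.inner_toEuclideanCLM (fisherInfo μ p θ₀ ℓ) (WithLp.toLp 2 x) (WithLp.toLp 2 x)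
    have h2 : 0 ≤ inner ℝ (WithLp.toLp 2 x : EuclideanSpace ℝ (Fin d))
        (Matrix.toEuclideanCLM (𝕜 := ℝ) (fisherInfo μ p θ₀ ℓ) (WithLp.toLp 2 x)) := by
      rw [hr.inner_fisherInfo]
      exact integral_nonneg fun y => mul_self_nonneg _
    rw [h1] at h2
    simpa using h2

theorem exists_le_inner_fisherInfo (hr : IsRegularAt μ p θ₀ ℓ)
    (hI : IsUnit (fisherInfo μ p θ₀ ℓ)) :
    ∃ c : ℝ, 0 < c ∧ ∀ h : EuclideanSpace ℝ (Fin d),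
      c * ‖h‖ ^ 2 ≤ inner ℝ h (Matrix.toEuclideanCLM (𝕜 := ℝ) (fisherInfo μ p θ₀ ℓ) h) := by
  set A := Matrix.toEuclideanCLM (𝕜 := ℝ) (fisherInfo μ p θ₀ ℓ)
  have hpos : ∀ h, h ≠ 0 → 0 < inner ℝ h (A h) := by
    intro h hh
    have h1 := (hr.fisherInfo_posDef hI).dotProduct_mulVec_pos (x := WithLp.ofLp h) (by simpa)
    have h2 := Matrix.inner_toEuclideanCLM (fisherInfo μ p θ₀ ℓ) h h
    rw [h2]
    simpa using h1
  have hcont : Continuous fun h => inner ℝ h (A h) := by fun_prop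
  rcases (Metric.sphere (0 : EuclideanSpace ℝ (Fin d)) 1).eq_empty_or_nonempty with h0 | h0
  · refine ⟨1, one_pos, fun h => ?_⟩
    have : h = 0 := by
      by_contra hne
      have h1 : (‖h‖⁻¹ • h) ∈ Metric.sphere (0 : EuclideanSpace ℝ (Fin d)) 1 := by
        rw [mem_sphere_zero_iff_norm, norm_smul, norm_inv, norm_norm]
        exact inv_mul_cancel₀ (norm_ne_zero_iff.2 hne)
      rw [h0] at h1
      exact h1
    simp [this]
  · obtain ⟨x, hx, hmin⟩ := (isCompact_sphere (0 : EuclideanSpace ℝ (Fin d)) 1).exists_isMinOn h0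
      hcont.continuousOn
    have hx0 : x ≠ 0 := by
      rintro rfl
      simp at hx
    refine ⟨_, hpos x hx0, fun h => ?_⟩
    by_cases hne : h = 0
    · simp [hne]
    have hn : 0 < ‖h‖ := norm_pos_iff.2 hne
    have h1 : (‖h‖⁻¹ • h) ∈ Metric.sphere (0 : EuclideanSpace ℝ (Fin d)) 1 := by
      rw [mem_sphere_zero_iff_norm, norm_smul, norm_inv, norm_norm]
      exact inv_mul_cancel₀ hn.ne'
    have h2 : inner ℝ x (A x) ≤ inner ℝ (‖h‖⁻¹ • h) (A (‖h‖⁻¹ • h)) := hmin h1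
    rw [map_smul, real_inner_smul_left, real_inner_smul_right] at h2
    calc inner ℝ x (A x) * ‖h‖ ^ 2 ≤ ‖h‖⁻¹ * (‖h‖⁻¹ * inner ℝ h (A h)) * ‖h‖ ^ 2 := by gcongr
      _ = inner ℝ h (A h) := by field_simp

end IsRegularAt

end

/-! ### Truncated scores -/

/-- The score truncated at `‖ℓ‖ ≤ K` and recentred under `P`. -/
noncomputable def truncScore (P : Measure 𝒴) (ℓ : 𝒴 → EuclideanSpace ℝ (Fin d)) (K : ℝ)
    (y : 𝒴) : EuclideanSpace ℝ (Fin d) :=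
  {z | ‖ℓ z‖ ≤ K}.indicator ℓ y - ∫ z, {z | ‖ℓ z‖ ≤ K}.indicator ℓ z ∂P

section Trunc

variable {P : Measure 𝒴} {ℓ : 𝒴 → EuclideanSpace ℝ (Fin d)}

theorem measurable_truncScore (hℓ : Measurable ℓ) (K : ℝ) : Measurable (truncScore P ℓ K) :=
  (hℓ.indicator (measurableSet_le hℓ.norm measurable_const)).sub measurable_const

theorem norm_indicator_le {Z : Type*} {ℓ : Z → EuclideanSpace ℝ (Fin d)} {K : ℝ} (hK : 0 ≤ K)
    (y : Z) :
    ‖{z | ‖ℓ z‖ ≤ K}.indicator ℓ y‖ ≤ K := by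
  by_cases hy : y ∈ {z | ‖ℓ z‖ ≤ K}
  · rw [Set.indicator_of_mem hy]; exact hy
  · rw [Set.indicator_of_notMem hy]; simpa using hK

variable [IsProbabilityMeasure P]

theorem norm_truncScore_le {K : ℝ} (hK : 0 ≤ K) (y : 𝒴) : ‖truncScore P ℓ K y‖ ≤ 2 * K := by
  have h1 : ‖∫ z, {z | ‖ℓ z‖ ≤ K}.indicator ℓ z ∂P‖ ≤ K := by
    simpa using norm_integral_le_of_norm_le_const (μ := P) (ae_of_all _ fun y =>
      norm_indicator_le (ℓ := ℓ) hK y)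
  calc _ ≤ K + K := (norm_sub_le _ _).trans (add_le_add (norm_indicator_le hK y) h1)
    _ = 2 * K := by ring

theorem memLp_truncScore (hℓ : Measurable ℓ) {K : ℝ} (hK : 0 ≤ K) :
    MemLp (truncScore P ℓ K) 2 P :=
  MemLp.of_bound (measurable_truncScore hℓ K).aestronglyMeasurable (2 * K)
    (ae_of_all _ (norm_truncScore_le hK))

theorem integral_truncScore (hℓ : Measurable ℓ) {K : ℝ} (hK : 0 ≤ K) :
    ∫ y, truncScore P ℓ K y ∂P = 0 := by
  have hi : Integrable ({z | ‖ℓ z‖ ≤ K}.indicator ℓ) P :=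
    (MemLp.of_bound (p := 1) (hℓ.indicator
      (measurableSet_le hℓ.norm measurable_const)).aestronglyMeasurable K
      (ae_of_all _ (norm_indicator_le hK))).integrable le_rfl
  unfold truncScore
  rw [integral_sub hi (integrable_const _)]
  simp

theorem tendsto_indicator_score {Z : Type*} {ℓ : Z → EuclideanSpace ℝ (Fin d)} (y : Z) :
    Tendsto (fun K : ℝ => {z | ‖ℓ z‖ ≤ K}.indicator ℓ y) atTop (𝓝 (ℓ y)) := by
  refine tendsto_const_nhds.congr' ?_
  filter_upwards [eventually_ge_atTop ‖ℓ y‖] with K hK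
  exact (Set.indicator_of_mem (show y ∈ {z | ‖ℓ z‖ ≤ K} from hK) ℓ).symm

theorem tendsto_integral_sq_sub_truncScore (hℓ : Measurable ℓ) (h2 : MemLp ℓ 2 P)
    (h0 : ∫ y, ℓ y ∂P = 0) :
    Tendsto (fun K : ℝ => ∫ y, ‖ℓ y - truncScore P ℓ K y‖ ^ 2 ∂P) atTop (𝓝 0) := by
  have hℓi : Integrable ℓ P := h2.integrable (by norm_num)
  have hmeas : ∀ K : ℝ, Measurable ({z | ‖ℓ z‖ ≤ K}.indicator ℓ) := fun K =>
    hℓ.indicator (measurableSet_le hℓ.norm measurable_const)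
  have hle : ∀ (K : ℝ) (y : 𝒴), ‖{z | ‖ℓ z‖ ≤ K}.indicator ℓ y‖ ≤ ‖ℓ y‖ := fun K y =>
    norm_indicator_le_norm_self _ _
  have hm : Tendsto (fun K : ℝ => ∫ z, {z | ‖ℓ z‖ ≤ K}.indicator ℓ z ∂P) atTop (𝓝 0) := by
    rw [← h0]
    exact tendsto_integral_filter_of_dominated_convergence (fun y => ‖ℓ y‖)
      (Eventually.of_forall fun K => (hmeas K).aestronglyMeasurable)
      (Eventually.of_forall fun K => ae_of_all _ (hle K)) hℓi.norm
      (ae_of_all _ tendsto_indicator_score)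
  have hB : ∀ K : ℝ, ‖∫ z, {z | ‖ℓ z‖ ≤ K}.indicator ℓ z ∂P‖ ≤ ∫ z, ‖ℓ z‖ ∂P := fun K =>
    norm_integral_le_of_norm_le hℓi.norm (ae_of_all _ (hle K))
  have hlim := tendsto_integral_filter_of_dominated_convergence (μ := P) (l := atTop)
    (F := fun (K : ℝ) y => ‖ℓ y - truncScore P ℓ K y‖ ^ 2) (f := fun _ => 0)
    (fun y => 8 * ‖ℓ y‖ ^ 2 + 2 * (∫ z, ‖ℓ z‖ ∂P) ^ 2)
    (Eventually.of_forall fun K =>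
      ((hℓ.sub (measurable_truncScore hℓ K)).norm.pow_const 2).aestronglyMeasurable)
    (Eventually.of_forall fun K => ae_of_all _ fun y => ?_)
    ((((memLp_two_iff_integrable_sq_norm hℓ.aestronglyMeasurable).1 h2).const_mul 8).add
      (integrable_const _))
    (ae_of_all _ fun y => ?_)
  · simpa using hlim
  · rw [Real.norm_of_nonneg (sq_nonneg _)]
    have e1 : ‖ℓ y - truncScore P ℓ K y‖ ≤ 2 * ‖ℓ y‖ + ∫ z, ‖ℓ z‖ ∂P := by
      unfold truncScore
      have := norm_sub_le (ℓ y) ({z | ‖ℓ z‖ ≤ K}.indicator ℓ y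
        - ∫ z, {z | ‖ℓ z‖ ≤ K}.indicator ℓ z ∂P)
      have := norm_sub_le ({z | ‖ℓ z‖ ≤ K}.indicator ℓ y)
        (∫ z, {z | ‖ℓ z‖ ≤ K}.indicator ℓ z ∂P)
      linarith [hB K, hle K y]
    calc _ ≤ (2 * ‖ℓ y‖ + ∫ z, ‖ℓ z‖ ∂P) ^ 2 := by gcongr
      _ ≤ _ := by nlinarith [sq_nonneg (2 * ‖ℓ y‖ - ∫ z, ‖ℓ z‖ ∂P)]
  · have h1 : Tendsto (fun K : ℝ => ℓ y - truncScore P ℓ K y) atTop (𝓝 (ℓ y - (ℓ y - 0))) :=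
      tendsto_const_nhds.sub ((tendsto_indicator_score y).sub hm)
    simpa using (h1.norm.pow 2)

end Trunc

theorem abs_sq_sub_sq_le {τ : ℝ} (hτ : 0 < τ) (x z : ℝ) :
    |x ^ 2 - z ^ 2| ≤ (1 + 2 / τ) * (x - z) ^ 2 + τ / 2 * x ^ 2 := by
  have f1 : (1 + 2 / τ) * (x - z) ^ 2 + τ / 2 * x ^ 2 - (x ^ 2 - z ^ 2)
    = 2 / τ * ((x - z) - τ / 2 * x) ^ 2 + 2 * (x - z) ^ 2 := by field_simp; ring
  have f2 : (1 + 2 / τ) * (x - z) ^ 2 + τ / 2 * x ^ 2 + (x ^ 2 - z ^ 2)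
    = 2 / τ * ((x - z) + τ / 2 * x) ^ 2 := by field_simp; ring
  have f3 : 0 ≤ 2 / τ * ((x - z) - τ / 2 * x) ^ 2 + 2 * (x - z) ^ 2 := by positivity
  have f4 : 0 ≤ 2 / τ * ((x - z) + τ / 2 * x) ^ 2 := by positivity
  exact abs_le.2 ⟨by linarith, by linarith⟩

/-! ### One observation under an exponential tilt -/

theorem abs_exp_two_mul_sub_le {w : ℝ} (hw : |2 * w| ≤ 1) :
    |Real.exp (2 * w) - 1 - (2 * w + 2 * w ^ 2)| ≤ 2 * |w| * w ^ 2 := by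
  have h := Real.exp_bound hw (n := 3) (by norm_num)
  simp only [Finset.sum_range_succ, Finset.sum_range_zero, Nat.factorial] at h
  norm_num at h
  have e1 : |w| ^ 3 = |w| * w ^ 2 := by rw [pow_succ', sq_abs]
  have e2 : Real.exp (2 * w) - 1 - (2 * w + 2 * w ^ 2)
    = Real.exp (2 * w) - (1 + 2 * w + (2 * w) ^ 2 / 2) := by ring
  rw [e2]
  refine h.trans ?_
  rw [mul_pow, e1]
  have : 0 ≤ |w| * w ^ 2 := by positivity
  nlinarith

/-- The moments of the exponential tilt `w n = X n / √n - κ / n` of a centred variable `X n` with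
`E (X n)² → κ`: its square has mass `1 + o(1/n)`, and it agrees with `1 + X n / √n` up to an error
of order `o(1/√n)` in `L²`. -/
theorem tendsto_tilt (P : Measure 𝒴) [IsProbabilityMeasure P] {X : ℕ → 𝒴 → ℝ} {B : ℕ → ℝ} {κ : ℝ}
    (hκ : 0 ≤ κ) (hX : ∀ n, Measurable (X n)) (hXB : ∀ n y, |X n y| ≤ B n)
    (hB : Tendsto (fun n : ℕ => B n / √(n : ℝ)) atTop (𝓝 0)) (h0 : ∀ n, ∫ y, X n y ∂P = 0)
    (h2 : Tendsto (fun n => ∫ y, X n y ^ 2 ∂P) atTop (𝓝 κ)) :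
    Tendsto (fun n : ℕ => (n : ℝ) *
      (∫ y, Real.exp (2 * (X n y / √(n : ℝ) - κ / n)) ∂P - 1)) atTop (𝓝 0) ∧
    Tendsto (fun n : ℕ => (n : ℝ) *
      ∫ y, (1 + X n y / √(n : ℝ) - Real.exp (X n y / √(n : ℝ) - κ / n)) ^ 2 ∂P)
      atTop (𝓝 0) := by
  have hκn : Tendsto (fun n : ℕ => κ / (n : ℝ)) atTop (𝓝 0) :=
    tendsto_const_div_atTop_nhds_zero_nat κ
  set ω : ℕ → ℝ := fun n => B n / √(n : ℝ) + κ / n with hω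
  have hω0 : Tendsto ω atTop (𝓝 0) := by simpa using hB.add hκn
  have hXm : ∀ n, MemLp (X n) 2 P := fun n =>
    MemLp.of_bound (hX n).aestronglyMeasurable (B n) (ae_of_all _ (hXB n))
  have hXi : ∀ n, Integrable (X n) P := fun n => (hXm n).integrable (by norm_num)
  have hX2i : ∀ n, Integrable (fun y => X n y ^ 2) P := fun n => (hXm n).integrable_sq
  let w : ℕ → 𝒴 → ℝ := fun n y => X n y / √(n : ℝ) - κ / n
  have hwm : ∀ n, Measurable (w n) := fun n => ((hX n).div_const _).sub measurable_const
  have hwω : ∀ n y, |w n y| ≤ ω n := by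
    intro n y
    have h1 : |X n y / √(n : ℝ)| ≤ B n / √(n : ℝ) := by
      rw [abs_div, abs_of_nonneg (Real.sqrt_nonneg _)]
      gcongr
      exact hXB n y
    have h3 : |κ / (n : ℝ)| = κ / n := abs_of_nonneg (by positivity)
    exact (abs_sub _ _).trans (by rw [h3]; exact add_le_add h1 le_rfl)
  have hωnn : ∀ n, 0 ≤ ω n := by
    intro n
    obtain ⟨y⟩ : Nonempty 𝒴 := P.nonempty_of_neZero
    exact (abs_nonneg _).trans (hwω n y)
  have hwi : ∀ n, Integrable (w n) P := fun n => ((hXi n).div_const _).sub (integrable_const _)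
  have hw2i : ∀ n, Integrable (fun y => w n y ^ 2) P := fun n =>
    (MemLp.of_bound (p := 2) (hwm n).aestronglyMeasurable (ω n) (ae_of_all _ (hwω n))).integrable_sq
  have hw1 : ∀ n, ∫ y, w n y ∂P = -(κ / n) := fun n => by
    simp only [w]
    rw [integral_sub ((hXi n).div_const _) (integrable_const _), integral_div, h0 n]
    simp
  have hw2 : ∀ n : ℕ, 0 < n → n * ∫ y, w n y ^ 2 ∂P = ∫ y, X n y ^ 2 ∂P + κ ^ 2 / n := by
    intro n hn
    have hn' : (0 : ℝ) < n := by exact_mod_cast hn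
    have e : ∀ y, w n y ^ 2 = (n : ℝ)⁻¹ * X n y ^ 2 - 2 * (κ / n) / √(n : ℝ) * X n y
        + (κ / n) ^ 2 := by
      intro y
      have e1 : √(n : ℝ) ^ 2 = n := Real.sq_sqrt hn'.le
      have e2 : (X n y / √(n : ℝ)) ^ 2 = (n : ℝ)⁻¹ * X n y ^ 2 := by
        rw [div_pow, e1]; field_simp
      simp only [w]
      rw [sub_sq, e2]
      ring
    simp_rw [e]
    rw [integral_add (by exact ((hX2i n).const_mul _).sub ((hXi n).const_mul _)) (integrable_const _),
      integral_sub ((hX2i n).const_mul _) ((hXi n).const_mul _), integral_const_mul,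
      integral_const_mul, h0 n]
    simp
    field_simp
  have hω1 : ∀ᶠ n in atTop, 2 * ω n ≤ 1 := by
    have := (hω0.const_mul 2).eventually (ge_mem_nhds (show (2 * 0 : ℝ) < 1 by norm_num))
    exact this
  have hlimQ : Tendsto (fun n : ℕ => ∫ y, X n y ^ 2 ∂P + κ ^ 2 / n) atTop (𝓝 (κ + 0)) :=
    h2.add (tendsto_const_div_atTop_nhds_zero_nat _)
  constructor
  · have hmain : Tendsto (fun n : ℕ => -2 * κ + 2 * (∫ y, X n y ^ 2 ∂P + κ ^ 2 / n)) atTop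
        (𝓝 (-2 * κ + 2 * (κ + 0))) := tendsto_const_nhds.add (hlimQ.const_mul 2)
    have herr : Tendsto (fun n : ℕ => 2 * ω n * (∫ y, X n y ^ 2 ∂P + κ ^ 2 / n)) atTop
        (𝓝 (2 * 0 * (κ + 0))) := (hω0.const_mul 2).mul hlimQ
    have hdiff : Tendsto (fun n : ℕ => n * (∫ y, Real.exp (2 * w n y) ∂P - 1)
        - (-2 * κ + 2 * (∫ y, X n y ^ 2 ∂P + κ ^ 2 / n))) atTop (𝓝 0) := by
      refine squeeze_zero_norm' ?_ (by simpa using herr)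
      filter_upwards [hω1, eventually_gt_atTop 0] with n hn hn0
      have hn' : (0 : ℝ) < n := by exact_mod_cast hn0
      have hei : Integrable (fun y => Real.exp (2 * w n y)) P := by
        refine (MemLp.of_bound (p := 1) ((hwm n).const_mul 2).exp.aestronglyMeasurable
          (Real.exp (2 * ω n)) (ae_of_all _ fun y => ?_)).integrable le_rfl
        rw [Real.norm_of_nonneg (Real.exp_pos _).le]
        exact Real.exp_le_exp.2 (by linarith [(le_abs_self _).trans (hwω n y)])
      have e1 : n * (∫ y, Real.exp (2 * w n y) ∂P - 1)
          - (-2 * κ + 2 * (∫ y, X n y ^ 2 ∂P + κ ^ 2 / n))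
          = n * ∫ y, (Real.exp (2 * w n y) - 1 - (2 * w n y + 2 * w n y ^ 2)) ∂P := by
        rw [← hw2 n hn0, integral_sub (by exact hei.sub (integrable_const _))
          (by exact ((hwi n).const_mul 2).add ((hw2i n).const_mul 2)), integral_sub hei (integrable_const _),
          integral_add ((hwi n).const_mul 2) ((hw2i n).const_mul 2), integral_const_mul,
          integral_const_mul, hw1 n]
        simp
        field_simp
      rw [e1, norm_mul, Real.norm_of_nonneg hn'.le, ← hw2 n hn0, mul_left_comm]
      gcongr
      rw [← integral_const_mul]
      refine norm_integral_le_of_norm_le ((hw2i n).const_mul _) (ae_of_all _ fun y => ?_)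
      rw [Real.norm_eq_abs]
      refine (abs_exp_two_mul_sub_le ?_).trans ?_
      · rw [abs_mul, abs_two]
        linarith [hwω n y]
      · have := hwω n y
        gcongr
    have := hdiff.add hmain
    simp only [sub_add_cancel] at this
    convert this using 2
    ring
  · have herr : Tendsto (fun n : ℕ => 2 * ω n ^ 2 * (∫ y, X n y ^ 2 ∂P + κ ^ 2 / n)
        + 2 * κ ^ 2 / n) atTop (𝓝 (2 * 0 ^ 2 * (κ + 0) + 0)) :=
      (((hω0.pow 2).const_mul 2).mul hlimQ).add (tendsto_const_div_atTop_nhds_zero_nat _)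
    refine squeeze_zero' (Eventually.of_forall fun n => by positivity) ?_ (by simpa using herr)
    filter_upwards [hω1, eventually_gt_atTop 0] with n hn hn0
    have hn' : (0 : ℝ) < n := by exact_mod_cast hn0
    have hb : ∀ y, (1 + X n y / √(n : ℝ) - Real.exp (X n y / √(n : ℝ) - κ / n)) ^ 2
        ≤ 2 * ω n ^ 2 * w n y ^ 2 + 2 * (κ / n) ^ 2 := by
      intro y
      have h1 := Real.abs_exp_sub_one_sub_id_le (x := w n y) (by linarith [hwω n y, hωnn n])
      have e1 : 1 + X n y / √(n : ℝ) - Real.exp (X n y / √(n : ℝ) - κ / n)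
        = κ / n - (Real.exp (w n y) - 1 - w n y) := by simp only [w]; ring
      rw [e1]
      have h3 : (Real.exp (w n y) - 1 - w n y) ^ 2 ≤ ω n ^ 2 * w n y ^ 2 := by
        rw [← sq_abs]
        calc _ ≤ (w n y ^ 2) ^ 2 := by gcongr
          _ = |w n y| ^ 2 * w n y ^ 2 := by rw [sq_abs]; ring
          _ ≤ _ := by gcongr; exact hwω n y
      nlinarith [sq_nonneg (κ / n + (Real.exp (w n y) - 1 - w n y))]
    calc _ ≤ (n : ℝ) * ∫ y, (2 * ω n ^ 2 * w n y ^ 2 + 2 * (κ / n) ^ 2) ∂P := by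
          gcongr ?_ * ?_
          refine integral_mono_of_nonneg (ae_of_all _ fun y => sq_nonneg _)
            (((hw2i n).const_mul _).add (integrable_const _)) (ae_of_all _ hb)
      _ = _ := by
          rw [integral_add ((hw2i n).const_mul _) (integrable_const _), integral_const_mul,
            ← hw2 n hn0]
          simp
          field_simp

/-! ### From one observation to the sample -/

/-- If the square roots `a n`, `b n` of two densities are at `L²(μ)`-distance `o(1/√n)`, then the
`n`-fold product densities are asymptotically equal in `L¹`. The inner product of the product roots
is the `n`-th power `(∫ a b)ⁿ = (1 + o(1/n))ⁿ`. -/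
theorem tendsto_lintegral_prod_sq_sub (μ : Measure 𝒴) [SigmaFinite μ] {a b : ℕ → 𝒴 → ℝ}
    (ha : ∀ n, Measurable (a n)) (hb : ∀ n, Measurable (b n))
    (hai : ∀ᶠ n in atTop, Integrable (fun y => a n y ^ 2) μ ∧ ∫ y, a n y ^ 2 ∂μ = 1)
    (hbi : ∀ᶠ n in atTop, Integrable (fun y => b n y ^ 2) μ)
    (hb1 : Tendsto (fun n : ℕ => n * (∫ y, b n y ^ 2 ∂μ - 1)) atTop (𝓝 0))
    (hab : Tendsto (fun n : ℕ => n * ∫ y, (a n y - b n y) ^ 2 ∂μ) atTop (𝓝 0)) :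
    Tendsto (fun n : ℕ => ∫⁻ y, ‖∏ i, a n (y i) ^ 2 - ∏ i, b n (y i) ^ 2‖ₑ
      ∂(Measure.pi fun _ : Fin n => μ)) atTop (𝓝 0) := by
  set D : ℕ → ℝ := fun n => ∫ y, (∏ i, a n (y i) - ∏ i, b n (y i)) ^ 2
    ∂(Measure.pi fun _ : Fin n => μ) with hD
  have habi : ∀ᶠ n in atTop, Integrable (fun y => a n y * b n y) μ := by
    filter_upwards [hai, hbi] with n h1 h2
    exact ((memLp_two_iff_integrable_sq (ha n).aestronglyMeasurable).2 h1.1).integrable_mul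
      ((memLp_two_iff_integrable_sq (hb n).aestronglyMeasurable).2 h2)
  have hexp : ∀ n (y : Fin n → 𝒴), (∏ i, a n (y i) - ∏ i, b n (y i)) ^ 2
      = ∏ i, a n (y i) ^ 2 - 2 * ∏ i, a n (y i) * b n (y i) + ∏ i, b n (y i) ^ 2 := by
    intro n y
    rw [Finset.prod_mul_distrib, Finset.prod_pow, Finset.prod_pow]
    ring
  have hint : ∀ᶠ n in atTop, Integrable (fun y : Fin n → 𝒴 => ∏ i, a n (y i) ^ 2)
        (Measure.pi fun _ : Fin n => μ) ∧
      Integrable (fun y : Fin n → 𝒴 => (∏ i, a n (y i) - ∏ i, b n (y i)) ^ 2)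
        (Measure.pi fun _ : Fin n => μ) ∧
      D n = 1 - 2 * (∫ y, a n y * b n y ∂μ) ^ n + (∫ y, b n y ^ 2 ∂μ) ^ n := by
    filter_upwards [hai, hbi, habi] with n h1 h2 h3
    have i1 : Integrable (fun y : Fin n → 𝒴 => ∏ i, a n (y i) ^ 2)
      (Measure.pi fun _ : Fin n => μ) := .fintype_prod fun _ => h1.1
    have i2 : Integrable (fun y : Fin n → 𝒴 => ∏ i, b n (y i) ^ 2)
      (Measure.pi fun _ : Fin n => μ) := .fintype_prod fun _ => h2
    have i3 : Integrable (fun y : Fin n → 𝒴 => ∏ i, a n (y i) * b n (y i))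
      (Measure.pi fun _ : Fin n => μ) := .fintype_prod (f := fun _ y => a n y * b n y) fun _ => h3
    refine ⟨i1, ?_, ?_⟩
    · simp_rw [hexp]
      exact (i1.sub (i3.const_mul 2)).add i2
    · simp only [hD]
      simp_rw [hexp]
      rw [integral_add (by exact i1.sub (i3.const_mul 2)) i2, integral_sub i1 (i3.const_mul 2),
        integral_const_mul, integral_fintype_prod_eq_pow (fun y => a n y ^ 2),
        integral_fintype_prod_eq_pow (fun y => b n y ^ 2),
        integral_fintype_prod_eq_pow (fun y => a n y * b n y), h1.2]
      simp
  have hD0 : Tendsto D atTop (𝓝 0) := by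
    have h1 : Tendsto (fun n : ℕ => (1 + (∫ y, b n y ^ 2 ∂μ - 1)) ^ n) atTop (𝓝 (Real.exp 0)) :=
      Real.tendsto_one_add_pow_exp_of_tendsto hb1
    have h2 : Tendsto (fun n : ℕ => n * (∫ y, a n y * b n y ∂μ - 1)) atTop (𝓝 0) := by
      have : Tendsto (fun n : ℕ => 1 / 2 * (n * (∫ y, b n y ^ 2 ∂μ - 1))
        - 1 / 2 * (n * ∫ y, (a n y - b n y) ^ 2 ∂μ)) atTop (𝓝 (1 / 2 * 0 - 1 / 2 * 0)) :=
        (hb1.const_mul _).sub (hab.const_mul _)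
      simp only [mul_zero, sub_zero] at this
      refine this.congr' ?_
      filter_upwards [hai, hbi, habi] with n h1 h2 h3
      have e : ∫ y, (a n y - b n y) ^ 2 ∂μ
          = 1 - 2 * ∫ y, a n y * b n y ∂μ + ∫ y, b n y ^ 2 ∂μ := by
        have : ∀ y, (a n y - b n y) ^ 2 = a n y ^ 2 - 2 * (a n y * b n y) + b n y ^ 2 := fun y => by
          ring
        simp_rw [this]
        rw [integral_add (by exact h1.1.sub (h3.const_mul 2)) h2,
          integral_sub h1.1 (h3.const_mul 2), integral_const_mul, h1.2]
      rw [e]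
      ring
    have h3 : Tendsto (fun n : ℕ => (1 + (∫ y, a n y * b n y ∂μ - 1)) ^ n) atTop
        (𝓝 (Real.exp 0)) := Real.tendsto_one_add_pow_exp_of_tendsto h2
    have h4 : Tendsto (fun n : ℕ => 1 - 2 * (1 + (∫ y, a n y * b n y ∂μ - 1)) ^ n
        + (1 + (∫ y, b n y ^ 2 ∂μ - 1)) ^ n) atTop (𝓝 (1 - 2 * Real.exp 0 + Real.exp 0)) :=
      (tendsto_const_nhds.sub (h3.const_mul 2)).add h1
    have h5 : (1 - 2 * Real.exp 0 + Real.exp 0 : ℝ) = 0 := by rw [Real.exp_zero]; norm_num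
    rw [h5] at h4
    refine h4.congr' ?_
    filter_upwards [hint] with n hn
    rw [hn.2.2]
    simp
  rw [ENNReal.tendsto_atTop_zero]
  intro ε hε
  obtain ⟨τ, hτ, hτε⟩ : ∃ τ : ℝ, 0 < τ ∧ ENNReal.ofReal τ < ε := by
    obtain ⟨t, ht0, ht⟩ := ENNReal.lt_iff_exists_nnreal_btwn.1 hε
    exact ⟨t, by exact_mod_cast ht0, by simpa using ht⟩
  have hlim : Tendsto (fun n => ENNReal.ofReal ((1 + 2 / τ) * D n + τ / 2)) atTop
      (𝓝 (ENNReal.ofReal ((1 + 2 / τ) * 0 + τ / 2))) :=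
    ENNReal.tendsto_ofReal ((hD0.const_mul _).add tendsto_const_nhds)
  have hlt : ENNReal.ofReal ((1 + 2 / τ) * 0 + τ / 2) < ε :=
    lt_of_le_of_lt (ENNReal.ofReal_le_ofReal (by linarith)) hτε
  refine eventually_atTop.1 ?_
  filter_upwards [hlim.eventually (ge_mem_nhds hlt), hint, hai] with n h1 h2 h3
  refine le_trans ?_ h1
  have hib : Integrable (fun y : Fin n → 𝒴 => (1 + 2 / τ) * (∏ i, a n (y i) - ∏ i, b n (y i)) ^ 2
      + τ / 2 * ∏ i, a n (y i) ^ 2) (Measure.pi fun _ : Fin n => μ) :=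
    (h2.2.1.const_mul _).add (h2.1.const_mul _)
  calc ∫⁻ y, ‖∏ i, a n (y i) ^ 2 - ∏ i, b n (y i) ^ 2‖ₑ ∂(Measure.pi fun _ : Fin n => μ)
      ≤ ∫⁻ y, ENNReal.ofReal ((1 + 2 / τ) * (∏ i, a n (y i) - ∏ i, b n (y i)) ^ 2
        + τ / 2 * ∏ i, a n (y i) ^ 2) ∂(Measure.pi fun _ : Fin n => μ) := by
        refine lintegral_mono fun y => ?_
        rw [Real.enorm_eq_ofReal_abs]
        refine ENNReal.ofReal_le_ofReal ?_
        rw [Finset.prod_pow, Finset.prod_pow]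
        exact abs_sq_sub_sq_le hτ _ _
    _ = ENNReal.ofReal ((1 + 2 / τ) * D n + τ / 2) := by
        rw [← ofReal_integral_eq_lintegral_ofReal hib (ae_of_all _ fun y => by positivity),
          integral_add (h2.2.1.const_mul _) (h2.1.const_mul _), integral_const_mul,
          integral_const_mul, integral_fintype_prod_eq_pow (fun y => a n y ^ 2), h3.2]
        simp [hD]

theorem tendsto_integral_sq_of_tendsto {P : Measure 𝒴} {ι : Type*} {l : Filter ι} {f : 𝒴 → ℝ}
    {g : ι → 𝒴 → ℝ} (hf : MemLp f 2 P) (hg : ∀ i, MemLp (g i) 2 P)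
    (h : Tendsto (fun i => ∫ y, (f y - g i y) ^ 2 ∂P) l (𝓝 0)) :
    Tendsto (fun i => ∫ y, g i y ^ 2 ∂P) l (𝓝 (∫ y, f y ^ 2 ∂P)) := by
  rw [Metric.tendsto_nhds]
  intro ε hε
  set F := ∫ y, f y ^ 2 ∂P
  have hF : 0 ≤ F := integral_nonneg fun y => sq_nonneg _
  set τ := ε / (F + 1)
  have hτ : 0 < τ := by positivity
  have hτF : τ / 2 * F < ε := by
    have e1 : τ * (F + 1) = ε := by simp only [τ]; field_simp
    nlinarith
  have hlim := (h.const_mul (1 + 2 / τ)).add_const (τ / 2 * F)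
  rw [mul_zero, zero_add] at hlim
  filter_upwards [hlim.eventually (gt_mem_nhds hτF)] with i hi
  have hfg : Integrable (fun y => (f y - g i y) ^ 2) P := (hf.sub (hg i)).integrable_sq
  rw [dist_comm, Real.dist_eq, ← integral_sub hf.integrable_sq (hg i).integrable_sq]
  rw [← Real.norm_eq_abs]
  refine lt_of_le_of_lt (norm_integral_le_of_norm_le
    ((hfg.const_mul (1 + 2 / τ)).add (hf.integrable_sq.const_mul (τ / 2)))
    (ae_of_all _ fun y => ?_)) ?_
  · rw [Real.norm_eq_abs]
    exact abs_sq_sub_sq_le hτ _ _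
  · simp only [Pi.add_apply]
    rw [integral_add (hfg.const_mul _) (hf.integrable_sq.const_mul _), integral_const_mul,
      integral_const_mul]
    exact hi

theorem abs_exp_sub_exp_le {x z m : ℝ} (hx : x ≤ m) (hz : z ≤ m) :
    |Real.exp x - Real.exp z| ≤ Real.exp m * |x - z| := by
  have key : ∀ x z : ℝ, x ≤ m → z ≤ m → Real.exp x - Real.exp z ≤ Real.exp m * |x - z| := by
    intro x z hx _
    have h1 : Real.exp z = Real.exp x * Real.exp (z - x) := by rw [← Real.exp_add]; congr 1; ring
    have h2 := Real.add_one_le_exp (z - x)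
    have h3 : Real.exp x - Real.exp z ≤ Real.exp x * (x - z) := by
      rw [h1]
      nlinarith [Real.exp_pos x]
    calc _ ≤ Real.exp x * |x - z| := h3.trans (by gcongr; exact le_abs_self _)
      _ ≤ _ := by gcongr
  refine abs_le.2 ⟨?_, key x z hx hz⟩
  have := key z x hz hx
  rw [abs_sub_comm] at this
  linarith

theorem tendsto_sqrt_natCast : Tendsto (fun n : ℕ => √(n : ℝ)) atTop atTop :=
  Real.tendsto_sqrt_atTop.comp tendsto_natCast_atTop_atTop

theorem tendsto_sqrt_sqrt_natCast : Tendsto (fun n : ℕ => √√(n : ℝ)) atTop atTop :=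
  Real.tendsto_sqrt_atTop.comp tendsto_sqrt_natCast

theorem tendsto_inv_sqrt_smul (h : EuclideanSpace ℝ (Fin d)) :
    Tendsto (fun n : ℕ => (√(n : ℝ))⁻¹ • h) atTop (𝓝 0) := by
  have := (tendsto_inv_atTop_zero.comp tendsto_sqrt_natCast).smul_const h
  simpa using this

theorem coe_likelihood {Z : Type*} (p : EuclideanSpace ℝ (Fin d) → Z → ℝ≥0) (n : ℕ)
    (y : Fin n → Z)
    (θ : EuclideanSpace ℝ (Fin d)) :
    (likelihood p n y θ : ℝ) = ∏ i, (p θ (y i) : ℝ) := by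
  simp [likelihood]

theorem lintegral_enorm_normSum_le (P : Measure 𝒴) [IsProbabilityMeasure P]
    {f : 𝒴 → EuclideanSpace ℝ (Fin d)} (hfm : Measurable f) (hf : MemLp f 2 P)
    (h0 : ∫ y, f y ∂P = 0) (n : ℕ) :
    ∫⁻ y, ‖normSum f n y‖ₑ ∂(Measure.pi fun _ : Fin n => P)
      ≤ ENNReal.ofReal (√(∫ y, ‖f y‖ ^ 2 ∂P)) := by
  obtain ⟨hi, hle⟩ := integral_sq_norm_normSum_le P hf h0 n
  have hm := (measurable_normSum hfm n).norm
  have hL2 : MemLp (fun y => ‖normSum f n y‖) 2 (Measure.pi fun _ : Fin n => P) :=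
    (memLp_two_iff_integrable_sq hm.aestronglyMeasurable).2 hi
  have hL1 := hL2.integrable (by norm_num)
  have hvar := variance_nonneg (fun y => ‖normSum f n y‖) (Measure.pi fun _ : Fin n => P)
  rw [variance_eq_sub hL2] at hvar
  have h1 : ∫⁻ y, ‖normSum f n y‖ₑ ∂(Measure.pi fun _ : Fin n => P)
      = ENNReal.ofReal (∫ y, ‖normSum f n y‖ ∂(Measure.pi fun _ : Fin n => P)) := by
    rw [ofReal_integral_eq_lintegral_ofReal hL1 (ae_of_all _ fun y => norm_nonneg _)]
    simp
  rw [h1]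
  refine ENNReal.ofReal_le_ofReal (Real.le_sqrt_of_sq_le ?_)
  simp only [Pi.pow_apply] at hvar
  linarith

namespace IsRegularAt

variable {μ : Measure 𝒴} [SigmaFinite μ] {p : EuclideanSpace ℝ (Fin d) → 𝒴 → ℝ≥0}
  {θ₀ : EuclideanSpace ℝ (Fin d)} {ℓ : 𝒴 → EuclideanSpace ℝ (Fin d)}

/-- Local asymptotic normality in `L¹`, with the score truncated at `n^{1/4}`. The truncation makes
the exponential of the score square integrable, so that no tightness argument is needed. -/
theorem tendsto_lintegral_likelihood_sub_trunc (hr : IsRegularAt μ p θ₀ ℓ)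
    (h : EuclideanSpace ℝ (Fin d)) :
    Tendsto (fun n : ℕ => ∫⁻ y, ‖(likelihood p n y (θ₀ + (√(n : ℝ))⁻¹ • h) : ℝ)
      - likelihood p n y θ₀ * limitRatio (Matrix.toEuclideanCLM (𝕜 := ℝ) (fisherInfo μ p θ₀ ℓ))
        (normSum (truncScore (obsLaw μ p θ₀) ℓ √√(n : ℝ)) n y) h‖ₑ
      ∂(Measure.pi fun _ : Fin n => μ)) atTop (𝓝 0) := by
  have hP := hr.isProbabilityMeasure
  have hp0 := hr.measurable_apply θ₀
  set P := obsLaw μ p θ₀ with hPdef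
  set A := Matrix.toEuclideanCLM (𝕜 := ℝ) (fisherInfo μ p θ₀ ℓ)
  set κ : ℝ := 1 / 4 * inner ℝ h (A h) with hκdef
  have hκ : 0 ≤ κ := mul_nonneg (by norm_num) (hr.inner_fisherInfo_self_nonneg h)
  set s : ℕ → 𝒴 → EuclideanSpace ℝ (Fin d) := fun n => truncScore P ℓ √√(n : ℝ) with hs
  have hsm : ∀ n, Measurable (s n) := fun n => measurable_truncScore hr.measurable_score _
  have hsL : ∀ n, MemLp (s n) 2 P := fun n =>
    memLp_truncScore hr.measurable_score (Real.sqrt_nonneg _)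
  have hs0 : Tendsto (fun n => ∫ y, ‖ℓ y - s n y‖ ^ 2 ∂P) atTop (𝓝 0) :=
    (tendsto_integral_sq_sub_truncScore hr.measurable_score hr.memLp_score
      hr.integral_score).comp tendsto_sqrt_sqrt_natCast
  have hdL : ∀ n, MemLp (fun y => ℓ y - s n y) 2 P := fun n => hr.memLp_score.sub (hsL n)
  have hd2 : ∀ n, Integrable (fun y => ‖ℓ y - s n y‖ ^ 2) P := fun n =>
    (memLp_two_iff_integrable_sq_norm (hdL n).aestronglyMeasurable).1 (hdL n)
  set X : ℕ → 𝒴 → ℝ := fun n y => 1 / 2 * inner ℝ h (s n y) with hX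
  have hXm : ∀ n, Measurable (X n) := fun n => (measurable_const.inner (hsm n)).const_mul _
  have hcs : ∀ v : EuclideanSpace ℝ (Fin d), (inner ℝ h v) ^ 2 ≤ ‖h‖ ^ 2 * ‖v‖ ^ 2 := fun v => by
    rw [← mul_pow, ← sq_abs]
    exact pow_le_pow_left₀ (abs_nonneg _) (abs_real_inner_le_norm h v) 2
  have hXB : ∀ n y, |X n y| ≤ ‖h‖ * √√(n : ℝ) := by
    intro n y
    rw [hX, abs_mul]
    have h1 := abs_real_inner_le_norm h (s n y)
    have h2 := norm_truncScore_le (P := P) (ℓ := ℓ) (Real.sqrt_nonneg √(n : ℝ)) y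
    have h3 : ‖h‖ * ‖s n y‖ ≤ ‖h‖ * (2 * √√(n : ℝ)) := by gcongr
    rw [abs_of_pos (by norm_num : (0 : ℝ) < 1 / 2)]
    linarith
  have hB : Tendsto (fun n : ℕ => ‖h‖ * √√(n : ℝ) / √(n : ℝ)) atTop (𝓝 0) := by
    have h1 := (tendsto_inv_atTop_zero.comp tendsto_sqrt_sqrt_natCast).const_mul ‖h‖
    rw [mul_zero] at h1
    refine h1.congr fun n => ?_
    have h2 : √(n : ℝ) = √√(n : ℝ) * √√(n : ℝ) := (Real.mul_self_sqrt (Real.sqrt_nonneg _)).symm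
    rw [Function.comp_apply, mul_div_assoc, h2]
    rcases eq_or_ne √√(n : ℝ) 0 with h3 | h3
    · simp [h3]
    · rw [← h2]
      congr 1
      rw [eq_div_iff (by rw [h2]; positivity), h2]
      simp only [Real.sqrt_mul_self (Real.sqrt_nonneg _)]
      field_simp
  have hX0 : ∀ n, ∫ y, X n y ∂P = 0 := by
    intro n
    simp only [hX]
    rw [integral_const_mul, integral_inner ((hsL n).integrable (by norm_num)),
      integral_truncScore hr.measurable_score (Real.sqrt_nonneg _), inner_zero_right, mul_zero]
  have hX2 : Tendsto (fun n => ∫ y, X n y ^ 2 ∂P) atTop (𝓝 κ) := by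
    have hκ' : κ = ∫ y, (1 / 2 * inner ℝ h (ℓ y)) ^ 2 ∂P := by
      rw [hκdef, hr.inner_fisherInfo, ← integral_const_mul]
      congr 1
      funext y
      ring
    rw [hκ']
    refine tendsto_integral_sq_of_tendsto ((hr.memLp_score.const_inner h).const_mul _)
      (fun n => ((hsL n).const_inner h).const_mul _) ?_
    have h1 := hs0.const_mul (1 / 4 * ‖h‖ ^ 2)
    rw [mul_zero] at h1
    refine squeeze_zero (fun n => integral_nonneg fun y => sq_nonneg _) (fun n => ?_) h1
    rw [← integral_const_mul]
    refine integral_mono_of_nonneg (ae_of_all _ fun y => sq_nonneg _) ((hd2 n).const_mul _)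
      (ae_of_all _ fun y => ?_)
    have h2 := hcs (ℓ y - s n y)
    simp only [hX]
    rw [← mul_sub, ← inner_sub_right, mul_pow]
    linarith
  obtain ⟨hT1, hT2⟩ := tendsto_tilt P hκ hXm hXB hB hX0 hX2
  set w : ℕ → 𝒴 → ℝ := fun n y => X n y / √(n : ℝ) - κ / n with hw
  have hwm : ∀ n, Measurable (w n) := fun n => ((hXm n).div_const _).sub measurable_const
  have hwB : ∀ n y, |w n y| ≤ ‖h‖ * √√(n : ℝ) / √(n : ℝ) + κ / n := by
    intro n y
    have h1 : |X n y / √(n : ℝ)| ≤ ‖h‖ * √√(n : ℝ) / √(n : ℝ) := by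
      rw [abs_div, abs_of_nonneg (Real.sqrt_nonneg _)]
      gcongr
      exact hXB n y
    have h3 : |κ / (n : ℝ)| = κ / n := abs_of_nonneg (by positivity)
    exact (abs_sub _ _).trans (by rw [h3]; exact add_le_add h1 le_rfl)
  set u : ℕ → EuclideanSpace ℝ (Fin d) := fun n => (√(n : ℝ))⁻¹ • h with hu
  have hu0 : Tendsto u atTop (𝓝 0) := tendsto_inv_sqrt_smul h
  have hun : ∀ n : ℕ, 0 < n → n * ‖u n‖ ^ 2 = ‖h‖ ^ 2 := by
    intro n hn
    have hn' : (0 : ℝ) < n := by exact_mod_cast hn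
    simp only [hu]
    rw [norm_smul, mul_pow, norm_inv, inv_pow, Real.norm_eq_abs, sq_abs, Real.sq_sqrt hn'.le]
    field_simp
  -- the roots of the density at `θ₀ + h/√n` and of its Gaussian approximation, one observation at a
  -- time; the products of their squares over the sample are to be compared
  let a : ℕ → 𝒴 → ℝ := fun n y => √(p (θ₀ + u n) y : ℝ)
  let b : ℕ → 𝒴 → ℝ := fun n y => √(p θ₀ y : ℝ) * Real.exp (w n y)
  have ham : ∀ n, Measurable (a n) := fun n => (hr.measurable_apply _).coe_nnreal_real.sqrt
  have hbm : ∀ n, Measurable (b n) := fun n => hp0.coe_nnreal_real.sqrt.mul (hwm n).exp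
  have ha2 : ∀ n y, a n y ^ 2 = (p (θ₀ + u n) y : ℝ) := fun n y =>
    Real.sq_sqrt (NNReal.coe_nonneg _)
  have hb2 : ∀ n y, b n y ^ 2 = (p θ₀ y : ℝ) • Real.exp (2 * w n y) := fun n y => by
    simp only [b]
    rw [mul_pow, Real.sq_sqrt (NNReal.coe_nonneg _), ← Real.exp_nat_mul, smul_eq_mul]
    norm_num
  have hai : ∀ᶠ n in atTop, Integrable (fun y => a n y ^ 2) μ ∧ ∫ y, a n y ^ 2 ∂μ = 1 := by
    simp_rw [ha2]
    exact hu0.eventually hr.integrable_and_integral_density_add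
  have hei : ∀ n, Integrable (fun y => Real.exp (2 * w n y)) P := fun n => by
    refine (MemLp.of_bound (p := 1) ((hwm n).const_mul 2).exp.aestronglyMeasurable
      (Real.exp (2 * (‖h‖ * √√(n : ℝ) / √(n : ℝ) + κ / n))) (ae_of_all _ fun y => ?_)).integrable
      le_rfl
    rw [Real.norm_of_nonneg (Real.exp_pos _).le]
    exact Real.exp_le_exp.2 (by linarith [(le_abs_self _).trans (hwB n y)])
  have hbi : ∀ n, Integrable (fun y => b n y ^ 2) μ := fun n => by
    simp_rw [hb2]
    exact (integrable_obsLaw_iff hp0).1 (hei n)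
  have hb1 : Tendsto (fun n : ℕ => n * (∫ y, b n y ^ 2 ∂μ - 1)) atTop (𝓝 0) := by
    simp_rw [hb2]
    simp_rw [← integral_obsLaw hp0]
    exact hT1
  have hR0 : Tendsto (fun n : ℕ => (n : ℝ) * ∫ y, dqmRem p θ₀ ℓ (u n) y ^ 2 ∂μ) atTop (𝓝 0) := by
    rw [Metric.tendsto_nhds]
    intro ε hε
    filter_upwards [hu0.eventually (hr.dqmRem_bound (show 0 < ε / (‖h‖ ^ 2 + 1) by positivity)),
      eventually_gt_atTop 0] with n hn hn0
    rw [Real.dist_eq, sub_zero, abs_of_nonneg (mul_nonneg (Nat.cast_nonneg _)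
      (integral_nonneg fun y => sq_nonneg _))]
    calc (n : ℝ) * ∫ y, dqmRem p θ₀ ℓ (u n) y ^ 2 ∂μ
        ≤ n * (ε / (‖h‖ ^ 2 + 1) * ‖u n‖ ^ 2) := by gcongr; exact hn.2
      _ = ε / (‖h‖ ^ 2 + 1) * ‖h‖ ^ 2 := by rw [← hun n hn0]; ring
      _ < ε := by
        rw [div_mul_eq_mul_div, div_lt_iff₀ (by positivity)]
        nlinarith
  have hab : Tendsto (fun n : ℕ => (n : ℝ) * ∫ y, (a n y - b n y) ^ 2 ∂μ) atTop (𝓝 0) := by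
    have hlim := ((hR0.add (hs0.const_mul (1 / 4 * ‖h‖ ^ 2))).add hT2).const_mul 3
    simp only [mul_zero, add_zero] at hlim
    refine squeeze_zero' (Eventually.of_forall fun n => mul_nonneg (Nat.cast_nonneg _)
      (integral_nonneg fun y => sq_nonneg _)) ?_ hlim
    filter_upwards [hu0.eventually (hr.dqmRem_bound one_pos), eventually_gt_atTop 0] with n hn hn0
    have hn' : (0 : ℝ) < n := by exact_mod_cast hn0
    have hTi : Integrable (fun y => (1 + X n y / √(n : ℝ) - Real.exp (w n y)) ^ 2) P := by
      have h1 : MemLp (fun y => 1 + X n y / √(n : ℝ)) 2 P :=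
        (memLp_const (1 : ℝ)).add (MemLp.of_bound ((hXm n).div_const _).aestronglyMeasurable
          (‖h‖ * √√(n : ℝ) / √(n : ℝ)) (ae_of_all _ fun y => by
            rw [norm_div, Real.norm_of_nonneg (Real.sqrt_nonneg _)]
            gcongr
            exact hXB n y))
      have h2 : MemLp (fun y => Real.exp (w n y)) 2 P :=
        MemLp.of_bound (hwm n).exp.aestronglyMeasurable
          (Real.exp (‖h‖ * √√(n : ℝ) / √(n : ℝ) + κ / n)) (ae_of_all _ fun y => by
            rw [Real.norm_of_nonneg (Real.exp_pos _).le]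
            exact Real.exp_le_exp.2 ((le_abs_self _).trans (hwB n y)))
      exact (h1.sub h2).integrable_sq
    have i2 := (integrable_obsLaw_iff hp0).1 (hd2 n)
    have i3 := (integrable_obsLaw_iff hp0).1 hTi
    have hpt : ∀ y, (a n y - b n y) ^ 2 ≤ 3 * dqmRem p θ₀ ℓ (u n) y ^ 2
        + 3 * (1 / 4 * ‖u n‖ ^ 2) * ((p θ₀ y : ℝ) • ‖ℓ y - s n y‖ ^ 2)
        + 3 * ((p θ₀ y : ℝ) • (1 + X n y / √(n : ℝ) - Real.exp (w n y)) ^ 2) := by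
      intro y
      have hin : inner ℝ (u n) (ℓ y - s n y) ^ 2 ≤ ‖u n‖ ^ 2 * ‖ℓ y - s n y‖ ^ 2 := by
        rw [← mul_pow, ← sq_abs]
        exact pow_le_pow_left₀ (abs_nonneg _) (abs_real_inner_le_norm _ _) 2
      have hXu : X n y / √(n : ℝ) = 1 / 2 * inner ℝ (u n) (s n y) := by
        simp only [hX, hu]
        rw [real_inner_smul_left]
        field_simp
      -- remainder of differentiability, truncation error, linearization error of the exponential
      have hdec : a n y - b n y = dqmRem p θ₀ ℓ (u n) y
          + √(p θ₀ y : ℝ) * (1 / 2 * inner ℝ (u n) (ℓ y - s n y))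
          + √(p θ₀ y : ℝ) * (1 + X n y / √(n : ℝ) - Real.exp (w n y)) := by
        rw [hXu, inner_sub_right]
        simp only [a, b, dqmRem]
        ring
      obtain ⟨r, e1, e1'⟩ := exists_sqrt_eq (p θ₀ y)
      rw [hdec, e1, smul_eq_mul, smul_eq_mul, e1']
      have hin' := mul_le_mul_of_nonneg_left hin (sq_nonneg r)
      generalize dqmRem p θ₀ ℓ (u n) y = R at *
      generalize inner ℝ (u n) (ℓ y - s n y) = q at *
      generalize 1 + X n y / √(n : ℝ) - Real.exp (w n y) = t at *
      nlinarith [sq_nonneg (R - r * (1 / 2 * q)), sq_nonneg (R - r * t),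
        sq_nonneg (r * (1 / 2 * q) - r * t)]
    calc (n : ℝ) * ∫ y, (a n y - b n y) ^ 2 ∂μ
        ≤ n * ∫ y, (3 * dqmRem p θ₀ ℓ (u n) y ^ 2
          + 3 * (1 / 4 * ‖u n‖ ^ 2) * ((p θ₀ y : ℝ) • ‖ℓ y - s n y‖ ^ 2)
          + 3 * ((p θ₀ y : ℝ) • (1 + X n y / √(n : ℝ) - Real.exp (w n y)) ^ 2)) ∂μ := by
          gcongr ?_ * ?_
          exact integral_mono_of_nonneg (ae_of_all _ fun y => sq_nonneg _)
            (((hn.1.const_mul _).add (i2.const_mul _)).add (i3.const_mul _)) (ae_of_all _ hpt)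
      _ = _ := by
          rw [integral_add (by exact (hn.1.const_mul _).add (i2.const_mul _)) (i3.const_mul _),
            integral_add (hn.1.const_mul _) (i2.const_mul _), integral_const_mul,
            integral_const_mul, integral_const_mul, ← integral_obsLaw hp0, ← integral_obsLaw hp0,
            ← hun n hn0]
          ring
  refine (tendsto_lintegral_prod_sq_sub μ ham hbm hai (Eventually.of_forall hbi) hb1 hab).congr' ?_
  filter_upwards [eventually_gt_atTop 0] with n hn0
  have hn' : (0 : ℝ) < n := by exact_mod_cast hn0
  refine lintegral_congr fun y => ?_
  rw [coe_likelihood, coe_likelihood]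
  simp_rw [ha2, hb2, smul_eq_mul]
  rw [Finset.prod_mul_distrib, ← Real.exp_sum]
  congr 3
  rw [limitRatio]
  congr 1
  simp only [hw, hX, normSum]
  rw [real_inner_smul_right, inner_sum, ← Finset.mul_sum, Finset.sum_sub_distrib,
    ← Finset.sum_div, ← Finset.mul_sum]
  simp only [Finset.sum_const, Finset.card_univ, Fintype.card_fin, nsmul_eq_mul, hκdef]
  field_simp
  ring

/-- Local asymptotic normality in `L¹`, on the event that the score sums are bounded. -/
theorem tendsto_setLIntegral_likelihood_sub (hr : IsRegularAt μ p θ₀ ℓ)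
    (h : EuclideanSpace ℝ (Fin d)) (M : ℝ) :
    Tendsto (fun n : ℕ => ∫⁻ y in {y | ‖normSum ℓ n y‖ ≤ M ∧
        ‖normSum (truncScore (obsLaw μ p θ₀) ℓ √√(n : ℝ)) n y‖ ≤ M},
      ‖(likelihood p n y (θ₀ + (√(n : ℝ))⁻¹ • h) : ℝ)
      - likelihood p n y θ₀ * limitRatio (Matrix.toEuclideanCLM (𝕜 := ℝ) (fisherInfo μ p θ₀ ℓ))
        (normSum ℓ n y) h‖ₑ ∂(Measure.pi fun _ : Fin n => μ)) atTop (𝓝 0) := by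
  have hP := hr.isProbabilityMeasure
  have hp0 := hr.measurable_apply θ₀
  set P := obsLaw μ p θ₀ with hPdef
  set A := Matrix.toEuclideanCLM (𝕜 := ℝ) (fisherInfo μ p θ₀ ℓ)
  set s : ℕ → 𝒴 → EuclideanSpace ℝ (Fin d) := fun n => truncScore P ℓ √√(n : ℝ) with hs
  have hsm : ∀ n, Measurable (s n) := fun n => measurable_truncScore hr.measurable_score _
  have hsL : ∀ n, MemLp (s n) 2 P := fun n =>
    memLp_truncScore hr.measurable_score (Real.sqrt_nonneg _)
  have hs0 : Tendsto (fun n => ∫ y, ‖ℓ y - s n y‖ ^ 2 ∂P) atTop (𝓝 0) :=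
    (tendsto_integral_sq_sub_truncScore hr.measurable_score hr.memLp_score
      hr.integral_score).comp tendsto_sqrt_sqrt_natCast
  have h1 := hr.tendsto_lintegral_likelihood_sub_trunc h
  have h2 : Tendsto (fun n : ℕ => ENNReal.ofReal (Real.exp (M * ‖h‖) * ‖h‖) *
      ENNReal.ofReal (√(∫ y, ‖ℓ y - s n y‖ ^ 2 ∂P))) atTop (𝓝 0) := by
    have h3 := ENNReal.tendsto_ofReal ((Real.continuous_sqrt.tendsto 0).comp hs0)
    rw [Real.sqrt_zero, ENNReal.ofReal_zero] at h3
    have h4 := ENNReal.Tendsto.const_mul (a := ENNReal.ofReal (Real.exp (M * ‖h‖) * ‖h‖)) h3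
      (Or.inr ENNReal.ofReal_ne_top)
    rw [mul_zero] at h4
    exact h4
  have h12 := h1.add h2
  rw [add_zero] at h12
  refine tendsto_of_tendsto_of_tendsto_of_le_of_le tendsto_const_nhds h12 (fun n => zero_le)
    fun n => ?_
  set G : Set (Fin n → 𝒴) := {y | ‖normSum ℓ n y‖ ≤ M ∧ ‖normSum (s n) n y‖ ≤ M} with hG
  have hLm : ∀ {S : (Fin n → 𝒴) → EuclideanSpace ℝ (Fin d)}, Measurable S →
      Measurable fun y => limitRatio A (S y) h := fun hS =>
    (continuous_limitRatio A).measurable.comp (hS.prodMk measurable_const)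
  have hm1 : Measurable fun y => ‖(likelihood p n y (θ₀ + (√(n : ℝ))⁻¹ • h) : ℝ)
      - likelihood p n y θ₀ * limitRatio A (normSum (s n) n y) h‖ₑ :=
    ((measurable_likelihood_left (hr.measurable_apply _) n).coe_nnreal_real.sub
      ((measurable_likelihood_left hp0 n).coe_nnreal_real.mul
        (hLm (measurable_normSum (hsm n) n)))).enorm
  have hdiff : ∀ y ∈ G, ‖limitRatio A (normSum (s n) n y) h - limitRatio A (normSum ℓ n y) h‖ₑ
      ≤ ENNReal.ofReal (Real.exp (M * ‖h‖) * ‖h‖) * ‖normSum (fun y => ℓ y - s n y) n y‖ₑ := by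
    intro y hy
    rw [Real.enorm_eq_ofReal_abs, ← ofReal_norm, ← ENNReal.ofReal_mul (by positivity)]
    refine ENNReal.ofReal_le_ofReal ?_
    have hb : ∀ S : EuclideanSpace ℝ (Fin d), ‖S‖ ≤ M →
        inner ℝ h S - 1 / 2 * inner ℝ h (A h) ≤ M * ‖h‖ := by
      intro S hS
      have e1 := real_inner_le_norm h S
      have e2 := hr.inner_fisherInfo_self_nonneg h
      have e3 : ‖h‖ * ‖S‖ ≤ ‖h‖ * M := by gcongr
      change 0 ≤ inner ℝ h (A h) at e2
      linarith
    refine (abs_exp_sub_exp_le (hb _ hy.2) (hb _ hy.1)).trans ?_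
    have e1 : normSum (fun y => ℓ y - s n y) n y = normSum ℓ n y - normSum (s n) n y := by
      simp only [normSum, Finset.sum_sub_distrib, smul_sub]
    rw [e1, mul_assoc]
    gcongr
    rw [show inner ℝ h (normSum (s n) n y) - 1 / 2 * inner ℝ h (A h)
      - (inner ℝ h (normSum ℓ n y) - 1 / 2 * inner ℝ h (A h))
      = -inner ℝ h (normSum ℓ n y - normSum (s n) n y) by rw [inner_sub_right]; ring, abs_neg]
    exact abs_real_inner_le_norm _ _
  have hGm : MeasurableSet G :=
    (measurableSet_le (measurable_normSum hr.measurable_score n).norm measurable_const).inter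
      (measurableSet_le (measurable_normSum (hsm n) n).norm measurable_const)
  calc _ ≤ ∫⁻ y in G, (‖(likelihood p n y (θ₀ + (√(n : ℝ))⁻¹ • h) : ℝ)
        - likelihood p n y θ₀ * limitRatio A (normSum (s n) n y) h‖ₑ
        + (likelihood p n y θ₀ : ℝ≥0∞) * (ENNReal.ofReal (Real.exp (M * ‖h‖) * ‖h‖)
          * ‖normSum (fun y => ℓ y - s n y) n y‖ₑ)) ∂(Measure.pi fun _ : Fin n => μ) := by
        refine setLIntegral_mono' hGm fun y hy => ?_
        have e1 : (likelihood p n y (θ₀ + (√(n : ℝ))⁻¹ • h) : ℝ)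
            - likelihood p n y θ₀ * limitRatio A (normSum ℓ n y) h
            = ((likelihood p n y (θ₀ + (√(n : ℝ))⁻¹ • h) : ℝ)
            - likelihood p n y θ₀ * limitRatio A (normSum (s n) n y) h)
            + likelihood p n y θ₀ *
              (limitRatio A (normSum (s n) n y) h - limitRatio A (normSum ℓ n y) h) := by ring
        rw [e1]
        refine (enorm_add_le _ _).trans ?_
        gcongr
        rw [enorm_mul]
        gcongr
        · rw [Real.enorm_eq_ofReal (NNReal.coe_nonneg _), ENNReal.ofReal_coe_nnreal]
        · exact hdiff y hy
    _ ≤ ∫⁻ y, (‖(likelihood p n y (θ₀ + (√(n : ℝ))⁻¹ • h) : ℝ)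
        - likelihood p n y θ₀ * limitRatio A (normSum (s n) n y) h‖ₑ
        + (likelihood p n y θ₀ : ℝ≥0∞) * (ENNReal.ofReal (Real.exp (M * ‖h‖) * ‖h‖)
          * ‖normSum (fun y => ℓ y - s n y) n y‖ₑ)) ∂(Measure.pi fun _ : Fin n => μ) :=
        setLIntegral_le_lintegral _ _
    _ ≤ _ := by
        rw [lintegral_add_left hm1]
        gcongr
        have e2 : ∫⁻ y, (likelihood p n y θ₀ : ℝ≥0∞) * (ENNReal.ofReal (Real.exp (M * ‖h‖) * ‖h‖)
            * ‖normSum (fun y => ℓ y - s n y) n y‖ₑ) ∂(Measure.pi fun _ : Fin n => μ)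
            = ∫⁻ y, ENNReal.ofReal (Real.exp (M * ‖h‖) * ‖h‖)
            * ‖normSum (fun y => ℓ y - s n y) n y‖ₑ ∂(sampleLaw μ p n θ₀) := by
          rw [sampleLaw_eq_withDensity μ hp0, lintegral_withDensity_eq_lintegral_mul _
            (measurable_likelihood_left hp0 n).coe_nnreal_ennreal]
          · rfl
          · exact (measurable_normSum (hr.measurable_score.sub (hsm n)) n).enorm.const_mul _
        rw [e2, lintegral_const_mul _
          (by exact (measurable_normSum (hr.measurable_score.sub (hsm n)) n).enorm)]
        gcongr
        refine lintegral_enorm_normSum_le P (hr.measurable_score.sub (hsm n))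
          (hr.memLp_score.sub (hsL n)) ?_ n
        simp only [Pi.sub_apply]
        rw [integral_sub (hr.memLp_score.integrable (by norm_num))
          ((hsL n).integrable (by norm_num)), hr.integral_score,
          integral_truncScore hr.measurable_score (Real.sqrt_nonneg _), sub_zero]

end IsRegularAt

/-! ### Moderate deviations of the local parameter -/

/-- The pointwise bound behind `IsRegularAt.exists_drift`, with `r`, `a` the roots of the densities
at `θ₀` and `θ₀ + u`, `s` the score, `t` the truncated score and `R` the remainder. -/
theorem sub_le_sq_mul_inner {u s t : EuclideanSpace ℝ (Fin d)} {r a R L τ q : ℝ} (hτ : 0 < τ)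
    (hq : 0 < q) (hx : |inner ℝ u t| ≤ L * ‖u‖) (ha : a = r + (R + 1 / 2 * inner ℝ u s * r)) :
    r ^ 2 * (inner ℝ u t + (inner ℝ u s * inner ℝ u s
        - ‖u‖ ^ 2 * (τ / 2 * ‖s‖ ^ 2 + 1 / (2 * τ) * ‖s - t‖ ^ 2)))
      - L * ‖u‖ * (q * r ^ 2 + q⁻¹ * R ^ 2 + (a - r) ^ 2) ≤ a ^ 2 * inner ℝ u t := by
  have hin : |inner ℝ u (s - t) * inner ℝ u s| ≤ ‖u‖ ^ 2 * (‖s - t‖ * ‖s‖) := by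
    rw [abs_mul]
    calc _ ≤ (‖u‖ * ‖s - t‖) * (‖u‖ * ‖s‖) := by
          gcongr <;> exact abs_real_inner_le_norm _ _
      _ = _ := by ring
  have hag : ‖s - t‖ * ‖s‖ ≤ τ / 2 * ‖s‖ ^ 2 + 1 / (2 * τ) * ‖s - t‖ ^ 2 := by
    have f1 : τ / 2 * ‖s‖ ^ 2 + 1 / (2 * τ) * ‖s - t‖ ^ 2 - ‖s - t‖ * ‖s‖
      = 1 / (2 * τ) * (‖s - t‖ - τ * ‖s‖) ^ 2 := by field_simp; ring
    have f2 : 0 ≤ 1 / (2 * τ) * (‖s - t‖ - τ * ‖s‖) ^ 2 := by positivity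
    linarith
  have hgle := mul_le_mul_of_nonneg_left hag (sq_nonneg ‖u‖)
  have hin' := (abs_le.1 hin).2
  rw [inner_sub_right] at hin'
  have h2rR : |2 * r * R| ≤ q * r ^ 2 + q⁻¹ * R ^ 2 := by
    have f1 : q⁻¹ * R ^ 2 + q * r ^ 2 - 2 * r * R = q⁻¹ * (R - q * r) ^ 2 := by
      field_simp; ring
    have f2 : q⁻¹ * R ^ 2 + q * r ^ 2 + 2 * r * R = q⁻¹ * (R + q * r) ^ 2 := by
      field_simp; ring
    have f3 : 0 ≤ q⁻¹ * (R - q * r) ^ 2 := by positivity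
    have f4 : 0 ≤ q⁻¹ * (R + q * r) ^ 2 := by positivity
    exact abs_le.2 ⟨by linarith, by linarith⟩
  have hkey : |inner ℝ u t * (2 * r * R + (a - r) ^ 2)|
      ≤ L * ‖u‖ * (q * r ^ 2 + q⁻¹ * R ^ 2 + (a - r) ^ 2) := by
    rw [abs_mul]
    refine mul_le_mul hx ?_ (abs_nonneg _) ((abs_nonneg _).trans hx)
    exact (abs_add_le _ _).trans (add_le_add h2rR (abs_of_nonneg (sq_nonneg _)).le)
  have hexp : a ^ 2 = r ^ 2 + inner ℝ u s * r ^ 2 + (2 * r * R + (a - r) ^ 2) := by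
    rw [ha]; ring
  generalize inner ℝ u t = x at *
  generalize inner ℝ u s = z at *
  generalize ‖u‖ ^ 2 * (τ / 2 * ‖s‖ ^ 2 + 1 / (2 * τ) * ‖s - t‖ ^ 2) = G at *
  have h3 := (abs_le.1 hkey).1
  have h4 : r ^ 2 * (x + (z * z - G)) ≤ r ^ 2 * (x + x * z) :=
    mul_le_mul_of_nonneg_left (by linarith) (sq_nonneg r)
  have h5 : a ^ 2 * x = r ^ 2 * (x + x * z) + x * (2 * r * R + (a - r) ^ 2) := by
    rw [hexp]; ring
  linarith

namespace IsRegularAt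

variable {μ : Measure 𝒴} {p : EuclideanSpace ℝ (Fin d) → 𝒴 → ℝ≥0}
  {θ₀ : EuclideanSpace ℝ (Fin d)} {ℓ : 𝒴 → EuclideanSpace ℝ (Fin d)}

/-- The drift of the truncated score under `P_θ`: its mean in the direction `u = θ - θ₀` is at least
a multiple of `‖u‖²`, because the truncated score is still positively correlated with the score. -/
theorem exists_drift (hr : IsRegularAt μ p θ₀ ℓ) (hI : IsUnit (fisherInfo μ p θ₀ ℓ)) :
    ∃ K : ℝ, 0 ≤ K ∧ ∃ c : ℝ, 0 < c ∧ ∀ᶠ u in 𝓝 (0 : EuclideanSpace ℝ (Fin d)),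
      c * ‖u‖ ^ 2 ≤ ∫ y, (p (θ₀ + u) y : ℝ) * inner ℝ u (truncScore (obsLaw μ p θ₀) ℓ K y) ∂μ := by
  have hP := hr.isProbabilityMeasure
  have hp0 := hr.measurable_apply θ₀
  obtain ⟨c₀, hc₀, hcA⟩ := hr.exists_le_inner_fisherInfo hI
  obtain ⟨C, hC, hH⟩ := hr.hellinger_bound
  set P := obsLaw μ p θ₀ with hPdef
  set V := ∫ y, ‖ℓ y‖ ^ 2 ∂P with hVdef
  have hV : 0 ≤ V := integral_nonneg fun y => sq_nonneg _
  have hVi : Integrable (fun y => ‖ℓ y‖ ^ 2) P :=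
    (memLp_two_iff_integrable_sq_norm hr.measurable_score.aestronglyMeasurable).1 hr.memLp_score
  -- `τ`, the level `K` and `ν` below make each error term a small fraction of `c₀ ‖u‖²`, the lower
  -- bound for the Fisher information in the direction `u`
  set τ : ℝ := c₀ / (2 * (V + 1)) with hτdef
  have hτ : 0 < τ := by positivity
  have hτV : τ / 2 * V ≤ c₀ / 4 := by
    have e1 : τ * (V + 1) = c₀ / 2 := by rw [hτdef]; field_simp
    nlinarith
  have hlim := (tendsto_integral_sq_sub_truncScore (P := P) hr.measurable_score hr.memLp_score
    hr.integral_score).const_mul (1 / (2 * τ))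
  rw [mul_zero] at hlim
  obtain ⟨K, hK1, hK⟩ := ((hlim.eventually (ge_mem_nhds (show 0 < c₀ / 4 by positivity))).and
    (eventually_ge_atTop 0)).exists
  refine ⟨K, hK, c₀ / 4, by positivity, ?_⟩
  set t := truncScore P ℓ K with ht
  have htm : Measurable t := measurable_truncScore hr.measurable_score K
  have htL : MemLp t 2 P := memLp_truncScore hr.measurable_score hK
  have ht0 : ∫ y, t y ∂P = 0 := integral_truncScore hr.measurable_score hK
  have hdi : Integrable (fun y => ‖ℓ y - t y‖ ^ 2) P :=
    (memLp_two_iff_integrable_sq_norm (hr.measurable_score.sub htm).aestronglyMeasurable).1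
      (hr.memLp_score.sub htL)
  set L : ℝ := 2 * K + 1 with hLdef
  have hL : 0 < L := by positivity
  have htb : ∀ u y, |inner ℝ u (t y)| ≤ L * ‖u‖ := fun u y => by
    have h1 := norm_truncScore_le (P := P) (ℓ := ℓ) hK y
    have h2 : ‖u‖ * ‖t y‖ ≤ ‖u‖ * L := by gcongr; linarith
    linarith [abs_real_inner_le_norm u (t y)]
  set ν : ℝ := c₀ / (16 * L) with hνdef
  have hν : 0 < ν := by positivity
  have hsmall : ∀ᶠ u in 𝓝 (0 : EuclideanSpace ℝ (Fin d)), L * C * ‖u‖ ≤ c₀ / 8 := by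
    have h1 : Tendsto (fun u : EuclideanSpace ℝ (Fin d) => L * C * ‖u‖) (𝓝 0) (𝓝 (L * C * ‖(0 :
        EuclideanSpace ℝ (Fin d))‖)) := by
      refine Continuous.tendsto ?_ 0
      fun_prop
    rw [norm_zero, mul_zero] at h1
    exact h1.eventually (ge_mem_nhds (by positivity))
  filter_upwards [hr.dqmRem_bound (sq_pos_of_pos hν), hH, hr.integrable_and_integral_density_add,
    hsmall] with u hR hD ha hu
  by_cases hu0 : u = 0
  · simp [hu0]
  have hun : 0 < ‖u‖ := norm_pos_iff.2 hu0
  set g : 𝒴 → ℝ := fun y => inner ℝ u (t y) + (inner ℝ u (ℓ y) * inner ℝ u (ℓ y)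
      - ‖u‖ ^ 2 * (τ / 2 * ‖ℓ y‖ ^ 2 + 1 / (2 * τ) * ‖ℓ y - t y‖ ^ 2)) with hg
  have j1 : Integrable (fun y => inner ℝ u (t y)) P :=
    (htL.integrable (by norm_num)).const_inner u
  have j2 := hr.integrable_inner_mul_inner u u
  have j3 : Integrable (fun y => ‖u‖ ^ 2 * (τ / 2 * ‖ℓ y‖ ^ 2 + 1 / (2 * τ) * ‖ℓ y - t y‖ ^ 2)) P :=
    ((hVi.const_mul _).add (hdi.const_mul _)).const_mul _
  have hgi : Integrable g P := j1.add (j2.sub j3)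
  have hgint : c₀ / 2 * ‖u‖ ^ 2 ≤ ∫ y, g y ∂P := by
    simp only [hg]
    rw [integral_add j1 (by exact j2.sub j3), integral_sub j2 j3,
      integral_inner (htL.integrable (by norm_num)), ht0, inner_zero_right, integral_const_mul,
      integral_add (hVi.const_mul _) (hdi.const_mul _), integral_const_mul, integral_const_mul,
      ← hr.inner_fisherInfo, ← hVdef]
    have h1 := hcA u
    have h2 : τ / 2 * V + 1 / (2 * τ) * ∫ y, ‖ℓ y - t y‖ ^ 2 ∂P ≤ c₀ / 2 := by linarith
    have h3 := mul_le_mul_of_nonneg_left h2 (sq_nonneg ‖u‖)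
    linarith
  have i1 := (integrable_obsLaw_iff hp0).1 hgi
  have i2 : Integrable (fun y => L * ‖u‖ * (ν * ‖u‖ * (p θ₀ y : ℝ)
      + (ν * ‖u‖)⁻¹ * dqmRem p θ₀ ℓ u y ^ 2
      + (√(p (θ₀ + u) y : ℝ) - √(p θ₀ y : ℝ)) ^ 2)) μ :=
    (((hr.integrable_density.const_mul _).add (hR.1.const_mul _)).add hD.1).const_mul _
  have i3 : Integrable (fun y => (p (θ₀ + u) y : ℝ) * inner ℝ u (t y)) μ := by
    refine (ha.1.mul_const (L * ‖u‖)).mono'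
      ((hr.measurable_apply _).coe_nnreal_real.mul (measurable_const.inner htm)).aestronglyMeasurable
      (ae_of_all _ fun y => ?_)
    rw [norm_mul, Real.norm_of_nonneg (NNReal.coe_nonneg _)]
    gcongr
    exact htb u y
  have hpt : ∀ y, (p θ₀ y : ℝ) • g y - L * ‖u‖ * (ν * ‖u‖ * (p θ₀ y : ℝ)
      + (ν * ‖u‖)⁻¹ * dqmRem p θ₀ ℓ u y ^ 2
      + (√(p (θ₀ + u) y : ℝ) - √(p θ₀ y : ℝ)) ^ 2)
      ≤ (p (θ₀ + u) y : ℝ) * inner ℝ u (t y) := by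
    intro y
    have hx := htb u y
    have hRdef : √(p (θ₀ + u) y : ℝ) = √(p θ₀ y : ℝ)
        + (dqmRem p θ₀ ℓ u y + 1 / 2 * inner ℝ u (ℓ y) * √(p θ₀ y : ℝ)) := by rw [dqmRem]; ring
    have h := sub_le_sq_mul_inner hτ (show 0 < ν * ‖u‖ by positivity) hx hRdef
    rw [Real.sq_sqrt (NNReal.coe_nonneg _), Real.sq_sqrt (NNReal.coe_nonneg _)] at h
    exact h
  refine le_trans ?_ (integral_mono (i1.sub i2) i3 hpt)
  simp only [Pi.sub_apply]
  rw [integral_sub i1 i2, ← integral_obsLaw hp0, integral_const_mul,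
    integral_add (by exact (hr.integrable_density.const_mul _).add (hR.1.const_mul _)) hD.1,
    integral_add (hr.integrable_density.const_mul _) (hR.1.const_mul _), integral_const_mul,
    integral_const_mul, hr.integral_density, mul_one]
  have hR2 : (ν * ‖u‖)⁻¹ * ∫ y, dqmRem p θ₀ ℓ u y ^ 2 ∂μ ≤ ν * ‖u‖ := by
    calc _ ≤ (ν * ‖u‖)⁻¹ * (ν ^ 2 * ‖u‖ ^ 2) := by gcongr; exact hR.2
      _ = ν * ‖u‖ := by field_simp
  have hbd : L * ‖u‖ * (ν * ‖u‖ + (ν * ‖u‖)⁻¹ * ∫ y, dqmRem p θ₀ ℓ u y ^ 2 ∂μ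
      + ∫ y, (√(p (θ₀ + u) y : ℝ) - √(p θ₀ y : ℝ)) ^ 2 ∂μ)
      ≤ L * ‖u‖ * (ν * ‖u‖ + ν * ‖u‖ + C * ‖u‖ ^ 2) := by
    gcongr
    exact hD.2
  have hLν : L * ν = c₀ / 16 := by rw [hνdef]; field_simp
  have e1 : L * ‖u‖ * (ν * ‖u‖ + ν * ‖u‖ + C * ‖u‖ ^ 2)
    = 2 * (L * ν) * ‖u‖ ^ 2 + L * C * ‖u‖ * ‖u‖ ^ 2 := by ring
  have e2 : L * C * ‖u‖ * ‖u‖ ^ 2 ≤ c₀ / 8 * ‖u‖ ^ 2 := by gcongr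
  rw [hLν] at e1
  linarith

/-- The drift as a bound for an exponential moment under `P_θ`, uniformly in `θ = θ₀ + u` near `θ₀`. -/
theorem exists_mgf_bound (hr : IsRegularAt μ p θ₀ ℓ) (hI : IsUnit (fisherInfo μ p θ₀ ℓ)) :
    ∃ K : ℝ, 0 ≤ K ∧ ∃ b : ℝ, 0 < b ∧ ∃ c : ℝ, 0 < c ∧
      ∀ᶠ u in 𝓝 (0 : EuclideanSpace ℝ (Fin d)),
      ∫⁻ y, (p (θ₀ + u) y : ℝ≥0∞) *
        ENNReal.ofReal (Real.exp (-(b * inner ℝ u (truncScore (obsLaw μ p θ₀) ℓ K y)))) ∂μ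
        ≤ ENNReal.ofReal (Real.exp (-(c * ‖u‖ ^ 2))) := by
  have hP := hr.isProbabilityMeasure
  obtain ⟨K, hK, c, hc, hdrift⟩ := hr.exists_drift hI
  set P := obsLaw μ p θ₀ with hPdef
  set t := truncScore P ℓ K with ht
  have htm : Measurable t := measurable_truncScore hr.measurable_score K
  set L : ℝ := 2 * K + 1 with hLdef
  have hL : 0 < L := by positivity
  have htb : ∀ u y, |inner ℝ u (t y)| ≤ L * ‖u‖ := fun u y => by
    have h1 := norm_truncScore_le (P := P) (ℓ := ℓ) hK y
    have h2 : ‖u‖ * ‖t y‖ ≤ ‖u‖ * L := by gcongr; linarith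
    linarith [abs_real_inner_le_norm u (t y)]
  -- the choice of `b` makes the second-order term at most half of the drift
  set b : ℝ := c / (2 * L ^ 2) with hb
  have hb0 : 0 < b := by positivity
  refine ⟨K, hK, b, hb0, b * c / 2, by positivity, ?_⟩
  have hsmall : ∀ᶠ u in 𝓝 (0 : EuclideanSpace ℝ (Fin d)), b * (L * ‖u‖) ≤ 1 := by
    have h1 : Tendsto (fun u : EuclideanSpace ℝ (Fin d) => b * (L * ‖u‖)) (𝓝 0)
        (𝓝 (b * (L * ‖(0 : EuclideanSpace ℝ (Fin d))‖))) := by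
      refine Continuous.tendsto ?_ 0
      fun_prop
    rw [norm_zero, mul_zero, mul_zero] at h1
    exact h1.eventually (ge_mem_nhds one_pos)
  filter_upwards [hdrift, hsmall, hr.integrable_and_integral_density_add] with u hd hu ha
  have hpm := (hr.measurable_apply (θ₀ + u)).coe_nnreal_real
  have i3 : Integrable (fun y => (p (θ₀ + u) y : ℝ) * inner ℝ u (t y)) μ := by
    refine (ha.1.mul_const (L * ‖u‖)).mono'
      (hpm.mul (measurable_const.inner htm)).aestronglyMeasurable (ae_of_all _ fun y => ?_)
    rw [norm_mul, Real.norm_of_nonneg (NNReal.coe_nonneg _)]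
    gcongr
    exact htb u y
  have hpt : ∀ y, (p (θ₀ + u) y : ℝ) * Real.exp (-(b * inner ℝ u (t y)))
      ≤ (p (θ₀ + u) y : ℝ) * (1 + (b * (L * ‖u‖)) ^ 2)
        - b * ((p (θ₀ + u) y : ℝ) * inner ℝ u (t y)) := by
    intro y
    have hx : |-(b * inner ℝ u (t y))| ≤ b * (L * ‖u‖) := by
      rw [abs_neg, abs_mul, abs_of_pos hb0]
      gcongr
      exact htb u y
    have h1 := (abs_le.1 (Real.abs_exp_sub_one_sub_id_le (hx.trans hu))).2
    have h2 : (-(b * inner ℝ u (t y))) ^ 2 ≤ (b * (L * ‖u‖)) ^ 2 := sq_le_sq' (abs_le.1 hx).1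
      (abs_le.1 hx).2
    have h3 : Real.exp (-(b * inner ℝ u (t y)))
        ≤ 1 + (b * (L * ‖u‖)) ^ 2 - b * inner ℝ u (t y) := by linarith
    have h4 := mul_le_mul_of_nonneg_left h3 (NNReal.coe_nonneg (p (θ₀ + u) y))
    linarith
  have ib : Integrable (fun y => (p (θ₀ + u) y : ℝ) * (1 + (b * (L * ‖u‖)) ^ 2)
        - b * ((p (θ₀ + u) y : ℝ) * inner ℝ u (t y))) μ :=
    (ha.1.mul_const _).sub (i3.const_mul _)
  calc ∫⁻ y, (p (θ₀ + u) y : ℝ≥0∞) * ENNReal.ofReal (Real.exp (-(b * inner ℝ u (t y)))) ∂μ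
      ≤ ∫⁻ y, ENNReal.ofReal ((p (θ₀ + u) y : ℝ) * (1 + (b * (L * ‖u‖)) ^ 2)
        - b * ((p (θ₀ + u) y : ℝ) * inner ℝ u (t y))) ∂μ := by
        refine lintegral_mono fun y => ?_
        rw [← ENNReal.ofReal_coe_nnreal, ← ENNReal.ofReal_mul (NNReal.coe_nonneg _)]
        exact ENNReal.ofReal_le_ofReal (hpt y)
    _ = ENNReal.ofReal (∫ y, ((p (θ₀ + u) y : ℝ) * (1 + (b * (L * ‖u‖)) ^ 2)
        - b * ((p (θ₀ + u) y : ℝ) * inner ℝ u (t y))) ∂μ) := by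
        rw [ofReal_integral_eq_lintegral_ofReal ib (ae_of_all _ fun y => ?_)]
        exact le_trans (by positivity) (hpt y)
    _ ≤ _ := by
        refine ENNReal.ofReal_le_ofReal ?_
        rw [integral_sub (ha.1.mul_const _) (i3.const_mul _), integral_mul_const,
          integral_const_mul, ha.2, one_mul]
        have h1 := mul_le_mul_of_nonneg_left hd hb0.le
        have h2 : (b * (L * ‖u‖)) ^ 2 = b * c / 2 * ‖u‖ ^ 2 := by
          rw [hb]; field_simp
        have h3 := Real.add_one_le_exp (-(b * c / 2 * ‖u‖ ^ 2))
        linarith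

/-- On the event that the truncated score sum is at most `M`, the mean of the likelihood at
`θ₀ + h / √n` is bounded by a Gaussian-type function of `h`, for all `h` up to `ε √n`. -/
theorem exists_setLIntegral_likelihood_le [SigmaFinite μ] (hr : IsRegularAt μ p θ₀ ℓ)
    (hI : IsUnit (fisherInfo μ p θ₀ ℓ)) :
    ∃ K : ℝ, 0 ≤ K ∧ ∃ b : ℝ, 0 < b ∧ ∃ c : ℝ, 0 < c ∧ ∃ ε : ℝ, 0 < ε ∧
      ∀ (n : ℕ), 0 < n → ∀ (M : ℝ) (h : EuclideanSpace ℝ (Fin d)), ‖(√(n : ℝ))⁻¹ • h‖ ≤ ε →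
      ∫⁻ y in {y | ‖normSum (truncScore (obsLaw μ p θ₀) ℓ K) n y‖ ≤ M},
        (likelihood p n y (θ₀ + (√(n : ℝ))⁻¹ • h) : ℝ≥0∞) ∂(Measure.pi fun _ : Fin n => μ)
        ≤ ENNReal.ofReal (Real.exp (b * M * ‖h‖ - c * ‖h‖ ^ 2)) := by
  obtain ⟨K, hK, b, hb, c, hc, hev⟩ := hr.exists_mgf_bound hI
  obtain ⟨ε, hε, hball⟩ := Metric.eventually_nhds_iff.1 hev
  refine ⟨K, hK, b, hb, c, hc, ε / 2, by positivity, fun n hn M h hh => ?_⟩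
  have hn' : (0 : ℝ) < n := by exact_mod_cast hn
  set t := truncScore (obsLaw μ p θ₀) ℓ K with ht
  have htm : Measurable t := measurable_truncScore hr.measurable_score K
  set u := (√(n : ℝ))⁻¹ • h with hu
  have hmgf := hball (y := u) (by rw [dist_zero_right]; linarith)
  have hun : n * ‖u‖ ^ 2 = ‖h‖ ^ 2 := by
    rw [hu, norm_smul, mul_pow, norm_inv, inv_pow, Real.norm_eq_abs, sq_abs, Real.sq_sqrt hn'.le]
    field_simp
  have hfm : Measurable fun y => (p (θ₀ + u) y : ℝ≥0∞) *
      ENNReal.ofReal (Real.exp (-(b * inner ℝ u (t y)))) := by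
    have h1 : Measurable fun y => inner ℝ u (t y) := measurable_const.inner htm
    exact (hr.measurable_apply _).coe_nnreal_ennreal.mul
      (h1.const_mul b).neg.exp.ennreal_ofReal
  have hGm : MeasurableSet {y : Fin n → 𝒴 | ‖normSum t n y‖ ≤ M} :=
    measurableSet_le (measurable_normSum htm n).norm measurable_const
  calc _ ≤ ∫⁻ y in {y : Fin n → 𝒴 | ‖normSum t n y‖ ≤ M}, ENNReal.ofReal (Real.exp (b * M * ‖h‖)) *
        ∏ i, ((p (θ₀ + u) (y i) : ℝ≥0∞) *
          ENNReal.ofReal (Real.exp (-(b * inner ℝ u (t (y i)))))) ∂(Measure.pi fun _ => μ) := by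
        refine setLIntegral_mono' hGm fun y hy => ?_
        rw [Finset.prod_mul_distrib, ← ENNReal.ofReal_prod_of_nonneg fun i _ => (Real.exp_pos _).le,
          ← Real.exp_sum, mul_left_comm, ← ENNReal.ofReal_mul (Real.exp_pos _).le, ← Real.exp_add,
          likelihood, ENNReal.ofNNReal_finsetProd]
        refine le_mul_of_one_le_right' ?_
        rw [ENNReal.one_le_ofReal, Real.one_le_exp_iff, Finset.sum_neg_distrib, ← Finset.mul_sum,
          ← inner_sum]
        have e1 : inner ℝ u (∑ i, t (y i)) = inner ℝ h (normSum t n y) := by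
          rw [hu, normSum, real_inner_smul_left, real_inner_smul_right]
        have hy' : ‖normSum t n y‖ ≤ M := hy
        have e2 : inner ℝ h (normSum t n y) ≤ ‖h‖ * M :=
          (real_inner_le_norm _ _).trans (by gcongr)
        rw [e1]
        nlinarith
    _ ≤ ∫⁻ y : Fin n → 𝒴, ENNReal.ofReal (Real.exp (b * M * ‖h‖)) *
        ∏ i, ((p (θ₀ + u) (y i) : ℝ≥0∞) *
          ENNReal.ofReal (Real.exp (-(b * inner ℝ u (t (y i)))))) ∂(Measure.pi fun _ => μ) :=
        setLIntegral_le_lintegral _ _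
    _ ≤ ENNReal.ofReal (Real.exp (b * M * ‖h‖)) * ENNReal.ofReal (Real.exp (-(c * ‖u‖ ^ 2))) ^ n := by
        rw [lintegral_const_mul _ (by
          exact Finset.measurable_prod _ fun i _ => hfm.comp (measurable_pi_apply i)), lintegral_pi_prod μ _ fun _ => hfm, Finset.prod_const,
          Finset.card_univ, Fintype.card_fin]
        gcongr
    _ = _ := by
        rw [← ENNReal.ofReal_pow (Real.exp_pos _).le, ← Real.exp_nat_mul,
          ← ENNReal.ofReal_mul (Real.exp_pos _).le, ← Real.exp_add, ← hun]
        congr 2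
        ring

end IsRegularAt

/-! ### The fiducial density near the true parameter -/

theorem measurable_limitRatio {Z : Type*} [MeasurableSpace Z]
    (A : EuclideanSpace ℝ (Fin d) →L[ℝ] EuclideanSpace ℝ (Fin d))
    {f g : Z → EuclideanSpace ℝ (Fin d)} (hf : Measurable f) (hg : Measurable g) :
    Measurable fun z => limitRatio A (f z) (g z) :=
  ((hg.inner hf).sub ((hg.inner (A.continuous.measurable.comp hg)).const_mul (1 / 2))).exp

/-- The difference, at the local parameter `h`, between the product of the likelihood and the
limiting density `π`, cut off at `‖θ - θ₀‖ ≤ ε`, and its Gaussian approximation. -/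
noncomputable def localDiff (μ : Measure 𝒴) (p : EuclideanSpace ℝ (Fin d) → 𝒴 → ℝ≥0)
    (θ₀ : EuclideanSpace ℝ (Fin d)) (ℓ : 𝒴 → EuclideanSpace ℝ (Fin d))
    (π : EuclideanSpace ℝ (Fin d) → ℝ≥0) (ε : ℝ) (n : ℕ) (y : Fin n → 𝒴)
    (h : EuclideanSpace ℝ (Fin d)) : ℝ :=
  {h : EuclideanSpace ℝ (Fin d) | ‖(√(n : ℝ))⁻¹ • h‖ ≤ ε}.indicator
    (fun h => (likelihood p n y (θ₀ + (√(n : ℝ))⁻¹ • h) : ℝ) * π (θ₀ + (√(n : ℝ))⁻¹ • h)) h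
  - π θ₀ * (likelihood p n y θ₀ * limitRatio (Matrix.toEuclideanCLM (𝕜 := ℝ)
      (fisherInfo μ p θ₀ ℓ)) (normSum ℓ n y) h)

namespace IsRegularAt

variable {μ : Measure 𝒴} {p : EuclideanSpace ℝ (Fin d) → 𝒴 → ℝ≥0}
  {θ₀ : EuclideanSpace ℝ (Fin d)} {ℓ : 𝒴 → EuclideanSpace ℝ (Fin d)}

theorem measurable_localDiff (hr : IsRegularAt μ p θ₀ ℓ) {π : EuclideanSpace ℝ (Fin d) → ℝ≥0}
    (hπ : Measurable π) (ε : ℝ) (n : ℕ) :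
    Measurable (Function.uncurry (localDiff μ p θ₀ ℓ π ε n)) := by
  have hθ : Measurable fun h : EuclideanSpace ℝ (Fin d) => θ₀ + (√(n : ℝ))⁻¹ • h :=
    (measurable_id.const_smul (√(n : ℝ))⁻¹).const_add θ₀
  have h1 : Measurable fun z : (Fin n → 𝒴) × EuclideanSpace ℝ (Fin d) =>
      (likelihood p n z.1 (θ₀ + (√(n : ℝ))⁻¹ • z.2) : ℝ) * π (θ₀ + (√(n : ℝ))⁻¹ • z.2) :=
    ((measurable_likelihood hr.measurable n).comp
      (measurable_fst.prodMk (hθ.comp measurable_snd))).coe_nnreal_real.mul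
      (hπ.comp (hθ.comp measurable_snd)).coe_nnreal_real
  have h2 : Measurable fun z : (Fin n → 𝒴) × EuclideanSpace ℝ (Fin d) =>
      (likelihood p n z.1 θ₀ : ℝ) :=
    ((measurable_likelihood_left (hr.measurable_apply θ₀) n).comp measurable_fst).coe_nnreal_real
  have h3 : Measurable fun z : (Fin n → 𝒴) × EuclideanSpace ℝ (Fin d) =>
      limitRatio (Matrix.toEuclideanCLM (𝕜 := ℝ) (fisherInfo μ p θ₀ ℓ)) (normSum ℓ n z.1) z.2 :=
    measurable_limitRatio _ ((measurable_normSum hr.measurable_score n).comp measurable_fst)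
      measurable_snd
  have hS : MeasurableSet {z : (Fin n → 𝒴) × EuclideanSpace ℝ (Fin d) |
      ‖(√(n : ℝ))⁻¹ • z.2‖ ≤ ε} :=
    measurableSet_le (measurable_snd.const_smul (√(n : ℝ))⁻¹).norm measurable_const
  have h4 : Measurable fun z : (Fin n → 𝒴) × EuclideanSpace ℝ (Fin d) =>
      {z : (Fin n → 𝒴) × EuclideanSpace ℝ (Fin d) | ‖(√(n : ℝ))⁻¹ • z.2‖ ≤ ε}.indicator
        (fun z => (likelihood p n z.1 (θ₀ + (√(n : ℝ))⁻¹ • z.2) : ℝ) *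
          π (θ₀ + (√(n : ℝ))⁻¹ • z.2)) z
      - π θ₀ * (likelihood p n z.1 θ₀ * limitRatio (Matrix.toEuclideanCLM (𝕜 := ℝ)
        (fisherInfo μ p θ₀ ℓ)) (normSum ℓ n z.1) z.2) :=
    (h1.indicator hS).sub ((h2.mul h3).const_mul (π θ₀ : ℝ))
  exact h4

/-- The score sum and its two truncations, one at a fixed level and one at a level that grows with
`n`, are bounded with high probability. -/
theorem exists_measure_normSum_compl_le (hr : IsRegularAt μ p θ₀ ℓ) {K : ℝ} (hK : 0 ≤ K)
    {η : ℝ≥0∞} (hη : 0 < η) :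
    ∃ M : ℝ, 0 < M ∧ ∀ᶠ n : ℕ in atTop, sampleLaw μ p n θ₀
      {y | (‖normSum ℓ n y‖ ≤ M ∧ ‖normSum (truncScore (obsLaw μ p θ₀) ℓ √√(n : ℝ)) n y‖ ≤ M) ∧
        ‖normSum (truncScore (obsLaw μ p θ₀) ℓ K) n y‖ ≤ M}ᶜ ≤ η := by
  have hP := hr.isProbabilityMeasure
  set P := obsLaw μ p θ₀ with hPdef
  have hlim := (tendsto_integral_sq_sub_truncScore (P := P) hr.measurable_score hr.memLp_score
    hr.integral_score).comp tendsto_sqrt_sqrt_natCast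
  set V := ∫ y, ‖ℓ y‖ ^ 2 ∂P with hVdef
  set VK := ∫ y, ‖truncScore P ℓ K y‖ ^ 2 ∂P with hVKdef
  have hV0 : 0 ≤ V := integral_nonneg fun y => sq_nonneg _
  have hVK0 : 0 ≤ VK := integral_nonneg fun y => sq_nonneg _
  have hVi : Integrable (fun y => ‖ℓ y‖ ^ 2) P :=
    (memLp_two_iff_integrable_sq_norm hr.measurable_score.aestronglyMeasurable).1 hr.memLp_score
  have hVn : ∀ᶠ n : ℕ in atTop, ∫ y, ‖truncScore P ℓ √√(n : ℝ) y‖ ^ 2 ∂P ≤ 2 * V + 2 := by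
    filter_upwards [hlim.eventually (ge_mem_nhds one_pos)] with n hn
    have ht := memLp_truncScore (P := P) hr.measurable_score (Real.sqrt_nonneg √(n : ℝ))
    have hd : Integrable (fun y => ‖ℓ y - truncScore P ℓ √√(n : ℝ) y‖ ^ 2) P :=
      (memLp_two_iff_integrable_sq_norm (hr.measurable_score.sub
        (measurable_truncScore hr.measurable_score _)).aestronglyMeasurable).1
        (hr.memLp_score.sub ht)
    have ht2 := (memLp_two_iff_integrable_sq_norm
      (measurable_truncScore hr.measurable_score _).aestronglyMeasurable).1 ht
    calc _ ≤ ∫ y, (2 * ‖ℓ y‖ ^ 2 + 2 * ‖ℓ y - truncScore P ℓ √√(n : ℝ) y‖ ^ 2) ∂P := by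
          refine integral_mono ht2 ((hVi.const_mul _).add (hd.const_mul _)) fun y => ?_
          have h1 : ‖truncScore P ℓ √√(n : ℝ) y‖ ≤ ‖ℓ y‖ + ‖ℓ y - truncScore P ℓ √√(n : ℝ) y‖ := by
            simpa using norm_sub_le (ℓ y) (ℓ y - truncScore P ℓ √√(n : ℝ) y)
          have h2 := pow_le_pow_left₀ (norm_nonneg _) h1 2
          have h3 := sq_nonneg (‖ℓ y‖ - ‖ℓ y - truncScore P ℓ √√(n : ℝ) y‖)
          simp only
          linarith
      _ ≤ _ := by
          rw [integral_add (hVi.const_mul _) (hd.const_mul _), integral_const_mul,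
            integral_const_mul]
          have hn' : ∫ y, ‖ℓ y - truncScore P ℓ √√(n : ℝ) y‖ ^ 2 ∂P ≤ 1 := hn
          linarith
  have hMlim : Tendsto (fun M : ℝ => ENNReal.ofReal (V / M ^ 2) + ENNReal.ofReal
      ((2 * V + 2) / M ^ 2) + ENNReal.ofReal (VK / M ^ 2)) atTop (𝓝 0) := by
    have h1 : ∀ a : ℝ, Tendsto (fun M : ℝ => ENNReal.ofReal (a / M ^ 2)) atTop (𝓝 0) := fun a => by
      rw [← ENNReal.ofReal_zero]
      exact (ENNReal.continuous_ofReal.tendsto 0).comp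
        ((tendsto_pow_atTop two_ne_zero).const_div_atTop a)
    simpa using ((h1 V).add (h1 (2 * V + 2))).add (h1 VK)
  obtain ⟨M, hMη, hM⟩ := ((hMlim.eventually (ge_mem_nhds hη)).and (eventually_gt_atTop 0)).exists
  refine ⟨M, hM, ?_⟩
  filter_upwards [hVn] with n hn
  have b1 := measure_normSum_le P hr.memLp_score hr.integral_score n hM
  have b2 := measure_normSum_le P (memLp_truncScore (P := P) hr.measurable_score
    (Real.sqrt_nonneg √(n : ℝ)))
    (integral_truncScore hr.measurable_score (Real.sqrt_nonneg √(n : ℝ))) n hM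
  have b3 := measure_normSum_le P (memLp_truncScore (P := P) hr.measurable_score hK)
    (integral_truncScore hr.measurable_score hK) n hM
  refine le_trans (le_trans (measure_mono (t := ({y | M < ‖normSum ℓ n y‖} ∪
    {y | M < ‖normSum (truncScore P ℓ √√(n : ℝ)) n y‖}) ∪
    {y | M < ‖normSum (truncScore P ℓ K) n y‖}) fun y hy => ?_) (measure_union_le _ _)) ?_
  · simp only [Set.mem_compl_iff, Set.mem_ofPred_eq, Set.mem_union] at hy ⊢
    by_contra hc
    simp only [not_or, not_lt] at hc
    exact hy hc
  · refine le_trans (add_le_add ((measure_union_le _ _).trans (add_le_add b1 (b2.trans ?_))) b3) hMη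
    gcongr

/-- Near `θ₀` the likelihood times `π` is close to its Gaussian approximation, in the mean on the
event where the score sums are bounded. -/
theorem tendsto_setLIntegral_localDiff [SigmaFinite μ] (hr : IsRegularAt μ p θ₀ ℓ)
    (hI : IsUnit (fisherInfo μ p θ₀ ℓ)) {π : EuclideanSpace ℝ (Fin d) → ℝ≥0}
    (hπ : Measurable π) (hπc : ContinuousAt π θ₀) :
    ∃ K : ℝ, 0 ≤ K ∧ ∃ ε₀ : ℝ, 0 < ε₀ ∧ ∀ ε : ℝ, 0 < ε → ε ≤ ε₀ → ∀ M : ℝ,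
      Tendsto (fun n : ℕ => ∫⁻ y in {y | (‖normSum ℓ n y‖ ≤ M ∧
          ‖normSum (truncScore (obsLaw μ p θ₀) ℓ √√(n : ℝ)) n y‖ ≤ M) ∧
          ‖normSum (truncScore (obsLaw μ p θ₀) ℓ K) n y‖ ≤ M},
        (∫⁻ h, ‖localDiff μ p θ₀ ℓ π ε n y h‖ₑ) ∂(Measure.pi fun _ : Fin n => μ))
        atTop (𝓝 0) := by
  have hP := hr.isProbabilityMeasure
  obtain ⟨K, hK, b, hb, c, hc, ε₁, hε₁, hbd⟩ := hr.exists_setLIntegral_likelihood_le hI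
  obtain ⟨c₀, hc₀, hcA⟩ := hr.exists_le_inner_fisherInfo hI
  have hπev : ∀ᶠ θ in 𝓝 θ₀, π θ ≤ π θ₀ + 1 :=
    (hπc.eventually (gt_mem_nhds (lt_add_one (π θ₀)))).mono fun θ h => le_of_lt h
  obtain ⟨ε₂, hε₂, hball⟩ := Metric.eventually_nhds_iff.1 hπev
  refine ⟨K, hK, min ε₁ (ε₂ / 2), by positivity, fun ε hε hεle M => ?_⟩
  set A := Matrix.toEuclideanCLM (𝕜 := ℝ) (fisherInfo μ p θ₀ ℓ) with hA
  set P := obsLaw μ p θ₀ with hPdef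
  set G : ∀ n : ℕ, Set (Fin n → 𝒴) := fun n => {y | (‖normSum ℓ n y‖ ≤ M ∧
    ‖normSum (truncScore P ℓ √√(n : ℝ)) n y‖ ≤ M) ∧ ‖normSum (truncScore P ℓ K) n y‖ ≤ M} with hG
  have hnm : ∀ (f : 𝒴 → EuclideanSpace ℝ (Fin d)), Measurable f → ∀ n,
      MeasurableSet {y : Fin n → 𝒴 | ‖normSum f n y‖ ≤ M} := fun f hf n =>
    measurableSet_le (measurable_normSum hf n).norm measurable_const
  have hGm : ∀ n, MeasurableSet (G n) := fun n =>
    ((hnm _ hr.measurable_score n).inter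
      (hnm _ (measurable_truncScore hr.measurable_score _) n)).inter
      (hnm _ (measurable_truncScore hr.measurable_score _) n)
  have hDm := fun n => (hr.measurable_localDiff hπ ε n).enorm
  have hswap : ∀ n : ℕ, ∫⁻ y in G n, (∫⁻ h, ‖localDiff μ p θ₀ ℓ π ε n y h‖ₑ)
      ∂(Measure.pi fun _ : Fin n => μ)
      = ∫⁻ h, ∫⁻ y in G n, ‖localDiff μ p θ₀ ℓ π ε n y h‖ₑ ∂(Measure.pi fun _ : Fin n => μ) :=
    fun n => lintegral_lintegral_swap (hDm n).aemeasurable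
  refine Tendsto.congr (fun n => (hswap n).symm) ?_
  have hlik1 : ∀ n : ℕ, ∫⁻ y, (likelihood p n y θ₀ : ℝ≥0∞) ∂(Measure.pi fun _ : Fin n => μ) = 1 := by
    intro n
    simp only [likelihood, ENNReal.ofNNReal_finsetProd]
    rw [lintegral_pi_prod μ (fun _ y => (p θ₀ y : ℝ≥0∞))
      fun _ => (hr.measurable_apply θ₀).coe_nnreal_ennreal, hr.lintegral_self]
    simp
  set F : ℕ → EuclideanSpace ℝ (Fin d) → ℝ≥0∞ := fun n h =>
    ∫⁻ y in G n, ‖localDiff μ p θ₀ ℓ π ε n y h‖ₑ ∂(Measure.pi fun _ : Fin n => μ) with hF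
  set bound : EuclideanSpace ℝ (Fin d) → ℝ≥0∞ := fun h =>
    ((π θ₀ + 1 : ℝ≥0) : ℝ≥0∞) * ENNReal.ofReal (Real.exp (b * M * ‖h‖ - c * ‖h‖ ^ 2))
    + (π θ₀ : ℝ≥0∞) * ENNReal.ofReal (Real.exp (M * ‖h‖ - c₀ / 2 * ‖h‖ ^ 2)) with hbound
  have hexpm : ∀ a b : ℝ, Measurable fun h : EuclideanSpace ℝ (Fin d) =>
      ENNReal.ofReal (Real.exp (a * ‖h‖ - b * ‖h‖ ^ 2)) := fun a b => by
    refine Measurable.ennreal_ofReal (Continuous.measurable ?_)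
    fun_prop
  have hboundfin : ∫⁻ h, bound h ≠ ∞ := by
    simp only [hbound]
    rw [lintegral_add_left ((hexpm _ _).const_mul _), lintegral_const_mul _ (hexpm _ _),
      lintegral_const_mul _ (hexpm _ _)]
    exact ENNReal.add_ne_top.2 ⟨ENNReal.mul_ne_top ENNReal.coe_ne_top
      (lintegral_exp_norm_lt_top hc).ne, ENNReal.mul_ne_top ENNReal.coe_ne_top
      (lintegral_exp_norm_lt_top (by positivity)).ne⟩
  rw [← lintegral_zero (μ := (volume : Measure (EuclideanSpace ℝ (Fin d))))]
  refine tendsto_lintegral_filter_of_dominated_convergence bound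
    (Eventually.of_forall fun n => Measurable.lintegral_prod_left' (hDm n)) ?_ hboundfin
    (ae_of_all _ fun h => ?_)
  · filter_upwards [eventually_gt_atTop 0] with n hn
    refine ae_of_all _ fun h => ?_
    have hlm : Measurable fun y : Fin n → 𝒴 =>
        (likelihood p n y (θ₀ + (√(n : ℝ))⁻¹ • h) : ℝ≥0∞) :=
      (measurable_likelihood_left (hr.measurable_apply _) n).coe_nnreal_ennreal
    -- the two terms of the difference are bounded separately
    have hle : F n h ≤ ∫⁻ y in G n, ({h : EuclideanSpace ℝ (Fin d) | ‖(√(n : ℝ))⁻¹ • h‖ ≤ ε}.indicator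
        (fun _ => ((π θ₀ + 1 : ℝ≥0) : ℝ≥0∞)) h * likelihood p n y (θ₀ + (√(n : ℝ))⁻¹ • h)
        + (π θ₀ : ℝ≥0∞) * ENNReal.ofReal (Real.exp (M * ‖h‖ - c₀ / 2 * ‖h‖ ^ 2))
          * likelihood p n y θ₀) ∂(Measure.pi fun _ : Fin n => μ) := by
      refine setLIntegral_mono' (hGm n) fun y hy => ?_
      unfold localDiff
      refine enorm_sub_le.trans (add_le_add ?_ ?_)
      · by_cases hh : h ∈ {h : EuclideanSpace ℝ (Fin d) | ‖(√(n : ℝ))⁻¹ • h‖ ≤ ε}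
        · rw [Set.indicator_of_mem hh, Set.indicator_of_mem hh, enorm_mul, mul_comm,
            NNReal.enorm_eq, NNReal.enorm_eq]
          gcongr
          refine hball ?_
          rw [dist_eq_norm, add_sub_cancel_left]
          have hh' : ‖(√(n : ℝ))⁻¹ • h‖ ≤ ε := hh
          have := hεle.trans (min_le_right _ _)
          linarith
        · simp [Set.indicator_of_notMem hh]
      · rw [enorm_mul, enorm_mul, NNReal.enorm_eq, NNReal.enorm_eq, mul_assoc,
          mul_comm (likelihood p n y θ₀ : ℝ≥0∞), Real.enorm_of_nonneg (limitRatio_pos _ _ _).le]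
        gcongr
        exact limitRatio_le hcA hy.1.1 h
    refine hle.trans ?_
    rw [lintegral_add_left (hlm.const_mul _), lintegral_const_mul _ hlm, lintegral_const_mul _
      (measurable_likelihood_left (hr.measurable_apply θ₀) n).coe_nnreal_ennreal]
    refine add_le_add ?_ (mul_le_of_le_one_right' ((setLIntegral_le_lintegral _ _).trans
      (hlik1 n).le))
    by_cases hh : h ∈ {h : EuclideanSpace ℝ (Fin d) | ‖(√(n : ℝ))⁻¹ • h‖ ≤ ε}
    · rw [Set.indicator_of_mem hh]
      gcongr
      have hh' : ‖(√(n : ℝ))⁻¹ • h‖ ≤ ε := hh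
      refine (lintegral_mono_set fun y hy => ?_).trans
        (hbd n hn M h (hh'.trans (hεle.trans (min_le_left _ _))))
      exact hy.2
    · simp [Set.indicator_of_notMem hh]
  · have hθ : Tendsto (fun n : ℕ => θ₀ + (√(n : ℝ))⁻¹ • h) atTop (𝓝 θ₀) := by
      simpa using (tendsto_inv_sqrt_smul h).const_add θ₀
    have hπlim : Tendsto (fun n : ℕ => ‖(π (θ₀ + (√(n : ℝ))⁻¹ • h) : ℝ) - π θ₀‖ₑ) atTop (𝓝 0) := by
      have h1 : Tendsto (fun n : ℕ => (π (θ₀ + (√(n : ℝ))⁻¹ • h) : ℝ) - π θ₀) atTop (𝓝 0) := by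
        have h2 := (NNReal.tendsto_coe.2 (hπc.tendsto.comp hθ)).sub_const (π θ₀ : ℝ)
        simpa using h2
      have h3 := (continuous_enorm.tendsto (0 : ℝ)).comp h1
      rw [enorm_zero] at h3
      exact h3
    have hlim := hπlim.add (ENNReal.Tendsto.const_mul
      (hr.tendsto_setLIntegral_likelihood_sub h M) (Or.inr (ENNReal.coe_ne_top (r := π θ₀))))
    rw [mul_zero, add_zero] at hlim
    refine tendsto_of_tendsto_of_tendsto_of_le_of_le' tendsto_const_nhds hlim
      (Eventually.of_forall fun _ => zero_le) ?_
    have hsm : ∀ᶠ n : ℕ in atTop, ‖(√(n : ℝ))⁻¹ • h‖ ≤ ε := by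
      have h1 := (tendsto_inv_sqrt_smul h).norm
      rw [norm_zero] at h1
      exact h1.eventually (ge_mem_nhds hε)
    filter_upwards [hsm, (tendsto_inv_sqrt_smul h).eventually hr.lintegral_eq_one] with n hn hn1
    have hlm : Measurable fun y : Fin n → 𝒴 =>
        (likelihood p n y (θ₀ + (√(n : ℝ))⁻¹ • h) : ℝ≥0∞) :=
      (measurable_likelihood_left (hr.measurable_apply _) n).coe_nnreal_ennreal
    have hlikn : ∫⁻ y, (likelihood p n y (θ₀ + (√(n : ℝ))⁻¹ • h) : ℝ≥0∞)
        ∂(Measure.pi fun _ : Fin n => μ) = 1 := by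
      simp only [likelihood, ENNReal.ofNNReal_finsetProd]
      rw [lintegral_pi_prod μ (fun _ y => (p (θ₀ + (√(n : ℝ))⁻¹ • h) y : ℝ≥0∞))
        fun _ => (hr.measurable_apply _).coe_nnreal_ennreal, hn1]
      simp
    calc F n h ≤ ∫⁻ y in G n, (‖(π (θ₀ + (√(n : ℝ))⁻¹ • h) : ℝ) - π θ₀‖ₑ
          * likelihood p n y (θ₀ + (√(n : ℝ))⁻¹ • h) + (π θ₀ : ℝ≥0∞) *
          ‖(likelihood p n y (θ₀ + (√(n : ℝ))⁻¹ • h) : ℝ) - likelihood p n y θ₀ *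
            limitRatio A (normSum ℓ n y) h‖ₑ) ∂(Measure.pi fun _ : Fin n => μ) := by
          refine lintegral_mono fun y => ?_
          have e1 : localDiff μ p θ₀ ℓ π ε n y h = ((π (θ₀ + (√(n : ℝ))⁻¹ • h) : ℝ) - π θ₀)
              * (likelihood p n y (θ₀ + (√(n : ℝ))⁻¹ • h) : ℝ) + (π θ₀ : ℝ) *
              ((likelihood p n y (θ₀ + (√(n : ℝ))⁻¹ • h) : ℝ) - likelihood p n y θ₀ *
                limitRatio A (normSum ℓ n y) h) := by
            rw [localDiff, Set.indicator_of_mem (by exact hn)]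
            ring
          simp only
          rw [e1]
          refine (enorm_add_le _ _).trans ?_
          rw [enorm_mul, enorm_mul, NNReal.enorm_eq, NNReal.enorm_eq]
      _ ≤ _ := by
          rw [lintegral_add_left (hlm.const_mul _), lintegral_const_mul _ hlm,
            lintegral_const_mul' _ _ ENNReal.coe_ne_top]
          refine add_le_add (mul_le_of_le_one_right' ((setLIntegral_le_lintegral _ _).trans
            hlikn.le)) ?_
          gcongr
          exact fun y hy => hy.1

/-- In the local parameter, the likelihood times `π` near `θ₀` is close to its Gaussian
approximation, in `L¹` and relative to the likelihood at `θ₀`. -/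
theorem tendsto_localDiff [SigmaFinite μ] (hr : IsRegularAt μ p θ₀ ℓ)
    (hI : IsUnit (fisherInfo μ p θ₀ ℓ)) {π : EuclideanSpace ℝ (Fin d) → ℝ≥0}
    (hπ : Measurable π) (hπc : ContinuousAt π θ₀) :
    ∃ ε₀ : ℝ, 0 < ε₀ ∧ ∀ ε : ℝ, 0 < ε → ε ≤ ε₀ →
      TendstoZeroInProb (fun n => sampleLaw μ p n θ₀) fun n y =>
        (∫⁻ h, ‖localDiff μ p θ₀ ℓ π ε n y h‖ₑ) / likelihood p n y θ₀ := by
  obtain ⟨K, hK, ε₀, hε₀, hlim⟩ := hr.tendsto_setLIntegral_localDiff hI hπ hπc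
  refine ⟨ε₀, hε₀, fun ε hε hεle => TendstoZeroInProb.of_le fun η hη τ _ _ => ?_⟩
  obtain ⟨M, hM, hMη⟩ := hr.exists_measure_normSum_compl_le hK hη
  set G : ∀ n : ℕ, Set (Fin n → 𝒴) := fun n => {y | (‖normSum ℓ n y‖ ≤ M ∧
    ‖normSum (truncScore (obsLaw μ p θ₀) ℓ √√(n : ℝ)) n y‖ ≤ M) ∧
    ‖normSum (truncScore (obsLaw μ p θ₀) ℓ K) n y‖ ≤ M} with hG
  have hnm : ∀ (f : 𝒴 → EuclideanSpace ℝ (Fin d)), Measurable f → ∀ n,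
      MeasurableSet {y : Fin n → 𝒴 | ‖normSum f n y‖ ≤ M} := fun f hf n =>
    measurableSet_le (measurable_normSum hf n).norm measurable_const
  have hGm : ∀ n, MeasurableSet (G n) := fun n =>
    ((hnm _ hr.measurable_score n).inter
      (hnm _ (measurable_truncScore hr.measurable_score _) n)).inter
      (hnm _ (measurable_truncScore hr.measurable_score _) n)
  have hXm : ∀ n, Measurable fun y : Fin n → 𝒴 => ∫⁻ h, ‖localDiff μ p θ₀ ℓ π ε n y h‖ₑ :=
    fun n => Measurable.lintegral_prod_right' (hr.measurable_localDiff hπ ε n).enorm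
  refine ⟨G, fun n y => (G n).indicator (fun y => ∫⁻ h, ‖localDiff μ p θ₀ ℓ π ε n y h‖ₑ) y /
    likelihood p n y θ₀, hMη, TendstoZeroInProb.of_lintegral (Eventually.of_forall fun n => ?_) ?_,
    Eventually.of_forall fun n y hy => ?_⟩
  · exact (((hXm n).indicator (hGm n)).div (measurable_likelihood_left
      (hr.measurable_apply θ₀) n).coe_nnreal_ennreal).aemeasurable
  · refine tendsto_of_tendsto_of_tendsto_of_le_of_le tendsto_const_nhds (hlim ε hε hεle M)
      (fun _ => zero_le) fun n => ?_
    refine (lintegral_sampleLaw_div_le μ (hr.measurable_apply θ₀) n _).trans ?_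
    rw [lintegral_indicator (hGm n)]
  · simp only [Set.indicator_of_mem hy]
    exact le_self_add

end IsRegularAt

/-! ### The fiducial mass away from the true parameter -/

theorem TendstoZeroInProb.of_shift {Ω : ℕ → Type*} [∀ n, MeasurableSpace (Ω n)]
    {P : ∀ n, Measure (Ω n)} {X : ∀ n, Ω n → ℝ≥0∞}
    (h : ∀ η : ℝ≥0∞, 0 < η → ∃ n₀ : ℕ, ∀ ε : ℝ≥0∞, 0 < ε →
      ∀ᶠ m in atTop, P (n₀ + m) {ω | ε ≤ X (n₀ + m) ω} ≤ η) :
    TendstoZeroInProb P X := by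
  intro ε hε
  rw [ENNReal.tendsto_atTop_zero]
  intro η hη
  obtain ⟨n₀, hn₀⟩ := h η hη
  obtain ⟨N, hN⟩ := eventually_atTop.1 (hn₀ ε hε)
  refine ⟨n₀ + N, fun n hn => ?_⟩
  obtain ⟨m, rfl⟩ := Nat.exists_eq_add_of_le (le_of_add_le_left hn)
  exact hN m (by omega)

theorem abs_sub_le_of_div_le {a b : ℝ≥0} {τ : ℝ} (hτ : 0 ≤ τ)
    (h : ENNReal.ofReal |(a : ℝ) - b| / (a : ℝ≥0∞) ≤ ENNReal.ofReal τ) :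
    |(a : ℝ) - b| ≤ τ * a := by
  rw [ENNReal.div_le_iff_le_mul (Or.inr ENNReal.ofReal_ne_top) (Or.inl ENNReal.coe_ne_top),
    ← ENNReal.ofReal_coe_nnreal, ← ENNReal.ofReal_mul hτ] at h
  exact (ENNReal.ofReal_le_ofReal_iff (by positivity)).1 h

/-- The polynomial factor from the change to the local parameter is beaten by the exponential rate
of the tests, also when `n₀` observations are set aside. -/
theorem tendsto_sqrt_pow_mul_exp (d n₀ : ℕ) {a : ℝ} (ha : 0 < a) :
    Tendsto (fun m : ℕ => ENNReal.ofReal (√((n₀ + m : ℕ) : ℝ) ^ d) *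
      ENNReal.ofReal (Real.exp (-(a * m)))) atTop (𝓝 0) := by
  have h1 : Tendsto (fun x : ℝ => x ^ (d : ℝ) * Real.exp (-a * x)) atTop (𝓝 0) :=
    tendsto_rpow_mul_exp_neg_mul_atTop_nhds_zero _ _ ha
  have h2 : Tendsto (fun n : ℕ => √(n : ℝ) ^ d * Real.exp (-(a * n))) atTop (𝓝 0) := by
    refine squeeze_zero' (Eventually.of_forall fun n => by positivity) ?_
      (h1.comp tendsto_natCast_atTop_atTop)
    filter_upwards [eventually_ge_atTop 1] with n hn
    have hn' : (1 : ℝ) ≤ n := by exact_mod_cast hn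
    simp only [Function.comp_apply, Real.rpow_natCast, neg_mul]
    gcongr
    exact Real.sqrt_le_left (by positivity) |>.2 (by nlinarith)
  have h3 : Tendsto (fun m : ℕ => √((n₀ + m : ℕ) : ℝ) ^ d * Real.exp (-(a * m))) atTop (𝓝 0) := by
    have h4 := ((tendsto_add_atTop_iff_nat n₀).2 h2).const_mul (Real.exp (a * n₀))
    rw [mul_zero] at h4
    refine h4.congr fun m => ?_
    rw [add_comm m n₀, mul_left_comm, ← Real.exp_add]
    congr 2
    push_cast
    ring
  have h5 := (ENNReal.continuous_ofReal.tendsto 0).comp h3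
  rw [ENNReal.ofReal_zero] at h5
  refine h5.congr fun m => ?_
  rw [Function.comp_apply, ENNReal.ofReal_mul (by positivity)]

/-- Bounds for the integrals of `g · θ` against a weight, for each `θ`, bound the expectation
of the weighted likelihood ratio integral. -/
theorem lintegral_weight_mul_div_le (μ : Measure 𝒴) [SigmaFinite μ]
    {p : EuclideanSpace ℝ (Fin d) → 𝒴 → ℝ≥0} {θ₀ : EuclideanSpace ℝ (Fin d)}
    (hp : Measurable (p θ₀)) (n : ℕ) {S : Set (EuclideanSpace ℝ (Fin d))}
    {φ : (Fin n → 𝒴) → ℝ≥0∞} (hφ : Measurable φ)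
    {g : (Fin n → 𝒴) → EuclideanSpace ℝ (Fin d) → ℝ≥0∞} (hg : Measurable (Function.uncurry g))
    {w : EuclideanSpace ℝ (Fin d) → ℝ≥0∞} (hw : Measurable w) {b : ℝ≥0∞}
    (hb : ∀ θ ∈ S, ∫⁻ y, φ y * g y θ ∂(Measure.pi fun _ : Fin n => μ) ≤ b * w θ) :
    ∫⁻ y, φ y * ((∫⁻ θ in S, g y θ) / likelihood p n y θ₀) ∂(sampleLaw μ p n θ₀)
      ≤ b * ∫⁻ θ in S, w θ := by
  calc _ = ∫⁻ y, (φ y * ∫⁻ θ in S, g y θ) / likelihood p n y θ₀ ∂(sampleLaw μ p n θ₀) := by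
        simp_rw [mul_div_assoc]
    _ ≤ ∫⁻ y, (φ y * ∫⁻ θ in S, g y θ) ∂(Measure.pi fun _ : Fin n => μ) :=
        lintegral_sampleLaw_div_le μ hp n _
    _ = ∫⁻ y, (∫⁻ θ in S, φ y * g y θ) ∂(Measure.pi fun _ : Fin n => μ) := by
        refine lintegral_congr fun y => ?_
        rw [lintegral_const_mul _ (by exact hg.comp measurable_prodMk_left)]
    _ = ∫⁻ θ in S, ∫⁻ y, φ y * g y θ ∂(Measure.pi fun _ : Fin n => μ) := by
        refine lintegral_lintegral_swap ?_
        exact ((hφ.comp measurable_fst).mul hg).aemeasurable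
    _ ≤ ∫⁻ θ in S, b * w θ := setLIntegral_mono (hw.const_mul b) hb
    _ = _ := lintegral_const_mul _ hw

/-- Where the test does not reject, its complement is at least one half. -/
theorem one_le_two_mul_ofReal_one_sub {x : ℝ} (hx : ¬ (1 / 2 : ℝ≥0∞) ≤ ENNReal.ofReal x) :
    1 ≤ 2 * ENNReal.ofReal (1 - x) := by
  have h1 : x < 1 / 2 := by
    by_contra hc
    refine hx ?_
    have h2 : (1 / 2 : ℝ≥0∞) = ENNReal.ofReal (1 / 2) := by
      rw [ENNReal.ofReal_div_of_pos two_pos]; simp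
    rw [h2]
    exact ENNReal.ofReal_le_ofReal (not_lt.1 hc)
  have h3 : (2 : ℝ≥0∞) = ENNReal.ofReal 2 := by simp
  rw [h3, ← ENNReal.ofReal_mul two_pos.le, ENNReal.one_le_ofReal]
  linarith

section Far

variable {μ : Measure 𝒴} [SigmaFinite μ] {Θ : Set (EuclideanSpace ℝ (Fin d))}
  {θ₀ : EuclideanSpace ℝ (Fin d)} {p : EuclideanSpace ℝ (Fin d) → 𝒴 → ℝ≥0}
  {J : ∀ n : ℕ, (Fin n → 𝒴) → EuclideanSpace ℝ (Fin d) → ℝ≥0}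
  {p₁ p₂ : ∀ n : ℕ, (Fin n → 𝒴) → EuclideanSpace ℝ (Fin d) → ℝ≥0}
  {D : ℝ} {γ π : EuclideanSpace ℝ (Fin d) → ℝ≥0}

theorem measurableSet_lt_norm_sub (a : ℝ) :
    MeasurableSet {θ : EuclideanSpace ℝ (Fin d) | a < ‖θ - θ₀‖} :=
  measurableSet_lt measurable_const (measurable_id.sub_const θ₀).norm

/-- Off the ball of radius `D` the fiducial mass is negligible: there it is dominated by the
integral of `p₁` against `γ`, which the tests make exponentially small. -/
theorem tendsto_fiducial_outside (hΘ : MeasurableSet Θ) (hp : Measurable (Function.uncurry p))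
    (hJ : ∀ n, Measurable (Function.uncurry (J n))) (hD : 0 < D)
    (hsplit : LikelihoodSplits μ Θ p J θ₀ D p₁ p₂ γ)
    (htests : ExpConsistentTests μ Θ p θ₀ p₁) :
    TendstoZeroInProb (fun n => sampleLaw μ p n θ₀) fun n y =>
      ENNReal.ofReal (√(n : ℝ) ^ d) * ((∫⁻ θ in Θ ∩ {θ | D < ‖θ - θ₀‖},
        (likelihood p n y θ : ℝ≥0∞) * (J n y θ : ℝ≥0∞)) / likelihood p n y θ₀) := by
  have hp0 : Measurable (p θ₀) := hp.comp measurable_prodMk_left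
  obtain ⟨δ, c, hc, hδm, hδ01, hδ0, hδ⟩ := htests D hD
  have hS : MeasurableSet (Θ ∩ {θ | D < ‖θ - θ₀‖}) := hΘ.inter (measurableSet_lt_norm_sub D)
  set S := Θ ∩ {θ | D < ‖θ - θ₀‖} with hSdef
  set g : ∀ n : ℕ, (Fin n → 𝒴) → EuclideanSpace ℝ (Fin d) → ℝ≥0∞ := fun n y θ =>
    {z : (Fin n → 𝒴) × EuclideanSpace ℝ (Fin d) | p₂ n z.1 z.2 * J n z.1 z.2 ≤ γ z.2}.indicator
      (fun z => (likelihood p n z.1 z.2 : ℝ≥0∞) * (J n z.1 z.2 : ℝ≥0∞)) (y, θ) with hg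
  have hgm : ∀ n, Measurable (Function.uncurry (g n)) := fun n =>
    (Measurable.mul (measurable_likelihood hp n).coe_nnreal_ennreal
      (hJ n).coe_nnreal_ennreal).indicator
      (measurableSet_le ((hsplit.measurable_snd n).mul (hJ n))
        (hsplit.measurable_dom.comp measurable_snd))
  set a : ℝ := c * min (D ^ 2) 1 with ha
  have ha0 : 0 < a := mul_pos hc (lt_min (by positivity) one_pos)
  have hbound : ∀ (n : ℕ), ∀ θ ∈ S, ∫⁻ y, ENNReal.ofReal (1 - δ n y) * g n y θ
      ∂(Measure.pi fun _ : Fin n => μ) ≤ ENNReal.ofReal (Real.exp (-(a * n))) * (γ θ : ℝ≥0∞) := by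
    intro n θ hθ
    have hθD : D ≤ ‖θ - θ₀‖ := le_of_lt hθ.2
    calc _ ≤ ∫⁻ y, (ENNReal.ofReal (1 - δ n y) * (p₁ n y θ : ℝ≥0∞)) * (γ θ : ℝ≥0∞)
          ∂(Measure.pi fun _ : Fin n => μ) := by
          refine lintegral_mono_ae ?_
          filter_upwards [hsplit.split n θ hθ.1] with y hy
          rw [mul_assoc]
          gcongr
          simp only [hg]
          by_cases hm : (y, θ) ∈ {z : (Fin n → 𝒴) × EuclideanSpace ℝ (Fin d) |
              p₂ n z.1 z.2 * J n z.1 z.2 ≤ γ z.2}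
          · rw [Set.indicator_of_mem hm, hy, ENNReal.coe_mul, mul_assoc]
            gcongr
            exact_mod_cast hm
          · rw [Set.indicator_of_notMem hm]
            exact zero_le
      _ = (∫⁻ y, ENNReal.ofReal (1 - δ n y) * (p₁ n y θ : ℝ≥0∞) ∂(Measure.pi fun _ : Fin n => μ))
          * γ θ := lintegral_mul_const' _ _ ENNReal.coe_ne_top
      _ ≤ _ := by
          gcongr
          refine (hδ n θ hθ.1 hθD).2.trans (ENNReal.ofReal_le_ofReal (Real.exp_le_exp.2 ?_))
          rw [ha, neg_le_neg_iff, mul_assoc, mul_assoc, mul_comm (n : ℝ)]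
          gcongr
  have hδ0' : TendstoZeroInProb (fun n => sampleLaw μ p n θ₀) fun n y => ENNReal.ofReal (δ n y) :=
    TendstoZeroInProb.of_lintegral
      (Eventually.of_forall fun n => (hδm n).ennreal_ofReal.aemeasurable) hδ0
  have hhalf := hδ0' (1 / 2) (by simp)
  refine TendstoZeroInProb.of_le fun η hη τ _ _ => ⟨fun n =>
    {y | (∀ θ ∈ Θ, D < ‖θ - θ₀‖ → p₂ n y θ * J n y θ ≤ γ θ) ∧
      ¬ (1 / 2 : ℝ≥0∞) ≤ ENNReal.ofReal (δ n y)},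
    fun n y => 2 * (ENNReal.ofReal (√(n : ℝ) ^ d) * (ENNReal.ofReal (1 - δ n y) *
      ((∫⁻ θ in S, g n y θ) / likelihood p n y θ₀))), ?_, ?_, Eventually.of_forall fun n y hy => ?_⟩
  · have hsum := hsplit.dominated.add hhalf
    rw [add_zero] at hsum
    filter_upwards [hsum.eventually (ge_mem_nhds hη)] with n hn
    refine le_trans ((measure_mono fun y hy => ?_).trans (measure_union_le _ _)) hn
    by_contra hc
    simp only [Set.mem_union, not_or] at hc
    exact hy ⟨not_not.1 hc.1, hc.2⟩
  · refine TendstoZeroInProb.const_mul ?_ ENNReal.ofNat_ne_top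
    refine TendstoZeroInProb.of_lintegral (Eventually.of_forall fun n => ?_) ?_
    · exact (((hδm n).const_sub 1).ennreal_ofReal.mul
        ((Measurable.lintegral_prod_right' (hgm n)).div
          (measurable_likelihood_left hp0 n).coe_nnreal_ennreal)).const_mul _ |>.aemeasurable
    · have hlim := ENNReal.Tendsto.mul_const (tendsto_sqrt_pow_mul_exp d 0 ha0)
        (Or.inr hsplit.finite_dom.ne)
      rw [zero_mul] at hlim
      refine tendsto_of_tendsto_of_tendsto_of_le_of_le tendsto_const_nhds hlim
        (fun _ => zero_le) fun n => ?_
      simp only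
      rw [lintegral_const_mul' _ _ ENNReal.ofReal_ne_top, zero_add, mul_assoc]
      gcongr
      refine (lintegral_weight_mul_div_le μ hp0 n ((hδm n).const_sub 1).ennreal_ofReal
        (hgm n) hsplit.measurable_dom.coe_nnreal_ennreal (hbound n)).trans ?_
      gcongr
      exact Set.inter_subset_left
  · refine le_trans ?_ le_self_add
    have hle : ∫⁻ θ in S, (likelihood p n y θ : ℝ≥0∞) * (J n y θ : ℝ≥0∞) ≤ ∫⁻ θ in S, g n y θ := by
      refine setLIntegral_mono' hS fun θ hθ => ?_
      simp only [hg]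
      rw [Set.indicator_of_mem (by exact hy.1 θ hθ.1 hθ.2)]
    have h1 := one_le_two_mul_ofReal_one_sub hy.2
    calc _ ≤ ENNReal.ofReal (√(n : ℝ) ^ d) * (1 * ((∫⁻ θ in S, g n y θ) / likelihood p n y θ₀)) := by
          rw [one_mul]; gcongr
      _ ≤ ENNReal.ofReal (√(n : ℝ) ^ d) * ((2 * ENNReal.ofReal (1 - δ n y)) *
          ((∫⁻ θ in S, g n y θ) / likelihood p n y θ₀)) := by gcongr
      _ = _ := by ring

theorem likelihood_add {Z : Type*} (p : EuclideanSpace ℝ (Fin d) → Z → ℝ≥0) (n m : ℕ)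
    (y : Fin (n + m) → Z) (θ : EuclideanSpace ℝ (Fin d)) :
    likelihood p (n + m) y θ = likelihood p n (fun i => y (Fin.castAdd m i)) θ *
      likelihood p m (fun i => y (Fin.natAdd n i)) θ := by
  simp only [likelihood, Fin.prod_univ_add]

theorem exists_measure_le_compl_le {Ω : Type*} [MeasurableSpace Ω] {P : Measure Ω}
    [IsFiniteMeasure P] {X : Ω → ℝ≥0∞} (hX : Measurable X) {η : ℝ≥0∞} (h : P {ω | X ω = ∞} < η) :
    ∃ R : ℕ, P {ω | X ω ≤ R}ᶜ ≤ η := by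
  have hset : ⋂ R : ℕ, {ω | X ω ≤ R}ᶜ ⊆ {ω | X ω = ∞} := by
    intro ω hω
    by_contra hc
    obtain ⟨R, hR⟩ := ENNReal.exists_nat_gt hc
    exact Set.mem_iInter.1 hω R hR.le
  have htend := tendsto_measure_iInter_atTop (μ := P) (s := fun R : ℕ => {ω | X ω ≤ R}ᶜ)
    (fun R => (measurableSet_le hX measurable_const).compl.nullMeasurableSet)
    (fun R R' hRR' => Set.compl_subset_compl.2 fun ω hω =>
      le_trans (show X ω ≤ R from hω) (by gcongr))
    ⟨0, measure_ne_top _ _⟩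
  obtain ⟨R, hR⟩ := (htend.eventually (gt_mem_nhds ((measure_mono hset).trans_lt h))).exists
  exact ⟨R, hR.le⟩

theorem lintegral_weight_mul_likelihood_le {S : Set (EuclideanSpace ℝ (Fin d))}
    (hp : Measurable (Function.uncurry p)) (m : ℕ) {φ : (Fin m → 𝒴) → ℝ≥0∞} (hφ : Measurable φ)
    {b : ℝ≥0∞} (hb : ∀ θ ∈ S, ∫⁻ y, φ y ∂(sampleLaw μ p m θ) ≤ b)
    {w : EuclideanSpace ℝ (Fin d) → ℝ≥0∞} (hw : Measurable w) :
    ∫⁻ y, φ y * ((∫⁻ θ in S, w θ * likelihood p m y θ) / likelihood p m y θ₀)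
      ∂(sampleLaw μ p m θ₀) ≤ b * ∫⁻ θ in S, w θ := by
  have hpm : ∀ θ, Measurable (p θ) := fun θ => hp.comp measurable_prodMk_left
  have hlm : ∀ θ, Measurable fun y : Fin m → 𝒴 => (likelihood p m y θ : ℝ≥0∞) := fun θ =>
    (measurable_likelihood_left (hpm θ) m).coe_nnreal_ennreal
  refine lintegral_weight_mul_div_le μ (hpm θ₀) m hφ
    (g := fun y θ => w θ * likelihood p m y θ) ((hw.comp measurable_snd).mul
    (measurable_likelihood hp m).coe_nnreal_ennreal) hw fun θ hθ => ?_
  have h1 := hb θ hθ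
  rw [sampleLaw_eq_withDensity μ (hpm θ), lintegral_withDensity_eq_lintegral_mul _ (hlm θ) hφ] at h1
  calc _ = ∫⁻ y, w θ * ((likelihood p m y θ : ℝ≥0∞) * φ y) ∂(Measure.pi fun _ : Fin m => μ) :=
        lintegral_congr fun y => by ring
    _ = w θ * ∫⁻ y, (likelihood p m y θ : ℝ≥0∞) * φ y ∂(Measure.pi fun _ : Fin m => μ) :=
        lintegral_const_mul _ ((hlm θ).mul hφ)
    _ ≤ w θ * b := by
        gcongr
        exact h1
    _ = b * w θ := mul_comm _ _

/-- Suppose that the likelihood ratio of the first `n` observations has mass at most `R` against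
`π`. A weight `φ` in the last `m` observations then reduces the expected mass of the full likelihood
ratio by the factor by which it reduces every `P^m_θ`. -/
theorem setLIntegral_split_le {S : Set (EuclideanSpace ℝ (Fin d))}
    (hp : Measurable (Function.uncurry p)) (hp0 : ∫⁻ y, (p θ₀ y : ℝ≥0∞) ∂μ = 1)
    (hπ : Measurable π) (n m : ℕ) {φ : (Fin m → 𝒴) → ℝ≥0∞} (hφ : Measurable φ) {b R : ℝ≥0∞}
    (hb : ∀ θ ∈ S, ∫⁻ y, φ y ∂(sampleLaw μ p m θ) ≤ b) :
    ∫⁻ y in {y : Fin (n + m) → 𝒴 | (∫⁻ θ in S,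
        (likelihood p n (fun i => y (Fin.castAdd m i)) θ : ℝ≥0∞) * (π θ : ℝ≥0∞)) /
          likelihood p n (fun i => y (Fin.castAdd m i)) θ₀ ≤ R},
      φ (fun i => y (Fin.natAdd n i)) * ((∫⁻ θ in S, (likelihood p (n + m) y θ : ℝ≥0∞) *
        (π θ : ℝ≥0∞)) / likelihood p (n + m) y θ₀) ∂(sampleLaw μ p (n + m) θ₀) ≤ b * R := by
  have hpm : ∀ θ, Measurable (p θ) := fun θ => hp.comp measurable_prodMk_left
  have hP := isProbabilityMeasure_obsLaw hp0
  have hPn := isProbabilityMeasure_sampleLaw hp0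
  have hlm : ∀ n : ℕ, Measurable fun y : Fin n → 𝒴 => (likelihood p n y θ₀ : ℝ≥0∞) := fun n =>
    (measurable_likelihood_left (hpm θ₀) n).coe_nnreal_ennreal
  have hgm : Measurable fun z : (Fin n → 𝒴) × EuclideanSpace ℝ (Fin d) =>
      (likelihood p n z.1 z.2 : ℝ≥0∞) * (π z.2 : ℝ≥0∞) :=
    Measurable.mul (measurable_likelihood hp n).coe_nnreal_ennreal
      (hπ.comp measurable_snd).coe_nnreal_ennreal
  have hg3 : Measurable fun z : ((Fin n → 𝒴) × (Fin m → 𝒴)) × EuclideanSpace ℝ (Fin d) =>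
      (likelihood p n z.1.1 z.2 : ℝ≥0∞) * π z.2 * likelihood p m z.1.2 z.2 :=
    Measurable.mul (hgm.comp ((measurable_fst.comp measurable_fst).prodMk measurable_snd))
      ((measurable_likelihood hp m).coe_nnreal_ennreal.comp
        ((measurable_snd.comp measurable_fst).prodMk measurable_snd))
  set B : Set (Fin n → 𝒴) := {y | (∫⁻ θ in S, (likelihood p n y θ : ℝ≥0∞) * (π θ : ℝ≥0∞)) /
    likelihood p n y θ₀ ≤ R} with hB
  have hBm : MeasurableSet B := measurableSet_le
    ((Measurable.lintegral_prod_right' hgm).div (hlm n)) measurable_const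
  set I : (Fin n → 𝒴) → (Fin m → 𝒴) → ℝ≥0∞ := fun y z =>
    ∫⁻ θ in S, (likelihood p n y θ : ℝ≥0∞) * π θ * likelihood p m z θ with hI
  have hIm : Measurable (Function.uncurry I) := Measurable.lintegral_prod_right' hg3
  set V : (Fin n → 𝒴) × (Fin m → 𝒴) → ℝ≥0∞ := fun z =>
    (likelihood p n z.1 θ₀ : ℝ≥0∞)⁻¹ * (φ z.2 * (I z.1 z.2 / likelihood p m z.2 θ₀)) with hV
  have hwm : ∀ y, Measurable fun z => φ z * (I y z / likelihood p m z θ₀) := fun y =>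
    hφ.mul ((hIm.comp measurable_prodMk_left).div (hlm m))
  have hVm : Measurable V := ((hlm n).comp measurable_fst).inv.mul
    ((hφ.comp measurable_snd).mul (hIm.div ((hlm m).comp measurable_snd)))
  have hsl : MeasurePreserving (fun y : Fin (n + m) → 𝒴 =>
        ((fun i => y (Fin.castAdd m i), fun i => y (Fin.natAdd n i)) :
          (Fin n → 𝒴) × (Fin m → 𝒴)))
      (sampleLaw μ p (n + m) θ₀) ((sampleLaw μ p n θ₀).prod (sampleLaw μ p m θ₀)) :=
    measurePreserving_split (obsLaw μ p θ₀) n m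
  have hfun : ∀ y : Fin (n + m) → 𝒴, φ (fun i => y (Fin.natAdd n i)) * ((∫⁻ θ in S,
        (likelihood p (n + m) y θ : ℝ≥0∞) * (π θ : ℝ≥0∞)) / likelihood p (n + m) y θ₀)
      = V (fun i => y (Fin.castAdd m i), fun i => y (Fin.natAdd n i)) := by
    intro y
    have e1 : ∫⁻ θ in S, (likelihood p (n + m) y θ : ℝ≥0∞) * (π θ : ℝ≥0∞)
        = I (fun i => y (Fin.castAdd m i)) (fun i => y (Fin.natAdd n i)) := by
      refine lintegral_congr fun θ => ?_
      rw [likelihood_add, ENNReal.coe_mul, mul_right_comm]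
    rw [e1, likelihood_add, ENNReal.coe_mul, div_eq_mul_inv,
      ENNReal.mul_inv (Or.inr ENNReal.coe_ne_top) (Or.inl ENNReal.coe_ne_top)]
    simp only [hV, div_eq_mul_inv]
    ring
  have hinner : ∀ y ∈ B, ∫⁻ z, V (y, z) ∂(sampleLaw μ p m θ₀) ≤ b * R := by
    intro y hy
    have hle := lintegral_weight_mul_likelihood_le (θ₀ := θ₀) hp m hφ hb
      (w := fun θ => (likelihood p n y θ : ℝ≥0∞) * π θ) (hgm.comp measurable_prodMk_left)
    have hVy : ∫⁻ z, V (y, z) ∂(sampleLaw μ p m θ₀) = (likelihood p n y θ₀ : ℝ≥0∞)⁻¹ *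
        ∫⁻ z, φ z * (I y z / likelihood p m z θ₀) ∂(sampleLaw μ p m θ₀) := by
      rw [← lintegral_const_mul _ (hwm y)]
    rw [hVy]
    calc _ ≤ (likelihood p n y θ₀ : ℝ≥0∞)⁻¹ *
          (b * ∫⁻ θ in S, (likelihood p n y θ : ℝ≥0∞) * π θ) := by gcongr
      _ = b * ((∫⁻ θ in S, (likelihood p n y θ : ℝ≥0∞) * π θ) / likelihood p n y θ₀) := by
          rw [div_eq_mul_inv]; ring
      _ ≤ _ := by
          gcongr
          exact hy
  simp_rw [hfun]
  calc _ = ∫⁻ z in B ×ˢ Set.univ, V z ∂((sampleLaw μ p n θ₀).prod (sampleLaw μ p m θ₀)) := by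
        rw [← hsl.setLIntegral_comp_preimage (hBm.prod MeasurableSet.univ) hVm]
        congr 2
        ext y
        simp [hB]
    _ = ∫⁻ y in B, ∫⁻ z, V (y, z) ∂(sampleLaw μ p m θ₀) ∂(sampleLaw μ p n θ₀) := by
        rw [← Measure.prod_restrict, Measure.restrict_univ, lintegral_prod _ hVm.aemeasurable]
    _ ≤ ∫⁻ _ in B, b * R ∂(sampleLaw μ p n θ₀) := setLIntegral_mono' hBm hinner
    _ ≤ b * R := by
        rw [setLIntegral_const]
        exact mul_le_of_le_one_right' prob_le_one

/-- On an intermediate shell the mass of the likelihood times `π` is negligible. As `π` need not be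
integrable there, finitely many observations are set aside to obtain a proper weight, and the tests
are based on the remaining ones. -/
theorem tendsto_fiducial_shell {S : Set (EuclideanSpace ℝ (Fin d))}
    (hp : Measurable (Function.uncurry p)) (hp0 : ∫⁻ y, (p θ₀ y : ℝ≥0∞) ∂μ = 1)
    (hπ : Measurable π) {δ : ∀ n : ℕ, (Fin n → 𝒴) → ℝ} {a : ℝ} (ha : 0 < a)
    (hδm : ∀ n, Measurable (δ n))
    (hδ0 : Tendsto (fun n => ∫⁻ y, ENNReal.ofReal (δ n y) ∂(sampleLaw μ p n θ₀)) atTop (𝓝 0))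
    (hδ : ∀ n, ∀ θ ∈ S, ∫⁻ y, ENNReal.ofReal (1 - δ n y) ∂(sampleLaw μ p n θ)
      ≤ ENNReal.ofReal (Real.exp (-(a * n))))
    (hfin : Tendsto (fun n => sampleLaw μ p n θ₀
      {y | ∫⁻ θ in S, (likelihood p n y θ : ℝ≥0∞) * (π θ : ℝ≥0∞) = ∞}) atTop (𝓝 0)) :
    TendstoZeroInProb (fun n => sampleLaw μ p n θ₀) fun n y =>
      ENNReal.ofReal (√(n : ℝ) ^ d) * ((∫⁻ θ in S,
        (likelihood p n y θ : ℝ≥0∞) * (π θ : ℝ≥0∞)) / likelihood p n y θ₀) := by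
  have hpm : ∀ θ, Measurable (p θ) := fun θ => hp.comp measurable_prodMk_left
  have hP := isProbabilityMeasure_obsLaw hp0
  have hPn := isProbabilityMeasure_sampleLaw hp0
  have hlm : ∀ n : ℕ, Measurable fun y : Fin n → 𝒴 => (likelihood p n y θ₀ : ℝ≥0∞) := fun n =>
    (measurable_likelihood_left (hpm θ₀) n).coe_nnreal_ennreal
  set U : ∀ n : ℕ, (Fin n → 𝒴) → ℝ≥0∞ := fun n y =>
    ∫⁻ θ in S, (likelihood p n y θ : ℝ≥0∞) * (π θ : ℝ≥0∞) with hU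
  have hUm : ∀ n, Measurable (U n) := fun n => Measurable.lintegral_prod_right'
    (Measurable.mul (measurable_likelihood hp n).coe_nnreal_ennreal
      (hπ.comp measurable_snd).coe_nnreal_ennreal)
  have hδ0' : TendstoZeroInProb (fun n => sampleLaw μ p n θ₀) fun n y => ENNReal.ofReal (δ n y) :=
    TendstoZeroInProb.of_lintegral
      (Eventually.of_forall fun n => (hδm n).ennreal_ofReal.aemeasurable) hδ0
  have hhalf := hδ0' (1 / 2) (by simp)
  refine TendstoZeroInProb.of_shift fun η hη => ?_
  have hη3 : 0 < η / 3 := ENNReal.div_pos hη.ne' (by simp)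
  obtain ⟨n₀, hn₀⟩ := (hfin.eventually (gt_mem_nhds hη3)).exists
  refine ⟨n₀, ?_⟩
  obtain ⟨R, hR⟩ : ∃ R : ℕ, sampleLaw μ p n₀ θ₀
      {y | U n₀ y / likelihood p n₀ y θ₀ ≤ (R : ℝ≥0∞)}ᶜ ≤ η / 3 := by
    have hzero := sampleLaw_likelihood_eq_zero μ (hpm θ₀) n₀
    refine exists_measure_le_compl_le ((hUm n₀).div (hlm n₀)) (lt_of_le_of_lt ((measure_mono
      (t := {y | U n₀ y = ∞} ∪ {y | likelihood p n₀ y θ₀ = 0}) fun y hy => ?_).trans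
      (measure_union_le _ _)) (by rw [hzero, add_zero]; exact hn₀))
    by_contra hc
    simp only [Set.mem_union, Set.mem_ofPred_eq, not_or] at hc
    exact ENNReal.div_ne_top hc.1 (ENNReal.coe_ne_zero.2 hc.2) hy
  set B : Set (Fin n₀ → 𝒴) := {y | U n₀ y / likelihood p n₀ y θ₀ ≤ (R : ℝ≥0∞)} with hB
  have hBm : MeasurableSet B := measurableSet_le ((hUm n₀).div (hlm n₀)) measurable_const
  have hsl : ∀ m : ℕ, MeasurePreserving (fun y : Fin (n₀ + m) → 𝒴 =>
        ((fun i => y (Fin.castAdd m i), fun i => y (Fin.natAdd n₀ i)) :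
          (Fin n₀ → 𝒴) × (Fin m → 𝒴)))
      (sampleLaw μ p (n₀ + m) θ₀) ((sampleLaw μ p n₀ θ₀).prod (sampleLaw μ p m θ₀)) := fun m =>
    measurePreserving_split (obsLaw μ p θ₀) n₀ m
  have hpreB : ∀ m : ℕ, MeasurableSet {y : Fin (n₀ + m) → 𝒴 | (fun i => y (Fin.castAdd m i)) ∈ B} :=
    fun m => (measurable_fst.comp (hsl m).measurable) hBm
  -- the mass given `n₀ + m` observations, on the event `B` and weighted by the test
  have hY : TendstoZeroInProb (fun m => sampleLaw μ p (n₀ + m) θ₀) fun m y =>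
      2 * (ENNReal.ofReal (√((n₀ + m : ℕ) : ℝ) ^ d) *
        {y : Fin (n₀ + m) → 𝒴 | (fun i => y (Fin.castAdd m i)) ∈ B}.indicator (fun y =>
          ENNReal.ofReal (1 - δ m fun i => y (Fin.natAdd n₀ i)) *
            (U (n₀ + m) y / likelihood p (n₀ + m) y θ₀)) y) := by
    have hm1 : ∀ m : ℕ, Measurable fun y : Fin (n₀ + m) → 𝒴 =>
        ENNReal.ofReal (1 - δ m fun i => y (Fin.natAdd n₀ i)) *
            (U (n₀ + m) y / likelihood p (n₀ + m) y θ₀) := fun m =>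
      (((hδm m).comp (measurable_snd.comp (hsl m).measurable)).const_sub 1).ennreal_ofReal.mul
        ((hUm _).div (hlm _))
    refine TendstoZeroInProb.const_mul ?_ ENNReal.ofNat_ne_top
    refine TendstoZeroInProb.of_lintegral (Eventually.of_forall fun m => ?_) ?_
    · exact (((hm1 m).indicator (hpreB m)).const_mul _).aemeasurable
    · have hlim := ENNReal.Tendsto.mul_const (tendsto_sqrt_pow_mul_exp d n₀ ha)
        (Or.inr (ENNReal.natCast_ne_top R))
      rw [zero_mul] at hlim
      refine tendsto_of_tendsto_of_tendsto_of_le_of_le tendsto_const_nhds hlim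
        (fun _ => zero_le) fun m => ?_
      simp only
      rw [lintegral_const_mul' _ _ ENNReal.ofReal_ne_top, mul_assoc, lintegral_indicator (hpreB m)]
      gcongr
      exact setLIntegral_split_le hp hp0 hπ n₀ m ((hδm m).const_sub 1).ennreal_ofReal (hδ m)
  intro ε hε
  filter_upwards [(hY ε hε).eventually (ge_mem_nhds hη3), hhalf.eventually (ge_mem_nhds hη3)]
    with m hm1 hm2
  have hpre1 : sampleLaw μ p (n₀ + m) θ₀ {y | (fun i => y (Fin.castAdd m i)) ∉ B} ≤ η / 3 := by
    have h1 := (measurePreserving_fst.comp (hsl m)).measure_preimage hBm.compl.nullMeasurableSet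
    exact (le_of_eq h1).trans hR
  have hpre2 : sampleLaw μ p (n₀ + m) θ₀
      {y | (1 / 2 : ℝ≥0∞) ≤ ENNReal.ofReal (δ m fun i => y (Fin.natAdd n₀ i))} ≤ η / 3 := by
    have h1 := (measurePreserving_snd.comp (hsl m)).measure_preimage
      (measurableSet_le (measurable_const (a := (1 / 2 : ℝ≥0∞)))
        (hδm m).ennreal_ofReal).nullMeasurableSet
    exact (le_of_eq h1).trans hm2
  refine le_trans ((measure_mono (fun y hy => ?_)).trans ((measure_union_le _ _).trans (add_le_add
    ((measure_union_le _ _).trans (add_le_add hpre1 hpre2)) hm1))) (ENNReal.add_thirds η).le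
  by_contra hc
  simp only [Set.mem_union, not_or, Set.mem_ofPred_eq, not_not] at hc
  refine hc.2 (le_trans hy ?_)
  have h1 := one_le_two_mul_ofReal_one_sub hc.1.2
  rw [Set.indicator_of_mem (by exact hc.1.1)]
  generalize U (n₀ + m) y / (likelihood p (n₀ + m) y θ₀ : ℝ≥0∞) = Z
  calc ENNReal.ofReal (√((n₀ + m : ℕ) : ℝ) ^ d) * Z
      = ENNReal.ofReal (√((n₀ + m : ℕ) : ℝ) ^ d) * (1 * Z) := by rw [one_mul]
    _ ≤ ENNReal.ofReal (√((n₀ + m : ℕ) : ℝ) ^ d) * ((2 * ENNReal.ofReal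
        (1 - δ m fun i => y (Fin.natAdd n₀ i))) * Z) := by gcongr
    _ = _ := by ring

end Far

theorem abs_sub_le_of_iSup_lt {Z : Type*} {Θ : Set (EuclideanSpace ℝ (Fin d))}
    {θ₀ : EuclideanSpace ℝ (Fin d)} {J : ∀ n : ℕ, (Fin n → Z) → EuclideanSpace ℝ (Fin d) → ℝ≥0}
    {D : ℝ} {π : EuclideanSpace ℝ (Fin d) → ℝ≥0} {n : ℕ} {y : Fin n → Z} {τ : ℝ} (hτ : 0 ≤ τ)
    (h : ¬ ENNReal.ofReal τ ≤ ⨆ θ ∈ Θ ∩ Metric.closedBall θ₀ D,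
      ENNReal.ofReal |(J n y θ : ℝ) - (π θ : ℝ)| / (J n y θ : ℝ≥0∞)) :
    ∀ θ ∈ Θ ∩ Metric.closedBall θ₀ D, |(J n y θ : ℝ) - π θ| ≤ τ * J n y θ := fun θ hθ =>
  abs_sub_le_of_div_le hτ ((le_iSup₂ (f := fun θ (_ : θ ∈ Θ ∩ Metric.closedBall θ₀ D) =>
    ENNReal.ofReal |(J n y θ : ℝ) - (π θ : ℝ)| / (J n y θ : ℝ≥0∞)) θ hθ).trans (not_le.1 h).le)

section FarAll

variable {μ : Measure 𝒴} [SigmaFinite μ] {Θ : Set (EuclideanSpace ℝ (Fin d))}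
  {θ₀ : EuclideanSpace ℝ (Fin d)} {p : EuclideanSpace ℝ (Fin d) → 𝒴 → ℝ≥0}
  {J : ∀ n : ℕ, (Fin n → 𝒴) → EuclideanSpace ℝ (Fin d) → ℝ≥0}
  {p₁ p₂ : ∀ n : ℕ, (Fin n → 𝒴) → EuclideanSpace ℝ (Fin d) → ℝ≥0}
  {D : ℝ} {γ π : EuclideanSpace ℝ (Fin d) → ℝ≥0}

/-- The fiducial mass outside any neighbourhood of `θ₀` is negligible at the scale of the local
parameter. -/
theorem tendsto_fiducial_far (hΘ : MeasurableSet Θ) (hθ₀ : θ₀ ∈ Θ) (hp : IsDensityFamily μ Θ p)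
    (hJ : ∀ n, Measurable (Function.uncurry (J n)))
    (hproper : Tendsto (fun n => sampleLaw μ p n θ₀
      {y | fiducialNormalizer Θ p J n y = ∞}) atTop (𝓝 0))
    (hD : 0 < D) (hπ : Measurable π) (hJπ : JacobianConverges μ Θ p J θ₀ D π)
    (hsplit : LikelihoodSplits μ Θ p J θ₀ D p₁ p₂ γ)
    (htests : ExpConsistentTests μ Θ p θ₀ p₁) {ε : ℝ} (hε : 0 < ε) :
    TendstoZeroInProb (fun n => sampleLaw μ p n θ₀) fun n y =>
      ENNReal.ofReal (√(n : ℝ) ^ d) * ((∫⁻ θ in Θ ∩ {θ | ε < ‖θ - θ₀‖},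
        (likelihood p n y θ : ℝ≥0∞) * (J n y θ : ℝ≥0∞)) / likelihood p n y θ₀) := by
  obtain ⟨δ, c, hc, hδm, -, hδ0, hδ⟩ := htests ε hε
  set a : ℝ := c * min (ε ^ 2) 1 with ha
  have ha0 : 0 < a := mul_pos hc (lt_min (by positivity) one_pos)
  set S := (Θ ∩ Metric.closedBall θ₀ D) ∩ {θ | ε < ‖θ - θ₀‖} with hSdef
  have hS : MeasurableSet S := (hΘ.inter Metric.isClosed_closedBall.measurableSet).inter
    (measurableSet_lt_norm_sub ε)
  have hhalf := hJπ (ENNReal.ofReal (1 / 2)) (by simp)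
  have hJbd : ∀ {n : ℕ} {y : Fin n → 𝒴}, (¬ ENNReal.ofReal (1 / 2) ≤
      ⨆ θ ∈ Θ ∩ Metric.closedBall θ₀ D,
        ENNReal.ofReal |(J n y θ : ℝ) - (π θ : ℝ)| / (J n y θ : ℝ≥0∞)) →
      ∀ θ ∈ Θ ∩ Metric.closedBall θ₀ D, J n y θ ≤ 2 * π θ ∧ π θ ≤ 2 * J n y θ := by
    intro n y hy θ hθ
    have h1 := abs_le.1 (abs_sub_le_of_iSup_lt (by norm_num) hy θ hθ)
    have h2 := NNReal.coe_nonneg (J n y θ)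
    refine ⟨?_, ?_⟩
    · rw [← NNReal.coe_le_coe]; push_cast; linarith [h1.2]
    · rw [← NNReal.coe_le_coe]; push_cast; linarith [h1.1]
  have hfin : Tendsto (fun n => sampleLaw μ p n θ₀
      {y | ∫⁻ θ in S, (likelihood p n y θ : ℝ≥0∞) * (π θ : ℝ≥0∞) = ∞}) atTop (𝓝 0) := by
    have hsum := hproper.add hhalf
    rw [add_zero] at hsum
    refine tendsto_of_tendsto_of_tendsto_of_le_of_le tendsto_const_nhds hsum
      (fun _ => zero_le) fun n => le_trans (measure_mono fun y hy => ?_) (measure_union_le _ _)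
    by_contra hc
    simp only [Set.mem_union, not_or] at hc
    refine ENNReal.mul_ne_top (a := 2) ENNReal.ofNat_ne_top hc.1 (top_unique ?_)
    rw [← show _ = ∞ from hy]
    calc _ ≤ ∫⁻ θ in S, 2 * ((likelihood p n y θ : ℝ≥0∞) * (J n y θ : ℝ≥0∞)) := by
          refine setLIntegral_mono' hS fun θ hθ => ?_
          rw [mul_left_comm]
          gcongr
          exact_mod_cast (hJbd hc.2 θ hθ.1).2
      _ = 2 * ∫⁻ θ in S, (likelihood p n y θ : ℝ≥0∞) * (J n y θ : ℝ≥0∞) :=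
          lintegral_const_mul' _ _ ENNReal.ofNat_ne_top
      _ ≤ _ := by
          unfold fiducialNormalizer
          gcongr
          exact fun θ hθ => hθ.1.1
  have hshell := tendsto_fiducial_shell (S := S) hp.measurable (hp.lintegral_eq_one θ₀ hθ₀) hπ ha0 hδm hδ0
    (fun n θ hθ => (hδ n θ hθ.1.1 (le_of_lt hθ.2)).1.trans (ENNReal.ofReal_le_ofReal
      (Real.exp_le_exp.2 (by
        have : ε < ‖θ - θ₀‖ := hθ.2
        rw [ha, neg_le_neg_iff, mul_assoc, mul_assoc, mul_comm (n : ℝ)]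
        gcongr)))) hfin
  have hout := tendsto_fiducial_outside hΘ hp.measurable hJ hD hsplit htests
  refine TendstoZeroInProb.of_le fun η hη τ _ _ => ⟨fun n => {y | ¬ ENNReal.ofReal (1 / 2) ≤
      ⨆ θ ∈ Θ ∩ Metric.closedBall θ₀ D,
        ENNReal.ofReal |(J n y θ : ℝ) - (π θ : ℝ)| / (J n y θ : ℝ≥0∞)}, _, ?_,
    (hshell.const_mul (ENNReal.ofNat_ne_top (n := 2))).add hout,
    Eventually.of_forall fun n y hy => ?_⟩
  · filter_upwards [hhalf.eventually (ge_mem_nhds hη)] with n hn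
    refine (measure_mono fun y hy => ?_).trans hn
    exact not_not.1 hy
  · refine le_trans ?_ le_self_add
    rw [mul_left_comm, ← mul_add]
    gcongr
    rw [← mul_div_assoc, ← ENNReal.add_div]
    gcongr
    calc _ ≤ ∫⁻ θ in S ∪ (Θ ∩ {θ | D < ‖θ - θ₀‖}),
          (likelihood p n y θ : ℝ≥0∞) * (J n y θ : ℝ≥0∞) := by
          refine lintegral_mono_set fun θ hθ => ?_
          rcases le_or_gt ‖θ - θ₀‖ D with h | h
          · exact Or.inl ⟨⟨hθ.1, by rwa [Metric.mem_closedBall, dist_eq_norm]⟩, hθ.2⟩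
          · exact Or.inr ⟨hθ.1, h⟩
      _ ≤ _ := lintegral_union_le _ _ _
      _ ≤ _ := by
          gcongr
          rw [← lintegral_const_mul' _ _ ENNReal.ofNat_ne_top]
          refine setLIntegral_mono' hS fun θ hθ => ?_
          rw [mul_left_comm]
          gcongr
          exact (ENNReal.coe_le_coe.2 (hJbd hy θ hθ.1).1).trans_eq (by push_cast; rfl)

end FarAll

/-! ### Passage to the local parameter -/

theorem lintegral_comp_add_inv_smul {s : ℝ} (hs : 0 < s) (θ₀ : EuclideanSpace ℝ (Fin d))
    {f : EuclideanSpace ℝ (Fin d) → ℝ≥0∞} (hf : Measurable f) :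
    ∫⁻ h, f (θ₀ + s⁻¹ • h) = ENNReal.ofReal (s ^ d) * ∫⁻ θ, f θ := by
  have h1 : ∫⁻ h, f (θ₀ + s⁻¹ • h)
      = ∫⁻ θ, f (θ₀ + θ) ∂(volume.map fun h : EuclideanSpace ℝ (Fin d) => s⁻¹ • h) :=
    (lintegral_map (hf.comp (measurable_const_add θ₀)) (measurable_const_smul s⁻¹)).symm
  rw [h1, Measure.map_addHaar_smul _ (inv_ne_zero hs.ne'), lintegral_smul_measure,
    lintegral_add_left_eq_self, finrank_euclideanSpace_fin, inv_pow, inv_inv,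
    abs_of_pos (by positivity), smul_eq_mul]

/-- The rescaled distribution has the rescaled density; the Jacobian determinant of the scaling
cancels with the normalization. -/
theorem map_normalize_withDensity {s : ℝ} (hs : 0 < s) (θ₀ : EuclideanSpace ℝ (Fin d))
    {f : EuclideanSpace ℝ (Fin d) → ℝ≥0∞} (hf : Measurable f) :
    ((∫⁻ θ, f θ)⁻¹ • (volume.withDensity f)).map (fun θ => s • (θ - θ₀))
      = (∫⁻ h, f (θ₀ + s⁻¹ • h))⁻¹ • volume.withDensity fun h => f (θ₀ + s⁻¹ • h) := by
  have hT : Measurable fun θ : EuclideanSpace ℝ (Fin d) => s • (θ - θ₀) :=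
    (measurable_id.sub_const θ₀).const_smul s
  have hc0 : ENNReal.ofReal (s ^ d) ≠ 0 := by
    rw [Ne, ENNReal.ofReal_eq_zero, not_le]; positivity
  ext B hB
  rw [Measure.map_apply hT hB, Measure.smul_apply, Measure.smul_apply,
    withDensity_apply _ (hT hB), withDensity_apply _ hB, smul_eq_mul, smul_eq_mul,
    lintegral_comp_add_inv_smul hs θ₀ hf]
  have h1 : ∫⁻ h in B, f (θ₀ + s⁻¹ • h) = ENNReal.ofReal (s ^ d) *
      ∫⁻ θ in (fun θ => s • (θ - θ₀)) ⁻¹' B, f θ := by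
    rw [← lintegral_indicator hB, ← lintegral_indicator (hT hB),
      ← lintegral_comp_add_inv_smul hs θ₀ (hf.indicator (hT hB))]
    refine lintegral_congr fun h => ?_
    have e1 : s • (θ₀ + s⁻¹ • h - θ₀) = h := by
      rw [add_sub_cancel_left, smul_inv_smul₀ hs.ne']
    by_cases hh : h ∈ B
    · rw [Set.indicator_of_mem hh, Set.indicator_of_mem (by rwa [Set.mem_preimage, e1])]
    · rw [Set.indicator_of_notMem hh, Set.indicator_of_notMem (by rwa [Set.mem_preimage, e1])]
  rw [h1, ENNReal.mul_inv (Or.inl hc0) (Or.inl ENNReal.ofReal_ne_top), mul_mul_mul_comm,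
    ENNReal.inv_mul_cancel hc0 ENNReal.ofReal_ne_top, one_mul]

theorem normalize_withDensity_const_mul {E : Type*} [MeasurableSpace E] (ν : Measure E)
    {k : ℝ≥0∞} (hk0 : k ≠ 0) (hk : k ≠ ∞) {f : E → ℝ≥0∞} (hf : Measurable f) :
    (∫⁻ x, k * f x ∂ν)⁻¹ • ν.withDensity (fun x => k * f x)
      = (∫⁻ x, f x ∂ν)⁻¹ • ν.withDensity f := by
  have h1 : ν.withDensity (fun x => k * f x) = k • ν.withDensity f := withDensity_smul k hf
  rw [h1, lintegral_const_mul _ hf, smul_smul, ENNReal.mul_inv (Or.inl hk0) (Or.inl hk),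
    mul_right_comm, ENNReal.inv_mul_cancel hk0 hk, one_mul]

theorem localFiducial_eq {Θ : Set (EuclideanSpace ℝ (Fin d))} (hΘ : MeasurableSet Θ)
    {p : EuclideanSpace ℝ (Fin d) → 𝒴 → ℝ≥0} (hp : Measurable (Function.uncurry p))
    {J : ∀ n : ℕ, (Fin n → 𝒴) → EuclideanSpace ℝ (Fin d) → ℝ≥0}
    (hJ : ∀ n, Measurable (Function.uncurry (J n))) (θ₀ : EuclideanSpace ℝ (Fin d)) {n : ℕ}
    (hn : 0 < n) (y : Fin n → 𝒴) :
    localFiducial Θ p J θ₀ n y = (∫⁻ h, Θ.indicator (fun θ => (likelihood p n y θ : ℝ≥0∞) *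
        (J n y θ : ℝ≥0∞)) (θ₀ + (√(n : ℝ))⁻¹ • h))⁻¹ • volume.withDensity fun h =>
      Θ.indicator (fun θ => (likelihood p n y θ : ℝ≥0∞) * (J n y θ : ℝ≥0∞))
        (θ₀ + (√(n : ℝ))⁻¹ • h) := by
  have hn' : (0 : ℝ) < √(n : ℝ) := Real.sqrt_pos.2 (by exact_mod_cast hn)
  have hF : Measurable fun θ => (likelihood p n y θ : ℝ≥0∞) * (J n y θ : ℝ≥0∞) :=
    ((measurable_likelihood hp n).comp measurable_prodMk_left).coe_nnreal_ennreal.mul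
      ((hJ n).comp measurable_prodMk_left).coe_nnreal_ennreal
  rw [← map_normalize_withDensity hn' θ₀ (hF.indicator hΘ), localFiducial, fiducial,
    fiducialNormalizer, withDensity_indicator hΘ, lintegral_indicator hΘ]

theorem toEuclideanCLM_localStat (μ : Measure 𝒴) (p : EuclideanSpace ℝ (Fin d) → 𝒴 → ℝ≥0)
    (θ₀ : EuclideanSpace ℝ (Fin d)) {ℓ : 𝒴 → EuclideanSpace ℝ (Fin d)}
    (hI : IsUnit (fisherInfo μ p θ₀ ℓ)) (n : ℕ) (y : Fin n → 𝒴) :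
    Matrix.toEuclideanCLM (𝕜 := ℝ) (fisherInfo μ p θ₀ ℓ) (localStat μ p θ₀ ℓ n y)
      = normSum ℓ n y := by
  have h1 : ∀ v : EuclideanSpace ℝ (Fin d), Matrix.toEuclideanCLM (𝕜 := ℝ) (fisherInfo μ p θ₀ ℓ)
      (Matrix.toEuclideanLin (fisherInfo μ p θ₀ ℓ)⁻¹ v) = v := fun v => by
    have h2 : Matrix.toEuclideanLin (fisherInfo μ p θ₀ ℓ)⁻¹ v
        = Matrix.toEuclideanCLM (𝕜 := ℝ) (fisherInfo μ p θ₀ ℓ)⁻¹ v := rfl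
    rw [h2, ← mul_apply_eq_comp, ← map_mul,
      Matrix.mul_nonsing_inv _ ((Matrix.isUnit_iff_isUnit_det _).1 hI), map_one]
    rfl
  rw [localStat, normSum, map_smul, map_sum]
  simp_rw [h1]

/-- The total variation distance between the local fiducial distribution and its Gaussian limit,
on the event that the Jacobian has relative error at most `τ`. -/
theorem tvNorm_localFiducial_le {μ : Measure 𝒴} {Θ : Set (EuclideanSpace ℝ (Fin d))}
    (hΘ : MeasurableSet Θ)
    {θ₀ : EuclideanSpace ℝ (Fin d)} {p : EuclideanSpace ℝ (Fin d) → 𝒴 → ℝ≥0}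
    {ℓ : 𝒴 → EuclideanSpace ℝ (Fin d)} (hr : IsRegularAt μ p θ₀ ℓ)
    (hI : IsUnit (fisherInfo μ p θ₀ ℓ))
    {J : ∀ n : ℕ, (Fin n → 𝒴) → EuclideanSpace ℝ (Fin d) → ℝ≥0}
    (hJ : ∀ n, Measurable (Function.uncurry (J n))) {D ε τ : ℝ} {π : EuclideanSpace ℝ (Fin d) → ℝ≥0}
    (hπ : Measurable π) (hπ0 : 0 < π θ₀) (hεD : ε ≤ D) (hεΘ : Metric.closedBall θ₀ ε ⊆ Θ)
    (hτ0 : 0 ≤ τ) (hτ : τ ≤ 1 / 2) {n : ℕ} (hn : 0 < n) {y : Fin n → 𝒴}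
    (hlik : likelihood p n y θ₀ ≠ 0)
    (hJy : ∀ θ ∈ Θ ∩ Metric.closedBall θ₀ D, |(J n y θ : ℝ) - π θ| ≤ τ * J n y θ) :
    tvNorm (localFiducial Θ p J θ₀ n y)
        (multivariateGaussian (localStat μ p θ₀ ℓ n y) (fisherInfo μ p θ₀ ℓ)⁻¹)
      ≤ 4 * ((π θ₀ * ∫⁻ h, ENNReal.ofReal (limitRatio (Matrix.toEuclideanCLM (𝕜 := ℝ)
          (fisherInfo μ p θ₀ ℓ)) 0 h))⁻¹ *
        (2 * ((∫⁻ h, ‖localDiff μ p θ₀ ℓ π ε n y h‖ₑ) / likelihood p n y θ₀) +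
        ENNReal.ofReal (√(n : ℝ) ^ d) * ((∫⁻ θ in Θ ∩ {θ | ε < ‖θ - θ₀‖},
          (likelihood p n y θ : ℝ≥0∞) * (J n y θ : ℝ≥0∞)) / likelihood p n y θ₀))
        + ENNReal.ofReal (2 * τ)) := by
  set A := Matrix.toEuclideanCLM (𝕜 := ℝ) (fisherInfo μ p θ₀ ℓ) with hA
  set S := normSum ℓ n y with hS
  set l := likelihood p n y θ₀ with hl
  set s := √(n : ℝ) with hs
  have hs0 : 0 < s := Real.sqrt_pos.2 (by exact_mod_cast hn)
  have hRm : Measurable fun h => ENNReal.ofReal (limitRatio A S h) :=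
    (measurable_limitRatio A measurable_const measurable_id).ennreal_ofReal
  set F : EuclideanSpace ℝ (Fin d) → ℝ≥0∞ := fun θ =>
    (likelihood p n y θ : ℝ≥0∞) * (J n y θ : ℝ≥0∞) with hF
  have hFm : Measurable F :=
    ((measurable_likelihood hr.measurable n).comp measurable_prodMk_left).coe_nnreal_ennreal.mul
      ((hJ n).comp measurable_prodMk_left).coe_nnreal_ennreal
  have hTm : Measurable fun h : EuclideanSpace ℝ (Fin d) => θ₀ + s⁻¹ • h :=
    (measurable_id.const_smul s⁻¹).const_add θ₀
  set q : EuclideanSpace ℝ (Fin d) → ℝ≥0∞ := fun h => Θ.indicator F (θ₀ + s⁻¹ • h) with hq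
  have hqm : Measurable q := (hFm.indicator hΘ).comp hTm
  set k : ℝ≥0∞ := (π θ₀ : ℝ≥0∞) * l with hk
  have hk0 : k ≠ 0 := mul_ne_zero (ENNReal.coe_ne_zero.2 hπ0.ne') (ENNReal.coe_ne_zero.2 hlik)
  have hkt : k ≠ ∞ := ENNReal.mul_ne_top ENNReal.coe_ne_top ENNReal.coe_ne_top
  set z : EuclideanSpace ℝ (Fin d) → ℝ≥0∞ := fun h => k * ENNReal.ofReal (limitRatio A S h) with hz
  have hzm : Measurable z := hRm.const_mul k
  set L := localDiff μ p θ₀ ℓ π ε n y with hL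
  have hLm : Measurable fun h => ‖L h‖ₑ :=
    ((hr.measurable_localDiff hπ ε n).comp measurable_prodMk_left).enorm
  have hEm := hΘ.inter (measurableSet_lt_norm_sub (θ₀ := θ₀) ε)
  set E := Θ ∩ {θ | ε < ‖θ - θ₀‖} with hE
  set w : EuclideanSpace ℝ (Fin d) → ℝ≥0∞ := fun h =>
    2 * ‖L h‖ₑ + (ENNReal.ofReal (2 * τ) * z h + E.indicator F (θ₀ + s⁻¹ • h)) with hw
  have hwm : Measurable w := (hLm.const_mul 2).add
    ((hzm.const_mul _).add ((hFm.indicator hEm).comp hTm))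
  have hzR : ∀ h, z h = ENNReal.ofReal (π θ₀ * (l * limitRatio A S h)) := fun h => by
    rw [ENNReal.ofReal_mul (NNReal.coe_nonneg _), ENNReal.ofReal_mul (NNReal.coe_nonneg _),
      ENNReal.ofReal_coe_nnreal, ENNReal.ofReal_coe_nnreal, ← mul_assoc]
  -- `q` and `z` are the unnormalized densities of the two distributions; near `0` they are compared
  -- by replacing `J` with `π`, and elsewhere both are counted in the error `w`
  have hpt : ∀ h, q h ≤ z h + w h ∧ z h ≤ q h + w h := by
    intro h
    by_cases hh : ‖s⁻¹ • h‖ ≤ ε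
    · have hball : θ₀ + s⁻¹ • h ∈ Metric.closedBall θ₀ ε := by
        rwa [Metric.mem_closedBall, dist_eq_norm, add_sub_cancel_left]
      have hmem := hεΘ hball
      have hj := hJy _ ⟨hmem, Metric.closedBall_subset_closedBall hεD hball⟩
      have hLh : L h = (likelihood p n y (θ₀ + s⁻¹ • h) : ℝ) * π (θ₀ + s⁻¹ • h)
          - π θ₀ * (l * limitRatio A S h) := by
        rw [hL, localDiff, Set.indicator_of_mem (by exact hh)]
      have hqR : q h = ENNReal.ofReal ((likelihood p n y (θ₀ + s⁻¹ • h) : ℝ) *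
          J n y (θ₀ + s⁻¹ • h)) := by
        rw [ENNReal.ofReal_mul (NNReal.coe_nonneg _), ENNReal.ofReal_coe_nnreal,
          ENNReal.ofReal_coe_nnreal]
        exact Set.indicator_of_mem hmem _
      have hZ0 : 0 ≤ π θ₀ * (l * limitRatio A S h) := by
        have := limitRatio_pos A S h
        positivity
      have hwR : ENNReal.ofReal (2 * |L h| + 2 * τ * (π θ₀ * (l * limitRatio A S h))) ≤ w h := by
        rw [ENNReal.ofReal_add (by positivity) (by positivity), ENNReal.ofReal_mul two_pos.le,
          ENNReal.ofReal_mul (by positivity), ← hzR, ← Real.enorm_eq_ofReal_abs,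
          ENNReal.ofReal_ofNat]
        simp only [hw]
        gcongr
        exact le_self_add
      have hr0 := NNReal.coe_nonneg (likelihood p n y (θ₀ + s⁻¹ • h))
      have hj0 := NNReal.coe_nonneg (J n y (θ₀ + s⁻¹ • h))
      rw [hqR, hzR]
      generalize (likelihood p n y (θ₀ + s⁻¹ • h) : ℝ) = r at *
      generalize (J n y (θ₀ + s⁻¹ • h) : ℝ) = j at *
      generalize (π (θ₀ + s⁻¹ • h) : ℝ) = a at *
      generalize (π θ₀ : ℝ) * (l * limitRatio A S h) = Z at *
      have hja : j ≤ 2 * a := by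
        have h1 := (abs_le.1 hj).2
        nlinarith
      have hd : |r * j - r * a| ≤ |L h| + 2 * τ * Z := by
        rw [← mul_sub, abs_mul, abs_of_nonneg hr0]
        calc r * |j - a| ≤ r * (τ * (2 * a)) := by
              gcongr
              exact hj.trans (by gcongr)
          _ = 2 * τ * (L h) + 2 * τ * Z := by rw [hLh]; ring
          _ ≤ 2 * τ * |L h| + 2 * τ * Z := by
              gcongr
              exact le_abs_self _
          _ ≤ _ := by
              gcongr
              exact mul_le_of_le_one_left (abs_nonneg _) (by linarith)
      have hd' := abs_le.1 hd
      have hL1 := le_abs_self (L h)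
      have hL2 := neg_abs_le (L h)
      have hw1 : 0 ≤ 2 * |L h| + 2 * τ * Z := by positivity
      constructor
      · refine le_trans ?_ (add_le_add_right hwR _)
        rw [← ENNReal.ofReal_add hZ0 hw1]
        exact ENNReal.ofReal_le_ofReal (by linarith)
      · refine le_trans ?_ (add_le_add_right hwR _)
        rw [← ENNReal.ofReal_add (by positivity) hw1]
        exact ENNReal.ofReal_le_ofReal (by linarith)
    · have hqE : q h = E.indicator F (θ₀ + s⁻¹ • h) := by
        have hmem : θ₀ + s⁻¹ • h ∈ E ↔ θ₀ + s⁻¹ • h ∈ Θ := by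
          simp only [hE, Set.mem_inter_iff, Set.mem_ofPred_eq, add_sub_cancel_left,
            not_le.1 hh, and_true]
        by_cases hm : θ₀ + s⁻¹ • h ∈ Θ
        · simp only [hq]
          rw [Set.indicator_of_mem hm, Set.indicator_of_mem (hmem.2 hm)]
        · simp only [hq]
          rw [Set.indicator_of_notMem hm, Set.indicator_of_notMem (mt hmem.1 hm)]
      have hLz : ‖L h‖ₑ = z h := by
        rw [hL, localDiff, Set.indicator_of_notMem (by exact hh), zero_sub, enorm_neg, hzR,
          Real.enorm_of_nonneg]
        have := limitRatio_pos A S h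
        positivity
      constructor
      · rw [hqE]
        exact (le_add_self.trans le_add_self).trans le_add_self
      · rw [← hLz]
        refine le_trans ?_ (le_self_add.trans le_add_self)
        rw [two_mul]
        exact le_self_add
  have hRpos := (lintegral_limitRatio_zero_pos A).trans_le (lintegral_limitRatio_zero_le A S)
  obtain ⟨c₀, hc₀, hcA⟩ := hr.exists_le_inner_fisherInfo hI
  have hRfin : ∫⁻ h, ENNReal.ofReal (limitRatio A S h) ≠ ∞ := by
    refine ne_top_of_le_ne_top (lintegral_exp_norm_lt_top (a := ‖S‖) (half_pos hc₀)).ne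
      (lintegral_mono fun h => ENNReal.ofReal_le_ofReal (limitRatio_le hcA le_rfl h))
  have hzint : ∫⁻ h, z h = k * ∫⁻ h, ENNReal.ofReal (limitRatio A S h) :=
    lintegral_const_mul k hRm
  have hz0 : ∫⁻ h, z h ≠ 0 := by rw [hzint]; exact mul_ne_zero hk0 hRpos.ne'
  have hzt : ∫⁻ h, z h ≠ ∞ := by rw [hzint]; exact ENNReal.mul_ne_top hkt hRfin
  have hwint : ∫⁻ h, w h = 2 * (∫⁻ h, ‖L h‖ₑ) + (ENNReal.ofReal (2 * τ) * (∫⁻ h, z h) +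
      ENNReal.ofReal (s ^ d) * ∫⁻ θ in E, F θ) := by
    simp only [hw]
    rw [lintegral_add_left (hLm.const_mul 2), lintegral_const_mul _ hLm,
      lintegral_add_left (hzm.const_mul _), lintegral_const_mul _ hzm,
      lintegral_comp_add_inv_smul hs0 θ₀ (hFm.indicator hEm), lintegral_indicator hEm]
  have htv := tvNorm_normalize_le volume (q := q) (z := z) (W := ∫⁻ h, w h) hzt
    (fun B _ => by
      calc ∫⁻ h in B, q h ≤ ∫⁻ h in B, (z h + w h) := lintegral_mono fun h => (hpt h).1
        _ = (∫⁻ h in B, z h) + ∫⁻ h in B, w h := lintegral_add_left hzm _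
        _ ≤ _ := add_le_add le_rfl (setLIntegral_le_lintegral _ _))
    (fun B _ => by
      calc ∫⁻ h in B, z h ≤ ∫⁻ h in B, (q h + w h) := lintegral_mono fun h => (hpt h).2
        _ = (∫⁻ h in B, q h) + ∫⁻ h in B, w h := lintegral_add_left hqm _
        _ ≤ _ := add_le_add le_rfl (setLIntegral_le_lintegral _ _)) hz0
  rw [multivariateGaussian_eq_withDensity (hr.fisherInfo_posDef hI),
    toEuclideanCLM_localStat μ p θ₀ hI, localFiducial_eq hΘ hr.measurable hJ θ₀ hn,
    ← normalize_withDensity_const_mul volume hk0 hkt hRm]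
  refine htv.trans ?_
  gcongr
  have hdiv : ∀ a : ℝ≥0∞, a / ∫⁻ h, z h ≤ (π θ₀ * ∫⁻ h, ENNReal.ofReal (limitRatio A 0 h))⁻¹ *
      (a / l) := fun a => by
    have h1 : π θ₀ * (∫⁻ h, ENNReal.ofReal (limitRatio A 0 h)) * l ≤ ∫⁻ h, z h := by
      rw [hzint, hk, mul_right_comm]
      exact mul_le_mul_right (lintegral_limitRatio_zero_le A S) _
    calc a / ∫⁻ h, z h ≤ a / (π θ₀ * (∫⁻ h, ENNReal.ofReal (limitRatio A 0 h)) * l) := by gcongr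
      _ = _ := by
        rw [div_eq_mul_inv, div_eq_mul_inv, ENNReal.mul_inv (Or.inr ENNReal.coe_ne_top)
          (Or.inr (ENNReal.coe_ne_zero.2 hlik)), mul_left_comm]
  rw [hwint, add_comm (ENNReal.ofReal (2 * τ) * _), ← add_assoc, ENNReal.add_div,
    ENNReal.mul_div_cancel_right hz0 hzt]
  gcongr
  refine (hdiv _).trans (le_of_eq ?_)
  rw [ENNReal.add_div, mul_div_assoc, mul_div_assoc]

end GFD

theorem theorem1 {𝒴 : Type*} [MeasurableSpace 𝒴] {d : ℕ}
    (μ : Measure 𝒴) [SigmaFinite μ]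
    (Θ : Set (EuclideanSpace ℝ (Fin d))) (hΘ : IsOpen Θ)
    (θ₀ : EuclideanSpace ℝ (Fin d)) (hθ₀ : θ₀ ∈ Θ)
    (p : EuclideanSpace ℝ (Fin d) → 𝒴 → ℝ≥0) (hp : GFD.IsDensityFamily μ Θ p)
    (J : ∀ n : ℕ, (Fin n → 𝒴) → EuclideanSpace ℝ (Fin d) → ℝ≥0)
    (hJ : ∀ n, Measurable (Function.uncurry (J n)))
    -- the fiducial density can be normalized, with probability tending to one
    (hproper : Tendsto (fun n => GFD.sampleLaw μ p n θ₀
      {y | GFD.fiducialNormalizer Θ p J n y = ∞}) atTop (𝓝 0))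
    -- differentiability in quadratic mean, non-singular Fisher information
    (ℓ : 𝒴 → EuclideanSpace ℝ (Fin d)) (hdqm : GFD.DQMAt μ p θ₀ ℓ)
    (hI : IsUnit (GFD.fisherInfo μ p θ₀ ℓ))
    -- convergence of the Jacobian to a limiting density
    (D : ℝ) (hD : 0 < D) (π : EuclideanSpace ℝ (Fin d) → ℝ≥0) (hπ : Measurable π)
    (hJπ : GFD.JacobianConverges μ Θ p J θ₀ D π)
    -- mass of the limiting measure
    (hπc : ContinuousAt π θ₀) (hπpos : 0 < π θ₀)
    -- likelihood splitting
    (p₁ p₂ : ∀ n : ℕ, (Fin n → 𝒴) → EuclideanSpace ℝ (Fin d) → ℝ≥0)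
    (γ : EuclideanSpace ℝ (Fin d) → ℝ≥0)
    (hsplit : GFD.LikelihoodSplits μ Θ p J θ₀ D p₁ p₂ γ)
    -- exponentially consistent tests
    (htests : GFD.ExpConsistentTests μ Θ p θ₀ p₁) :
    GFD.TendstoZeroInProb (fun n => GFD.sampleLaw μ p n θ₀) fun n y =>
      GFD.tvNorm (GFD.localFiducial Θ p J θ₀ n y)
        (multivariateGaussian (GFD.localStat μ p θ₀ ℓ n y) (GFD.fisherInfo μ p θ₀ ℓ)⁻¹) := by
  have hΘm := hΘ.measurableSet
  have hr : GFD.IsRegularAt μ p θ₀ ℓ := by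
    refine ⟨hp.measurable, ?_, hdqm⟩
    have h1 : Tendsto (fun h : EuclideanSpace ℝ (Fin d) => θ₀ + h) (𝓝 0) (𝓝 θ₀) := by
      simpa using (continuous_const_add θ₀).tendsto 0
    exact (h1.eventually (hΘ.mem_nhds hθ₀)).mono fun h hh => hp.lintegral_eq_one _ hh
  obtain ⟨ε₀, hε₀, hlocal⟩ := hr.tendsto_localDiff hI hπ hπc
  obtain ⟨ε₁, hε₁, hball⟩ := Metric.nhds_basis_closedBall.mem_iff.1 (hΘ.mem_nhds hθ₀)
  set ε := min (min ε₀ ε₁) D with hε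
  have hε0 : 0 < ε := lt_min (lt_min hε₀ hε₁) hD
  have hnear := hlocal ε hε0 ((min_le_left _ _).trans (min_le_left _ _))
  have hεΘ : Metric.closedBall θ₀ ε ⊆ Θ := (Metric.closedBall_subset_closedBall
    ((min_le_left _ _).trans (min_le_right _ _))).trans hball
  have hfar := GFD.tendsto_fiducial_far hΘm hθ₀ hp hJ hproper hD hπ hJπ hsplit htests hε0
  have hk : ((π θ₀ : ℝ≥0∞) * ∫⁻ h, ENNReal.ofReal (GFD.limitRatio (Matrix.toEuclideanCLM (𝕜 := ℝ)
      (GFD.fisherInfo μ p θ₀ ℓ)) 0 h))⁻¹ ≠ ∞ := ENNReal.inv_ne_top.2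
    (mul_ne_zero (ENNReal.coe_ne_zero.2 hπpos.ne') (GFD.lintegral_limitRatio_zero_pos _).ne')
  refine GFD.TendstoZeroInProb.of_le fun η hη τ hτ hτt => ?_
  -- the Jacobian is asked to have relative error at most `ρ`, which costs `8 ρ` in total variation
  set ρ : ℝ := min (1 / 2) (τ.toReal / 8) with hρ
  have hτ0 : 0 < τ.toReal := ENNReal.toReal_pos hτ.ne' hτt
  have hρ0 : 0 < ρ := lt_min (by norm_num) (by positivity)
  have hρτ : 4 * ENNReal.ofReal (2 * ρ) ≤ τ := by
    rw [← ENNReal.ofReal_toReal hτt, ← ENNReal.ofReal_ofNat 4,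
      ← ENNReal.ofReal_mul (by norm_num)]
    exact ENNReal.ofReal_le_ofReal (by linarith [min_le_right (1 / 2) (τ.toReal / 8)])
  have hJρ := hJπ (ENNReal.ofReal ρ) (ENNReal.ofReal_pos.2 hρ0)
  refine ⟨fun n => {y | (¬ ENNReal.ofReal ρ ≤ ⨆ θ ∈ Θ ∩ Metric.closedBall θ₀ D,
      ENNReal.ofReal |(J n y θ : ℝ) - (π θ : ℝ)| / (J n y θ : ℝ≥0∞)) ∧
      GFD.likelihood p n y θ₀ ≠ 0}, _, ?_,
    (((hnear.const_mul (ENNReal.ofNat_ne_top (n := 2))).add hfar).const_mul hk).const_mul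
      (ENNReal.ofNat_ne_top (n := 4)), ?_⟩
  · filter_upwards [hJρ.eventually (ge_mem_nhds hη)] with n hn
    have hzero := GFD.sampleLaw_likelihood_eq_zero μ (hr.measurable_apply θ₀) n
    refine le_trans (measure_mono fun y hy => ?_) ((measure_union_le
      {y | ENNReal.ofReal ρ ≤ ⨆ θ ∈ Θ ∩ Metric.closedBall θ₀ D,
        ENNReal.ofReal |(J n y θ : ℝ) - (π θ : ℝ)| / (J n y θ : ℝ≥0∞)}
      {y | GFD.likelihood p n y θ₀ = 0}).trans (by rwa [hzero, add_zero]))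
    by_contra hc
    simp only [Set.mem_union, not_or] at hc
    exact hy hc
  · filter_upwards [eventually_gt_atTop 0] with n hn y hy
    refine (GFD.tvNorm_localFiducial_le hΘm hr hI hJ hπ hπpos (min_le_right _ _) hεΘ hρ0.le
      (min_le_left _ _) hn hy.2 (GFD.abs_sub_le_of_iSup_lt hρ0.le hy.1)).trans ?_
    rw [mul_add]
    exact add_le_add le_rfl hρτ
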